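/- **Setting.** Time is divided into unit slots $[t,t+1)$, $t\in\mathbb Z$. There are $n\ge 1$ jobs $1,\dots,n$ with integer release times $r_j$, deadlines $d_j$ and processing times $p_j\ge 1$. A preemptive schedule assigns to each slot at most one job; a scheduled job $j$ gets exactly $p_j$ slots, all inside $[r_j,d_j)$. We assume that $d_1<\dots<d_n$, that the $r_j$ are pairwise distinct, that $r_1=\min_j r_j$, $p_1=1$, $d_1=r_1+1$, and that some schedule of all the jobs exists. A gap is a maximal finite idle interval; with wake-up cost $L$ the energy of a schedule is the sum of $\min(L,\text{length})$ over its gaps, which for $L=1$ is the number of gaps. $C_{\max}(S)$ is the completion time of $S$. An $(s,k)$-schedule is a partial schedule $S$ that executes exactly the jobs $j\le k$ with $r_s\le r_j<C_{\max}(S)$, where $C_{\max}(S)\le d_k$ is required if $S$ is not empty; the empty one has $C_{\max}=r_s$. An idle period between $r_s$ and its first block counts as a gap, and with respect to $[r_s,t)$, $t\ge C_{\max}(S)$, so does $[C_{\max}(S),t)$ if not empty. An $(s,k,q)$-schedule is an $(s,k)$-schedule for the instance modified by $r_k\leftarrow\max\{r_s,r_k\}$, $p_k\leftarrow q$ ($q\ge0$).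 Let $\mathrm{prevr}_{k}(t)=\max\{r_j: j\le k,\ r_j<t\}$ ($-\infty$ if there is no such $j$), and let $C_{s,i}$ (for $r_i\ge r_s$) be the minimum completion time of $i$ among all $(s,k)$-schedules, $k\ge i$, that execute $i$ and always execute, when busy, a pending job with the earliest deadline. Define * $U_{s,k,g}$ as the maximum completion time of an $(s,k)$-schedule with at most $g$ gaps ($1\le s\le n$, $0\le k\le n$, $0\le g\le n-1$); * $P_{s,k,g,l}$ as the minimum $q\ge 0$ for which there is an $(s,k,q)$-schedule $S$ with $\mathrm{prevr}_{k-1}(r_l)<C_{\max}(S)\le r_l$ and at most $g$ gaps with respect to $[r_s,r_l)$, and $+\infty$ if there is no such $q$ ($1\le s\le n$, $1\le k\le n$, $0\le g\le n-1$, $1\le l<k$, $r_l\ge r_s$). **Algorithm AlgB** computes tables $\mathbf U,\mathbf P$ as follows. $\mathbf U_{s,0,g}=r_s$. For $k=1,\dots,n$: $\mathbf P_{s,k,g,l}=+\infty$ if some $j<k$ has $r_s\le r_j<r_l$ and $C_{s,j}>r_l$; otherwise $\mathbf P_{s,k,g,l}=0$ if $\mathbf U_{s,k-1,g}\ge r_l$;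 otherwise $\mathbf P_{s,k,g,l}$ is the minimum (with $\min\emptyset=+\infty$) of $r_j-\mathbf U_{s,k-1,h}+\mathbf P_{j,k,g-h,l}$ over $0\le h\le g$, $j<k$, $r_s<r_j\le r_l$ with $\mathrm{prevr}_{k-1}(r_j)<\mathbf U_{s,k-1,h}<r_j$ and $r_k\le \mathbf U_{s,k-1,h}$. $\mathbf U_{s,k,g}=\mathbf U_{s,k-1,g}$ if $r_k<r_s$. Otherwise $\mathbf U_{s,k,g}$ is the maximum of the following values, where $(l,h)$ ranges over the pairs with $1\le l<k$, $0\le h\le g$, $r_l\ge r_s$ and, if $s\ge k$, also the pair $(s,0)$ with $\mathbf P_{s,k,0,s}$ read as $0$; write $q=\mathbf P_{s,k,h,l}$, $u=\mathbf U_{l,k-1,g-h}$, $w=\mathbf U_{l,k-1,g-h-1}$: (1) $\mathbf U_{s,k-1,g}$ if $\mathbf U_{s,k-1,g}<r_k$; (2) $u+p_k-q$ if $q\le p_k$, $d_k-u>p_k-q$, $u\ge r_k$ and $u>\mathrm{prevr}_{k-1}(u+p_k-q)$; (3) $d_k$ if $q<p_k$, $d_k-u\le p_k-q$ and $u>\mathrm{prevr}_{k-1}(d_k)$;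 (4) $d_k$ if $h<g$, $q<p_k$, $d_k-w>p_k-q$ and $w>\mathrm{prevr}_{k-1}(d_k)$. The answer is the smallest $g\in\{0,\dots,n-1\}$ with $\mathbf U_{1,n,g}>\max_j r_j$. **Theorem.** For every such instance, $\mathbf U_{s,k,g}=U_{s,k,g}$ and $\mathbf P_{s,k,g,l}=P_{s,k,g,l}$ for all indices in the above ranges (in particular, the maximum in the definition of $U_{s,k,g}$ exists and $\mathbf U_{s,k,g}$ is always defined), and the answer is defined and is the minimum number of gaps, and the minimum energy for $L=1$, over all schedules of the whole instance. Moreover, Algorithm AlgB can be implemented in time $O(n^5)$: there are a program for a unit-cost random access machine (integer registers and arrays, addition, subtraction, comparisons) and a constant $K$ such that, on every such instance, the program halts after at most $K n^5$ steps having computed both tables and the answer. -/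

import Mathlib

/-! Single-processor preemptive scheduling in discrete time, gaps and energy, the tables of the
dynamic program, the dynamic program itself, and a unit-cost random access machine. -/

namespace GapSched

/-- An instance with `n` jobs, numbered `1, …, n`: job `j` has release time `r j`, deadline `d j`
and processing time `p j`. Values at indices outside `1, …, n` play no role. -/
structure Jobs where
  n : ℕ
  r : ℕ → ℤ
  d : ℕ → ℤ
  p : ℕ → ℕ

/-- A (partial) preemptive schedule: which job, if any, is executed in the time slot
`[t, t + 1)`. -/
abbrev Schedule := ℤ → Option ℕ

namespace Schedule

/-- `S` is busy in time slot `t`. -/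
def Busy (S : Schedule) (t : ℤ) : Prop := S t ≠ none

open Classical in
/-- The completion time `C_max` of `S`; that of the empty schedule is set to `a`. -/
noncomputable def cmax (S : Schedule) (a : ℤ) : ℤ :=
  if ∃ t, S.Busy t then sSup {c | ∃ t, S.Busy t ∧ c = t + 1} else a

/-- The gaps `[u, v)` of `S`: the maximal finite idle intervals. -/
def gaps (S : Schedule) : Set (ℤ × ℤ) :=
  {I | I.1 < I.2 ∧ S.Busy (I.1 - 1) ∧ S.Busy I.2 ∧ ∀ t, I.1 ≤ t → t < I.2 → ¬ S.Busy t}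

/-- The energy wasted by `S` for wake-up cost `L`: a gap of length `x` costs `min x L`. -/
noncomputable def energy (L : ℤ) (S : Schedule) : ℤ :=
  ∑ᶠ I ∈ S.gaps, min (I.2 - I.1) L

/-- The gaps of `S` with respect to the window `[a, b)`: the inclusion-wise maximal idle
subintervals `[u, v)` of `[a, b)`. -/
def gapsIn (S : Schedule) (a b : ℤ) : Set (ℤ × ℤ) :=
  {I | a ≤ I.1 ∧ I.1 < I.2 ∧ I.2 ≤ b ∧ (I.1 = a ∨ S.Busy (I.1 - 1)) ∧ (I.2 = b ∨ S.Busy I.2) ∧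
    ∀ t, I.1 ≤ t → t < I.2 → ¬ S.Busy t}

/-- The completion time of job `i` in `S` is `c`. -/
def CompletesAt (S : Schedule) (i : ℕ) (c : ℤ) : Prop :=
  S (c - 1) = some i ∧ ∀ t, c ≤ t → S t ≠ some i

end Schedule

namespace Jobs

variable (I : Jobs)

/-- `S` executes exactly the jobs in `J`, each of them completely and between its release time
and its deadline. -/
def Executes (J : Set ℕ) (S : Schedule) : Prop :=
  (∀ t j, S t = some j → j ∈ J ∧ I.r j ≤ t ∧ t < I.d j) ∧
  ∀ j ∈ J, {t | S t = some j}.ncard = I.p j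

/-- `S` is a schedule of the whole instance. -/
def IsSchedule (S : Schedule) : Prop := I.Executes (Set.Icc 1 I.n) S

/-- The standing assumptions: positive processing times, jobs ordered by deadlines, distinct
deadlines, distinct release times, job `1` has unit length and has to be executed at the minimum
release time, and the instance is feasible. -/
structure Normalized : Prop where
  one_le_n : 1 ≤ I.n
  p_pos : ∀ j ∈ Set.Icc 1 I.n, 1 ≤ I.p j
  d_strictMono : StrictMonoOn I.d (Set.Icc 1 I.n)
  r_injOn : Set.InjOn I.r (Set.Icc 1 I.n)
  r_one_le : ∀ j ∈ Set.Icc 1 I.n, I.r 1 ≤ I.r j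
  p_one : I.p 1 = 1
  d_one : I.d 1 = I.r 1 + 1
  feasible : ∃ S, I.IsSchedule S

/-- `(s,k)`-schedules: partial schedules that execute exactly the jobs `j ≤ k` with
`r_s ≤ r_j < C_max(S)`, where `C_max(S) ≤ d_k` unless `S` is empty. The completion time of the
empty schedule is `r_s`. -/
def IsSK (s k : ℕ) (S : Schedule) : Prop :=
  ((∃ t, S.Busy t) → S.cmax (I.r s) ≤ I.d k) ∧
  I.Executes {j | 1 ≤ j ∧ j ≤ k ∧ I.r s ≤ I.r j ∧ I.r j < S.cmax (I.r s)} S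

/-- The instance in which the release time of `k` is `max r_s r_k` and its processing time `q`. -/
def modify (s k q : ℕ) : Jobs where
  n := I.n
  r := Function.update I.r k (max (I.r s) (I.r k))
  d := I.d
  p := Function.update I.p k q

/-- `(s,k,q)`-schedules. -/
def IsSKP (s k q : ℕ) (S : Schedule) : Prop := (I.modify s k q).IsSK s k S

/-- The completion times of the `(s,k)`-schedules with at most `g` gaps, where an idle period
between `r_s` and the first block counts as a gap. -/
def completions (s k g : ℕ) : Set ℤ :=
  {c | ∃ S, I.IsSK s k S ∧ (S.gapsIn (I.r s) (S.cmax (I.r s))).ncard ≤ g ∧ c = S.cmax (I.r s)}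

/-- `U_{s,k,g}`, the maximum completion time of an `(s,k)`-schedule with at most `g` gaps. -/
noncomputable def U (s k g : ℕ) : ℤ := sSup (I.completions s k g)

/-- The latest release time before `t` of a job `j ≤ k`, and `⊥` (for `-∞`) if there is none. -/
def prevr (k : ℕ) (t : ℤ) : WithBot ℤ :=
  ((Finset.Icc 1 k).filter (fun j => I.r j < t)).sup (fun j => (I.r j : WithBot ℤ))

/-- The amounts `q` of job `k` for which there is an `(s,k,q)`-schedule `S` that satisfies
`prevr_{k-1}(r_l) < C_max(S) ≤ r_l` and has at most `g` gaps with respect to `[r_s, r_l)`. -/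
def amounts (s k g l : ℕ) : Set ℕ :=
  {q | ∃ S, I.IsSKP s k q S ∧ I.prevr (k - 1) (I.r l) < (S.cmax (I.r s) : WithBot ℤ) ∧
    S.cmax (I.r s) ≤ I.r l ∧ (S.gapsIn (I.r s) (I.r l)).ncard ≤ g}

/-- `P_{s,k,g,l}`, the minimum of `amounts s k g l`, and `⊤` (for `+∞`) if there is no such
amount. -/
noncomputable def P (s k g l : ℕ) : ℕ∞ := ⨅ q ∈ I.amounts s k g l, (q : ℕ∞)

/-- The earliest-deadline property: the job executed at `t` has the earliest deadline among the
jobs pending at `t`. In a schedule that completes all the jobs it executes, such a job is pending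
at `t` if it is released at `t` or before and is executed at some time `t' ≥ t`. -/
def EarliestDeadline (S : Schedule) : Prop :=
  ∀ t j, S t = some j → ∀ t' i, t ≤ t' → S t' = some i → I.r i ≤ t → I.d j ≤ I.d i

/-- `C_{s,i}`, the minimum completion time of job `i` among all earliest-deadline
`(s,k)`-schedules, `k ≥ i`, that execute `i`. -/
noncomputable def earliest (s i : ℕ) : ℤ :=
  sInf {c | ∃ k S, i ≤ k ∧ k ≤ I.n ∧ I.IsSK s k S ∧ I.EarliestDeadline S ∧ S.CompletesAt i c}

/-! ### The algorithm -/

/-- The entry `P[s,k,g,l]`, computed from the values `V s g = U[s,k-1,g]`. In the recurrence, the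
condition `prevr_{k-1}(r_j) < V s h` excludes the case `V s h = ⊥`. -/
noncomputable def stepP (k : ℕ) (V : ℕ → ℕ → WithBot ℤ) (l s g : ℕ) : ℕ∞ :=
  if ∃ j ∈ Finset.Ico 1 k, I.r s ≤ I.r j ∧ I.r j < I.r l ∧ I.r l < I.earliest s j then ⊤
  else if (I.r l : WithBot ℤ) ≤ V s g then 0
  else
    (Finset.range (g + 1)).inf fun h => (Finset.Ico 1 k).inf fun j =>
      if _hj : I.r s < I.r j ∧ I.r j ≤ I.r l ∧ I.prevr (k - 1) (I.r j) < V s h ∧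
          V s h < (I.r j : WithBot ℤ) ∧ (I.r k : WithBot ℤ) ≤ V s h then
        ((I.r j - (V s h).unbotD 0).toNat : ℕ∞) + stepP k V l j (g - h)
      else ⊤
termination_by (I.r l - I.r s).toNat
decreasing_by omega

/-- The last three options in the maximum that defines `U[s,k,g]`, for a pair `(l,h)`, in terms of
`q = P[s,k,h,l]` and `V g' = U[l,k-1,g']`. The value of an option that is not applicable is `⊥`;
an option is applicable only if the value of `V` in it is not `⊥`. -/
noncomputable def optU (k g h : ℕ) (q : ℕ∞) (V : ℕ → WithBot ℤ) : WithBot ℤ :=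
  let rest : ℤ := (I.p k : ℤ) - (q.toNat : ℤ)
  let u : ℤ := (V (g - h)).unbotD 0
  let w : ℤ := (V (g - h - 1)).unbotD 0
  max
    (if q ≤ (I.p k : ℕ∞) ∧ I.d k - u > rest ∧ u ≥ I.r k ∧ V (g - h) > I.prevr (k - 1) (u + rest)
      then ((u + rest : ℤ) : WithBot ℤ) else ⊥)
    (max
      (if q < (I.p k : ℕ∞) ∧ I.d k - u ≤ rest ∧ V (g - h) > I.prevr (k - 1) (I.d k)
        then (I.d k : WithBot ℤ) else ⊥)
      (if h < g ∧ q < (I.p k : ℕ∞) ∧ I.d k - w > rest ∧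
          V (g - h - 1) > I.prevr (k - 1) (I.d k)
        then (I.d k : WithBot ℤ) else ⊥))

/-- The entry `U[s,k,g]`, computed from the values `V s g = U[s,k-1,g]`. The pairs `(l,h)` are those
with `1 ≤ l < k`, `0 ≤ h ≤ g` and `r_l ≥ r_s`, and if `s ≥ k` also the pair `(s,0)`, for which
`P[s,k,0,s]` is interpreted as `0`. -/
noncomputable def stepU (k : ℕ) (V : ℕ → ℕ → WithBot ℤ) (s g : ℕ) : WithBot ℤ :=
  if I.r k < I.r s then V s g
  else
    max (if V s g < (I.r k : WithBot ℤ) then V s g else ⊥)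
      (max
        ((Finset.range (g + 1)).sup fun h =>
          ((Finset.Ico 1 k).filter (fun l => I.r s ≤ I.r l)).sup fun l =>
            I.optU k g h (I.stepP k V l s h) (V l))
        (if k ≤ s then I.optU k g 0 0 (V s) else ⊥))

/-- The table `U[s,k,g]` of the algorithm; `⊥` is the maximum of the empty set of options. -/
noncomputable def algU : ℕ → ℕ → ℕ → WithBot ℤ
  | s, 0, _ => (I.r s : WithBot ℤ)
  | s, k + 1, g => I.stepU (k + 1) (fun s' g' => algU s' k g') s g

/-- The table `P[s,k,g,l]` of the algorithm (for `k ≥ 1`). -/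
noncomputable def algP (s k g l : ℕ) : ℕ∞ :=
  I.stepP k (fun s' g' => I.algU s' (k - 1) g') l s g

/-- The answer of the algorithm: the smallest `g` in `0, …, n - 1` with
`U[1,n,g] > max_j r_j`, and `⊤` if there is none. -/
noncomputable def algGaps : ℕ∞ :=
  ((Finset.range I.n).filter fun g =>
    (Finset.Icc 1 I.n).sup (fun j => (I.r j : WithBot ℤ)) < I.algU 1 I.n g).inf
      fun g => (g : ℕ∞)

end Jobs

/-! ### A unit-cost random access machine

Programs are finite texts of a structured language over integer registers `x` and integer arrays
`a[i₁, …, i_m]`. The only arithmetic operations are addition and subtraction, and the only tests are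
comparisons. Every occurrence of an operation, operand, test or access costs one step. -/

/-- Arithmetic expressions. -/
inductive Expr where
  | const (z : ℤ)
  | reg (x : ℕ)
  | add (e f : Expr)
  | sub (e f : Expr)

/-- Programs. `ite e f c c'` executes `c` if `e ≤ f` and `c'` otherwise; `loop e f c` repeats `c` as
long as `e ≤ f`. -/
inductive Prog where
  | skip
  | assign (x : ℕ) (e : Expr)
  | load (x a : ℕ) (idx : List Expr)
  | store (a : ℕ) (idx : List Expr) (e : Expr)
  | seq (c c' : Prog)
  | ite (e f : Expr) (c c' : Prog)
  | loop (e f : Expr) (c : Prog)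

/-- The memory: registers, and arrays of every dimension. -/
structure Mem where
  reg : ℕ → ℤ
  arr : ℕ → List ℤ → ℤ

/-- The value of an expression. -/
def Expr.val (m : Mem) : Expr → ℤ
  | const z => z
  | reg x => m.reg x
  | add e f => e.val m + f.val m
  | sub e f => e.val m - f.val m

/-- The number of steps for evaluating an expression. -/
def Expr.cost : Expr → ℕ
  | const _ => 1
  | reg _ => 1
  | add e f => e.cost + f.cost + 1
  | sub e f => e.cost + f.cost + 1

/-- The number of steps for evaluating a list of indices. -/
def idxCost (idx : List Expr) : ℕ := (idx.map Expr.cost).sum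

/-- `Runs c m t m'`: the program `c`, started in memory `m`, halts after `t` steps in memory
`m'`. -/
inductive Runs : Prog → Mem → ℕ → Mem → Prop
  | skip (m : Mem) : Runs .skip m 1 m
  | assign (m : Mem) (x : ℕ) (e : Expr) :
      Runs (.assign x e) m (e.cost + 1) ⟨Function.update m.reg x (e.val m), m.arr⟩
  | load (m : Mem) (x a : ℕ) (idx : List Expr) :
      Runs (.load x a idx) m (idxCost idx + 1)
        ⟨Function.update m.reg x (m.arr a (idx.map (Expr.val m))), m.arr⟩
  | store (m : Mem) (a : ℕ) (idx : List Expr) (e : Expr) :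
      Runs (.store a idx e) m (idxCost idx + e.cost + 1)
        ⟨m.reg, Function.update m.arr a
          (Function.update (m.arr a) (idx.map (Expr.val m)) (e.val m))⟩
  | seq {m m' m'' : Mem} {c c' : Prog} {t t' : ℕ} (h : Runs c m t m') (h' : Runs c' m' t' m'') :
      Runs (.seq c c') m (t + t') m''
  | ite_true {m m' : Mem} {e f : Expr} {c c' : Prog} {t : ℕ} (hle : e.val m ≤ f.val m)
      (h : Runs c m t m') : Runs (.ite e f c c') m (e.cost + f.cost + 1 + t) m'
  | ite_false {m m' : Mem} {e f : Expr} {c c' : Prog} {t : ℕ} (hlt : f.val m < e.val m)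
      (h : Runs c' m t m') : Runs (.ite e f c c') m (e.cost + f.cost + 1 + t) m'
  | loop_end {m : Mem} {e f : Expr} {c : Prog} (hlt : f.val m < e.val m) :
      Runs (.loop e f c) m (e.cost + f.cost + 1) m
  | loop_step {m m' m'' : Mem} {e f : Expr} {c : Prog} {t t' : ℕ} (hle : e.val m ≤ f.val m)
      (h : Runs c m t m') (h' : Runs (.loop e f c) m' t' m'') :
      Runs (.loop e f c) m (e.cost + f.cost + 1 + t + t') m''

namespace Jobs

variable (I : Jobs)

/-- The initial memory: register `0` holds `n`, the arrays `0`, `1`, `2` hold the release times,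
deadlines and processing times of the jobs `1, …, n`, and everything else is `0`. -/
def input : Mem where
  reg x := if x = 0 then (I.n : ℤ) else 0
  arr a idx :=
    match idx with
    | [j] =>
      if 1 ≤ j ∧ j ≤ I.n then
        if a = 0 then I.r j.toNat
        else if a = 1 then I.d j.toNat
        else if a = 2 then (I.p j.toNat : ℤ)
        else 0
      else 0
    | _ => 0

open Classical in
/-- How table entries `P[s,k,g,l]` are stored: `+∞` as `-1`. -/
noncomputable def encode (q : ℕ∞) : ℤ := if q = ⊤ then -1 else (q.toNat : ℤ)

/-- The memory `m` holds the results of the algorithm: the array `3` holds the table `U[s,k,g]`,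
the array `4` holds the table `P[s,k,g,l]`, and register `1` holds the answer. -/
def HoldsResults (m : Mem) : Prop :=
  (∀ s k g : ℕ, 1 ≤ s → s ≤ I.n → k ≤ I.n → g < I.n →
    I.algU s k g = (m.arr 3 [(s : ℤ), (k : ℤ), (g : ℤ)] : WithBot ℤ)) ∧
  (∀ s k g l : ℕ, 1 ≤ s → s ≤ I.n → 1 ≤ k → k ≤ I.n → g < I.n → 1 ≤ l → l < k →
    I.r s ≤ I.r l →
      m.arr 4 [(s : ℤ), (k : ℤ), (g : ℤ), (l : ℤ)] = encode (I.algP s k g l)) ∧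
  m.reg 1 = encode I.algGaps

end Jobs

end GapSched

/-! Partial schedules are described by workloads: `Fits` says how many units of every job are
executed in a window. Three exchange arguments carry the proof. A schedule can be compressed into
`[a, t)` without new gaps there as soon as no interval `[x, t)` is overloaded by the work released
in it (`Fits.compress`): the last hole before `t` is filled from the right. Units can be put in
earliest-deadline order without changing the busy slots (`Fits.edf`). A job released at the start of
a window starts a busy block in which exactly the jobs released during the block are finished
(`Fits.exists_block`).

For `P`, consider an earliest-deadline schedule with the least amount of `k`, the job with the
latest deadline. When `k` first runs, at `t₀`, no other job is pending. So the schedule splits into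
a schedule of jobs below `k`, a stretch of `k` alone up to the next release time `r_j`, and a
problem of the same kind starting at `r_j`. Minimality excludes idle slots in the stretch, and it
forces `t₀ ≤ U_{s,k-1,h} < r_j`, where `h` counts the gaps before `t₀` (`exists_split_of_isLeast`,
`stepP_eq`). The test of the algorithm by the times `C_{s,j}` detects overload exactly
(`overloaded_iff`).

For `U`, consider an optimal schedule in earliest-deadline order whose busy slots lie as late as
possible, so that no unit of `k` is followed by an idle slot before the end. The last unit of `k`
that precedes another job is then followed at once by a job `l` released at that moment. From `r_l`
on, the other jobs come first, up to a time `c₁`, and then only `k`. By monotonicity the amount of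
`k` before `r_l` may be replaced by its minimum `P`, and `c₁` by a maximum `U_{l,k-1}`. If there is
an idle slot between `c₁` and the end, then the end is `d_k` (`exists_split_of_isGreatest`).
Conversely, every option of the recurrence is realized by a schedule (`exists_completion_ge`,
`d_mem_completions`). Together this is `stepU_eq`.

Job `1` occupies the slot at `r_1`, so the gaps of a complete schedule are its gaps in the window
that `U_{1,n,g}` speaks of. If all busy slots are pushed to the left, every gap ends at the release
time of a job other than `1`; hence `n - 1` gaps suffice.

The running time is bounded through the nesting depth of loops with at most `n` iterations. Two
auxiliary tables keep the depth at five. One contains the first release at or after `U_{s,k-1,g}`,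
which decides the comparisons with `prevr` and determines the only possible `j` in the recurrence
for `P`. The other one contains the overloaded pairs `(s,l)`, for which intervals that begin at
release times suffice. -/

namespace GapSched

/-- `S` executes exactly `w j` units of every job `j`, within `[a, b)` and between the release
times `r` and the deadlines `d`. -/
structure Fits (r d : ℕ → ℤ) (w : ℕ → ℕ) (a b : ℤ) (S : Schedule) : Prop where
  window : ∀ t j, S t = some j → a ≤ t ∧ t < b
  release : ∀ t j, S t = some j → r j ≤ t
  deadline : ∀ t j, S t = some j → t < d j
  amount : ∀ j, {t | S t = some j}.ncard = w j

/-! ### Counting gaps by their left end points -/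

namespace Schedule

theorem busy_iff {S : Schedule} {t : ℤ} : S.Busy t ↔ ∃ j, S t = some j :=
  Option.ne_none_iff_exists'

theorem not_busy_iff {S : Schedule} {t : ℤ} : ¬ S.Busy t ↔ S t = none := by
  simp [Busy]

open Classical in
/-- The number of gaps with respect to `[a, b)`, counted by their left end points. -/
noncomputable def gapCount (S : Schedule) (a b : ℤ) : ℕ :=
  ((Finset.Ico a b).filter fun t => ¬ S.Busy t ∧ (t = a ∨ S.Busy (t - 1))).card

theorem exists_first {p : ℤ → Prop} {a b : ℤ} (hab : a ≤ b) (hb : p b) :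
    ∃ c, a ≤ c ∧ c ≤ b ∧ p c ∧ ∀ t, a ≤ t → t < c → ¬ p t := by
  classical
  obtain ⟨c, ⟨hc1, hc2⟩, hc⟩ := Int.exists_least_of_bdd (P := fun c => a ≤ c ∧ p c)
    ⟨a, fun z hz => hz.1⟩ ⟨b, hab, hb⟩
  exact ⟨c, hc1, hc b ⟨hab, hb⟩, hc2, fun t ht htc hp => absurd (hc t ⟨ht, hp⟩) (by omega)⟩

theorem exists_last {p : ℤ → Prop} {a b : ℤ} (hab : a ≤ b) (ha : p a) :
    ∃ c, a ≤ c ∧ c ≤ b ∧ p c ∧ ∀ t, c < t → t ≤ b → ¬ p t := by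
  classical
  obtain ⟨c, ⟨hc1, hc2⟩, hc⟩ := Int.exists_greatest_of_bdd (P := fun c => c ≤ b ∧ p c)
    ⟨b, fun z hz => hz.1⟩ ⟨a, hab, ha⟩
  exact ⟨c, hc a ⟨hab, ha⟩, hc1, hc2, fun t ht htc hp => absurd (hc t ⟨htc, hp⟩) (by omega)⟩

/-- A gap is determined by its left end: its right end is the first later point that is busy or
equal to `b`. -/
theorem ncard_gapsIn (S : Schedule) (a b : ℤ) : (S.gapsIn a b).ncard = S.gapCount a b := by
  classical
  rw [gapCount, ← Set.ncard_coe_finset]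
  refine Set.ncard_congr (fun I _ => I.1) ?_ ?_ ?_
  · rintro ⟨u, v⟩ ⟨h1, h2, h3, h4, h5, h6⟩
    simp only at *
    simp only [Finset.coe_filter, Finset.mem_Ico, Set.mem_ofPred_eq]
    exact ⟨⟨h1, by omega⟩, h6 u le_rfl h2, h4⟩
  · rintro ⟨u, v⟩ ⟨u', v'⟩ ⟨h1, h2, h3, h4, h5, h6⟩ ⟨h1', h2', h3', h4', h5', h6'⟩ huu
    simp only at *
    subst huu
    have : v = v' := by
      rcases lt_trichotomy v v' with h | h | h
      · rcases h5 with h5 | h5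
        · omega
        · exact absurd h5 (h6' v (by omega) h)
      · exact h
      · rcases h5' with h5' | h5'
        · omega
        · exact absurd h5' (h6 v' (by omega) h)
    rw [this]
  · intro u hu
    simp only [Finset.coe_filter, Finset.mem_Ico, Set.mem_ofPred_eq] at hu
    obtain ⟨⟨hu1, hu2⟩, hu3, hu4⟩ := hu
    obtain ⟨c, hc1, hc2, hc3, hc4⟩ := exists_first (p := fun t => t = b ∨ S.Busy t)
      hu2.le (Or.inl rfl)
    refine ⟨(u, c), ⟨hu1, ?_, hc2, hu4, hc3, fun t ht htc hb => hc4 t ht htc (Or.inr hb)⟩, rfl⟩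
    rcases hc1.lt_or_eq with h | h
    · exact h
    · subst h
      rcases hc3 with h | h
      · omega
      · exact absurd h hu3

theorem gapCount_congr {S S' : Schedule} {a b : ℤ}
    (h : ∀ t, a ≤ t → t < b → (S.Busy t ↔ S'.Busy t)) : S.gapCount a b = S'.gapCount a b := by
  classical
  unfold gapCount
  congr 1
  refine Finset.filter_congr fun t ht => ?_
  rw [Finset.mem_Ico] at ht
  rw [h t ht.1 ht.2]
  by_cases hta : t = a
  · simp [hta]
  · rw [h (t - 1) (by omega) (by omega)]

theorem gapCount_self (S : Schedule) (a : ℤ) : S.gapCount a a = 0 := by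
  simp [gapCount]

theorem gapCount_le_add (S : Schedule) {a c b : ℤ} (hac : a ≤ c) :
    S.gapCount a b ≤ S.gapCount a c + S.gapCount c b := by
  classical
  unfold gapCount
  refine le_trans (Finset.card_le_card ?_) (Finset.card_union_le _ _)
  intro t ht
  simp only [Finset.mem_filter, Finset.mem_union, Finset.mem_Ico] at ht ⊢
  by_cases h : t < c
  · exact Or.inl ⟨⟨ht.1.1, h⟩, ht.2⟩
  · refine Or.inr ⟨⟨by omega, ht.1.2⟩, ht.2.1, ?_⟩
    rcases ht.2.2 with h' | h'
    · left; omega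
    · exact Or.inr h'

/-- Cutting at `c` counts a gap twice only if `c` lies in its interior, which `hc` excludes. -/
theorem gapCount_add (S : Schedule) {a c b : ℤ} (hac : a ≤ c) (hcb : c ≤ b)
    (hc : c = a ∨ S.Busy (c - 1) ∨ S.Busy c) :
    S.gapCount a c + S.gapCount c b = S.gapCount a b := by
  classical
  refine le_antisymm ?_ (S.gapCount_le_add hac)
  unfold gapCount
  rw [← Finset.card_union_of_disjoint]
  · refine Finset.card_le_card fun t ht => ?_
    simp only [Finset.mem_filter, Finset.mem_union, Finset.mem_Ico] at ht ⊢
    rcases ht with ht | ht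
    · exact ⟨⟨ht.1.1, by omega⟩, ht.2⟩
    · refine ⟨⟨by omega, ht.1.2⟩, ht.2.1, ?_⟩
      rcases ht.2.2 with h' | h'
      · subst h'
        rcases hc with h | h | h
        · exact Or.inl h
        · exact Or.inr h
        · exact absurd h ht.2.1
      · exact Or.inr h'
  · rw [Finset.disjoint_left]
    intro t ht ht'
    simp only [Finset.mem_filter, Finset.mem_Ico] at ht ht'
    omega

theorem gapCount_mono_right (S : Schedule) {a c b : ℤ} (hcb : c ≤ b) :
    S.gapCount a c ≤ S.gapCount a b := by
  classical
  unfold gapCount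
  refine Finset.card_le_card fun t ht => ?_
  simp only [Finset.mem_filter, Finset.mem_Ico] at ht ⊢
  exact ⟨⟨ht.1.1, by omega⟩, ht.2⟩

theorem gapCount_eq_zero {S : Schedule} {a b : ℤ} (h : ∀ t, a ≤ t → t < b → S.Busy t) :
    S.gapCount a b = 0 := by
  classical
  unfold gapCount
  rw [Finset.card_eq_zero, Finset.filter_eq_empty_iff]
  intro t ht
  rw [Finset.mem_Ico] at ht
  simp [h t ht.1 ht.2]

theorem one_le_gapCount {S : Schedule} {a b t : ℤ} (hat : a ≤ t) (htb : t < b)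
    (h : ¬ S.Busy t) : 1 ≤ S.gapCount a b := by
  classical
  obtain ⟨c, hc1, hc2, hc3, hc4⟩ := exists_first (p := fun t => ¬ S.Busy t) hat h
  unfold gapCount
  refine Finset.card_pos.2 ⟨c, ?_⟩
  simp only [Finset.mem_filter, Finset.mem_Ico]
  refine ⟨⟨hc1, by omega⟩, hc3, ?_⟩
  by_cases h' : c = a
  · exact Or.inl h'
  · exact Or.inr (not_not.1 (hc4 (c - 1) (by omega) (by omega)))

/-- An idle interval makes at most one gap. -/
theorem gapCount_le_one {S : Schedule} {a b : ℤ} (h : ∀ t, a ≤ t → t < b → ¬ S.Busy t) :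
    S.gapCount a b ≤ 1 := by
  classical
  unfold gapCount
  refine le_trans (Finset.card_le_card (t := {a}) fun t ht => ?_) (by simp)
  simp only [Finset.mem_filter, Finset.mem_Ico, Finset.mem_singleton] at ht ⊢
  rcases ht.2.2 with h' | h'
  · exact h'
  · by_contra hne
    exact h (t - 1) (by omega) (by omega) h'

/-- Filling an idle slot next to a busy slot, or the last idle slot, does not create a gap. -/
theorem gapCount_fill_le {S S' : Schedule} {a b e : ℤ}
    (h : ∀ t, a ≤ t → t < b → (S'.Busy t ↔ t = e ∨ S.Busy t))
    (he : e + 1 < b → S.Busy (e + 1)) :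
    S'.gapCount a b ≤ S.gapCount a b := by
  classical
  unfold gapCount
  refine Finset.card_le_card fun t ht => ?_
  simp only [Finset.mem_filter, Finset.mem_Ico] at ht ⊢
  obtain ⟨⟨h1, h2⟩, h3, h4⟩ := ht
  rw [h t h1 h2] at h3
  push Not at h3
  refine ⟨⟨h1, h2⟩, h3.2, ?_⟩
  rcases h4 with h4 | h4
  · exact Or.inl h4
  · by_cases hta : t = a
    · exact Or.inl hta
    · rw [h (t - 1) (by omega) (by omega)] at h4
      rcases h4 with h4 | h4
      · exact absurd (he (by omega)) (by rw [← h4]; simpa using h3.2)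
      · exact Or.inr h4

end Schedule

/-! ### Elementary operations on schedules with a given workload -/

variable {r d : ℕ → ℤ} {w : ℕ → ℕ} {a b : ℤ} {S : Schedule}

namespace Fits

theorem finite (h : Fits r d w a b S) (j : ℕ) : {t | S t = some j}.Finite :=
  (Set.finite_Ico a b).subset fun t ht => h.window t j ht

theorem amount_ne_zero (h : Fits r d w a b S) {t : ℤ} {j : ℕ} (ht : S t = some j) : w j ≠ 0 := by
  rw [← h.amount j]
  exact ((Set.ncard_pos (h.finite j)).2 ⟨t, ht⟩).ne'

theorem exists_slot (h : Fits r d w a b S) {j : ℕ} (hw : w j ≠ 0) : ∃ t, S t = some j := by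
  rw [← h.amount j] at hw
  obtain ⟨t, ht⟩ := Set.nonempty_of_ncard_ne_zero hw
  exact ⟨t, ht⟩

theorem busy_window (h : Fits r d w a b S) {t : ℤ} (ht : S.Busy t) : a ≤ t ∧ t < b := by
  obtain ⟨j, hj⟩ := Schedule.busy_iff.1 ht
  exact h.window t j hj

open Classical in
theorem sum_eq (h : Fits r d w a b S) (A : Finset ℕ) :
    ∑ j ∈ A, w j = ((Finset.Ico a b).filter fun t => ∃ j ∈ A, S t = some j).card := by
  have : ((Finset.Ico a b).filter fun t => ∃ j ∈ A, S t = some j) =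
      A.biUnion fun j => (Finset.Ico a b).filter fun t => S t = some j := by
    ext t
    simp only [Finset.mem_filter, Finset.mem_biUnion]
    constructor
    · rintro ⟨h1, j, hj, h2⟩
      exact ⟨j, hj, h1, h2⟩
    · rintro ⟨j, hj, h1, h2⟩
      exact ⟨h1, j, hj, h2⟩
  rw [this, Finset.card_biUnion]
  · refine Finset.sum_congr rfl fun j _ => ?_
    rw [← h.amount j, ← Set.ncard_coe_finset]
    congr 1
    ext t
    simp only [Set.mem_ofPred_eq, Finset.coe_filter, Finset.mem_Ico]
    exact ⟨fun ht => ⟨h.window t j ht, ht⟩, fun ht => ht.2⟩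
  · intro i _ j _ hij
    rw [Function.onFun, Finset.disjoint_left]
    intro t ht ht'
    simp only [Finset.mem_filter] at ht ht'
    exact hij (by simpa using ht.2.symm.trans ht'.2)

theorem congr (h : Fits r d w a b S) {w' : ℕ → ℕ} (hw : ∀ j, w j = w' j) : Fits r d w' a b S := by
  have : w = w' := funext hw
  rwa [← this]

theorem mono (h : Fits r d w a b S) {r' d' : ℕ → ℤ} {a' b' : ℤ}
    (h' : ∀ t j, S t = some j → a' ≤ t ∧ t < b' ∧ r' j ≤ t ∧ t < d' j) :
    Fits r' d' w a' b' S where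
  window t j ht := ⟨(h' t j ht).1, (h' t j ht).2.1⟩
  release t j ht := (h' t j ht).2.2.1
  deadline t j ht := (h' t j ht).2.2.2
  amount := h.amount

theorem comp (h : Fits r d w a b S) (σ : Equiv.Perm ℤ) {a' b' : ℤ}
    (h' : ∀ t j, S (σ t) = some j → a' ≤ t ∧ t < b' ∧ r j ≤ t ∧ t < d j) :
    Fits r d w a' b' (S ∘ σ) where
  window t j ht := ⟨(h' t j ht).1, (h' t j ht).2.1⟩
  release t j ht := (h' t j ht).2.2.1
  deadline t j ht := (h' t j ht).2.2.2
  amount j := by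
    rw [← h.amount j]
    have : {t | S t = some j} = σ '' {t | (S ∘ σ) t = some j} := by
      ext t
      constructor
      · intro ht
        exact ⟨σ.symm t, by simpa using ht, by simp⟩
      · rintro ⟨u, hu, rfl⟩
        exact hu
    rw [this, Set.ncard_image_of_injective _ σ.injective]

/-- Moving one unit of a job to an idle slot. -/
theorem move (h : Fits r d w a b S) {e y : ℤ} {j : ℕ} (hy : S y = some j) (he : S e = none)
    (hr : r j ≤ e) (hd : e < d j) (hae : a ≤ e) (heb : e < b) :
    Fits r d w a b (S ∘ Equiv.swap e y) := by
  refine h.comp _ fun t i ht => ?_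
  by_cases h1 : t = e
  · subst h1
    rw [Equiv.swap_apply_left, hy] at ht
    cases ht
    exact ⟨hae, heb, hr, hd⟩
  · by_cases h2 : t = y
    · subst h2
      rw [Equiv.swap_apply_right, he] at ht
      cases ht
    · rw [Equiv.swap_apply_of_ne_of_ne h1 h2] at ht
      exact ⟨(h.window t i ht).1, (h.window t i ht).2, h.release t i ht, h.deadline t i ht⟩

theorem concat {w₁ w₂ : ℕ → ℕ} {c : ℤ} {S₁ S₂ : Schedule} (h₁ : Fits r d w₁ a b S₁)
    (h₂ : Fits r d w₂ b c S₂) (hab : a ≤ b) (hbc : b ≤ c) :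
    Fits r d (w₁ + w₂) a c (fun t => if t < b then S₁ t else S₂ t) where
  window t j ht := by
    split_ifs at ht with h
    · have := h₁.window t j ht; omega
    · have := h₂.window t j ht; omega
  release t j ht := by
    split_ifs at ht with h
    · exact h₁.release t j ht
    · exact h₂.release t j ht
  deadline t j ht := by
    split_ifs at ht with h
    · exact h₁.deadline t j ht
    · exact h₂.deadline t j ht
  amount j := by
    have : {t | (if t < b then S₁ t else S₂ t) = some j} =
        {t | S₁ t = some j} ∪ {t | S₂ t = some j} := by
      ext t
      simp only [Set.mem_ofPred_eq, Set.mem_union]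
      constructor
      · intro ht
        split_ifs at ht with h
        · exact Or.inl ht
        · exact Or.inr ht
      · rintro (ht | ht)
        · rw [if_pos (h₁.window t j ht).2, ht]
        · rw [if_neg (not_lt.2 (h₂.window t j ht).1), ht]
    rw [this, Set.ncard_union_eq _ (h₁.finite j) (h₂.finite j), h₁.amount, h₂.amount, Pi.add_apply]
    rw [Set.disjoint_left]
    intro t ht ht'
    have := h₁.window t j ht
    have := h₂.window t j ht'
    omega

open Classical in
theorem restrict (h : Fits r d w a b S) (A : Set ℕ) :
    Fits r d (fun j => if j ∈ A then w j else 0) a b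
      (fun t => (S t).filter fun j => j ∈ A) := by
  have key : ∀ t j, ((S t).filter fun j => j ∈ A) = some j → S t = some j ∧ j ∈ A := by
    intro t j ht
    simpa [Option.filter_eq_some_iff] using ht
  refine ⟨fun t j ht => h.window t j (key t j ht).1, fun t j ht => h.release t j (key t j ht).1,
    fun t j ht => h.deadline t j (key t j ht).1, fun j => ?_⟩
  by_cases hj : j ∈ A
  · rw [if_pos hj, ← h.amount j]
    congr 1
    ext t
    simp [Option.filter_eq_some_iff, hj]
  · rw [if_neg hj]
    convert Set.ncard_empty ℤ
    ext t
    simp only [Set.mem_ofPred_eq, Set.mem_empty_iff_false, iff_false]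
    exact fun ht => hj (key t j ht).2

theorem empty (r d : ℕ → ℤ) (a b : ℤ) : Fits r d 0 a b (fun _ => none) where
  window t j ht := by cases ht
  release t j ht := by cases ht
  deadline t j ht := by cases ht
  amount j := by simp

/-- Executing `k` in the whole interval `[a, b)`. -/
theorem block {k : ℕ} (hr : r k ≤ a) (hd : b ≤ d k) :
    Fits r d (Pi.single k (b - a).toNat) a b
      (fun t => if a ≤ t ∧ t < b then some k else none) where
  window t j ht := by
    split_ifs at ht with h
    exact h
  release t j ht := by
    split_ifs at ht with h
    cases ht
    omega
  deadline t j ht := by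
    split_ifs at ht with h
    cases ht
    omega
  amount j := by
    by_cases hj : j = k
    · subst hj
      rw [Pi.single_eq_same, ← Int.card_Ico, ← Set.ncard_coe_finset]
      congr 1
      ext t
      simp
    · rw [Pi.single_eq_of_ne hj]
      convert Set.ncard_empty ℤ
      ext t
      simp only [Set.mem_ofPred_eq, Set.mem_empty_iff_false, iff_false]
      intro ht
      split_ifs at ht
      cases ht
      exact hj rfl

/-- The part of a schedule before `c`. -/
theorem before (h : Fits r d w a b S) {w' : ℕ → ℕ} (c : ℤ)
    (hw : ∀ j, {t | t < c ∧ S t = some j}.ncard = w' j) :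
    Fits r d w' a c (fun t => if t < c then S t else none) := by
  have key : ∀ t j, (if t < c then S t else none) = some j ↔ t < c ∧ S t = some j := by
    intro t j
    split_ifs with h <;> simp [h]
  refine ⟨fun t j ht => ?_, fun t j ht => h.release t j ((key t j).1 ht).2,
    fun t j ht => h.deadline t j ((key t j).1 ht).2, fun j => ?_⟩
  · rw [key] at ht
    exact ⟨(h.window t j ht.2).1, ht.1⟩
  · rw [← hw j]
    congr 1
    ext t
    exact key t j

/-- The part of a schedule from `c` on. -/
theorem after (h : Fits r d w a b S) {w' : ℕ → ℕ} (c : ℤ)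
    (hw : ∀ j, {t | c ≤ t ∧ S t = some j}.ncard = w' j) :
    Fits r d w' c b (fun t => if t < c then none else S t) := by
  have key : ∀ t j, (if t < c then none else S t) = some j ↔ c ≤ t ∧ S t = some j := by
    intro t j
    split_ifs with h
    · simp [h]
    · simp [not_lt.1 h]
  refine ⟨fun t j ht => ?_, fun t j ht => h.release t j ((key t j).1 ht).2,
    fun t j ht => h.deadline t j ((key t j).1 ht).2, fun j => ?_⟩
  · rw [key] at ht
    exact ⟨ht.1, (h.window t j ht.2).2⟩
  · rw [← hw j]
    congr 1
    ext t
    exact key t j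

end Fits


/-! ### Exchange arguments: compression, earliest-deadline order, busy blocks -/

variable {r d : ℕ → ℤ} {w : ℕ → ℕ} {a b : ℤ} {S : Schedule}

namespace Schedule

theorem busy_swap {S : Schedule} {e y : ℤ} (he : ¬ S.Busy e) (z : ℤ) :
    Busy (S ∘ Equiv.swap e y) z ↔ (z = e ∧ S.Busy y) ∨ (z ≠ y ∧ S.Busy z) := by
  have he' : S e = none := not_busy_iff.1 he
  unfold Busy
  simp only [Function.comp]
  by_cases h1 : z = e
  · subst h1
    simp [he']
  · by_cases h2 : z = y
    · subst h2
      simp [he', h1]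
    · rw [Equiv.swap_apply_of_ne_of_ne h1 h2]
      simp [h1, h2]

end Schedule

namespace Fits

theorem sum_le (h : Fits r d w a b S) {A : Finset ℕ} {x : ℤ} (hA : ∀ j ∈ A, x ≤ r j)
    (hxb : x ≤ b) : ((∑ j ∈ A, w j : ℕ) : ℤ) ≤ b - x := by
  classical
  rw [h.sum_eq A]
  have : ((Finset.Ico a b).filter fun t => ∃ j ∈ A, S t = some j) ⊆ Finset.Ico x b := by
    intro t ht
    simp only [Finset.mem_filter, Finset.mem_Ico] at ht ⊢
    obtain ⟨⟨_, h2⟩, j, hj, hS⟩ := ht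
    exact ⟨(hA j hj).trans (h.release t j hS), h2⟩
  have := Finset.card_le_card this
  rw [Int.card_Ico] at this
  omega

/-- The slots of `[x, t)` together with the slot `y` are `t - x + 1` busy slots, all of them
occupied by jobs in `A`. Such a lower bound on the work contradicts the assumption that no interval
is overloaded. -/
theorem lt_sum (h : Fits r d w a b S) {A : Finset ℕ} {x t y : ℤ} (hxt : x ≤ t)
    (hbusy : ∀ z, x ≤ z → z < t → S.Busy z) (hty : t ≤ y) (hy : S.Busy y)
    (hA : ∀ z j, x ≤ z → S z = some j → j ∈ A) : t - x < ((∑ j ∈ A, w j : ℕ) : ℤ) := by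
  classical
  rw [h.sum_eq A]
  have : insert y (Finset.Ico x t) ⊆
      ((Finset.Ico a b).filter fun t => ∃ j ∈ A, S t = some j) := by
    intro z hz
    have hz' : x ≤ z ∧ S.Busy z := by
      rw [Finset.mem_insert, Finset.mem_Ico] at hz
      rcases hz with rfl | hz
      · exact ⟨by omega, hy⟩
      · exact ⟨hz.1, hbusy z hz.1 hz.2⟩
    obtain ⟨j, hj⟩ := Schedule.busy_iff.1 hz'.2
    rw [Finset.mem_filter, Finset.mem_Ico]
    exact ⟨h.window z j hj, j, hA z j hz'.1 hj, hj⟩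
  have := Finset.card_le_card this
  rw [Finset.card_insert_of_notMem (by simp [hty]), Int.card_Ico] at this
  omega

/-- The last idle slot `e` before `t` can be filled by a unit from a slot after `t`. -/
theorem fill {J : Finset ℕ} {t : ℤ}
    (hall : ∀ x, a ≤ x → x ≤ t → ((∑ j ∈ J with x ≤ r j, w j : ℕ) : ℤ) ≤ t - x) (m : ℕ) :
    ∀ (S : Schedule) (e : ℤ), Fits r d w a b S → (∀ z j, S z = some j → j ∈ J) →
      (t - e).toNat ≤ m → a ≤ e → e < t → ¬ S.Busy e → (∀ z, e < z → z < t → S.Busy z) →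
      (∃ y, t ≤ y ∧ S.Busy y) →
      ∃ S' y, t ≤ y ∧ Fits r d w a b S' ∧ S.Busy y ∧
        ∀ z, S'.Busy z ↔ z = e ∨ (z ≠ y ∧ S.Busy z) := by
  induction m with
  | zero => intro S e _ _ h1 _ h2; omega
  | succ m ih =>
    intro S e h hJ hm hae het he hbusy ⟨y, hty, hy⟩
    -- If all jobs executed after `e` were released after `e`, the work released from `e + 1` on
    -- would fill `[e + 1, t)` and the slot `y` in addition, against `hall`.
    obtain ⟨z, i, hez, hz, hri⟩ : ∃ z i, e < z ∧ S z = some i ∧ r i ≤ e := by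
      by_contra hne
      push Not at hne
      have h1 := h.lt_sum (A := J.filter fun j => e + 1 ≤ r j) (x := e + 1) (t := t) (by omega)
        (fun z hz hz' => hbusy z (by omega) hz') hty hy
        (fun z j hz hj => Finset.mem_filter.2
          ⟨hJ z j hj, by have := hne z j (by omega) hj; omega⟩)
      have h2 := hall (e + 1) (by omega) (by omega)
      omega
    have hzw := h.window z i hz
    have hzd := h.deadline z i hz
    have hfit := h.move hz (Schedule.not_busy_iff.1 he) hri (by omega) hae (by omega)
    have hb := Schedule.busy_swap (y := z) he
    have hzb : S.Busy z := Schedule.busy_iff.2 ⟨i, hz⟩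
    simp only [hzb, and_true] at hb
    -- A unit from `t` or later settles the matter. Otherwise the hole has moved from `e` to `z`,
    -- closer to `t`, and all slots between `z` and `t` are still busy.
    by_cases hzt : t ≤ z
    · exact ⟨_, z, hzt, hfit, hzb, hb⟩
    · push Not at hzt
      obtain ⟨S', y', hy', hS', hby', hb'⟩ := ih (S ∘ Equiv.swap e z) z hfit
        (fun u j hu => hJ _ j hu) (by omega) (by omega) hzt
        (by rw [hb]; push Not; exact ⟨by omega, fun hh => absurd rfl hh⟩)
        (fun u hu hut => (hb u).2 (Or.inr ⟨by omega, hbusy u (by omega) hut⟩))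
        ⟨y, hty, (hb y).2 (Or.inr ⟨by omega, hy⟩)⟩
      refine ⟨S', y', hy', hS', ?_, fun u => ?_⟩
      · rcases (hb y').1 hby' with hh | hh
        · omega
        · exact hh.2
      · rw [hb', hb]
        constructor
        · rintro (hu | ⟨hu1, hu2 | hu2⟩)
          · subst hu; exact Or.inr ⟨by omega, hzb⟩
          · exact Or.inl hu2
          · exact Or.inr ⟨hu1, hu2.2⟩
        · rintro (hu | hu)
          · exact Or.inr ⟨by omega, Or.inl hu⟩
          · by_cases huz : u = z
            · exact Or.inl huz
            · exact Or.inr ⟨hu.1, Or.inr ⟨huz, hu.2⟩⟩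

/-- A schedule can be compressed to `[a, t)` without additional gaps in `[a, t)` if for every `x`
the work released in `[x, t)` is at most `t - x`. -/
theorem compress {J : Finset ℕ} {t : ℤ} (h : Fits r d w a b S) (hJ : ∀ j, w j ≠ 0 → j ∈ J)
    (hr : ∀ j, w j ≠ 0 → a ≤ r j) (hat : a ≤ t)
    (hall : ∀ x, a ≤ x → x ≤ t → ((∑ j ∈ J with x ≤ r j, w j : ℕ) : ℤ) ≤ t - x) :
    ∃ S', Fits r d w a t S' ∧ (∀ z, z < t → S.Busy z → S'.Busy z) ∧
      S'.gapCount a t ≤ S.gapCount a t := by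
  classical
  obtain ⟨m, hm⟩ : ∃ m, ((Finset.Ico t b).filter fun z => S.Busy z).card = m := ⟨_, rfl⟩
  induction m generalizing S with
  | zero =>
    rw [Finset.card_eq_zero, Finset.filter_eq_empty_iff] at hm
    refine ⟨S, h.mono fun z j hz => ⟨(h.window z j hz).1, ?_, h.release z j hz,
      h.deadline z j hz⟩, fun z _ hz => hz, le_rfl⟩
    by_contra hzt
    exact hm (Finset.mem_Ico.2 ⟨not_lt.1 hzt, (h.window z j hz).2⟩)
      (Schedule.busy_iff.2 ⟨j, hz⟩)
  | succ m ih =>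
    have hpos : 0 < ((Finset.Ico t b).filter fun z => S.Busy z).card := by omega
    obtain ⟨y, hy⟩ := Finset.card_pos.1 hpos
    rw [Finset.mem_filter, Finset.mem_Ico] at hy
    -- Without an idle slot before `t`, the window `[a, t)` and the slot `y` would contain more work
    -- than `hall` admits for `x = a`.
    obtain ⟨e, hae, het, he, hbusy⟩ : ∃ e, a ≤ e ∧ e < t ∧ ¬ S.Busy e ∧
        ∀ z, e < z → z < t → S.Busy z := by
      by_cases hidle : ∃ e, a ≤ e ∧ e < t ∧ ¬ S.Busy e
      · obtain ⟨e, h1, h2, h3⟩ := hidle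
        obtain ⟨c, hc1, hc2, hc3, hc4⟩ := Schedule.exists_last (p := fun e => ¬ S.Busy e)
          (show e ≤ t - 1 by omega) h3
        exact ⟨c, by omega, by omega, hc3, fun z hz hz' => not_not.1 (hc4 z hz (by omega))⟩
      · push Not at hidle
        have h1 := h.lt_sum (A := J.filter fun j => a ≤ r j) (x := a) (t := t) hat
          hidle hy.1.1 hy.2 (fun z j _ hj => Finset.mem_filter.2
            ⟨hJ j (h.amount_ne_zero hj), hr j (h.amount_ne_zero hj)⟩)
        have h3 := hall a le_rfl hat
        omega
    obtain ⟨S', y', hy', hS', hby', hb'⟩ := fill hall _ S e h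
      (fun z j hz => hJ j (h.amount_ne_zero hz)) le_rfl hae het he hbusy ⟨y, hy.1.1, hy.2⟩
    have hlt : ∀ z, z < t → (S'.Busy z ↔ z = e ∨ S.Busy z) := by
      intro z hz
      rw [hb']
      have : z ≠ y' := by omega
      simp [this]
    obtain ⟨S'', h1, h2, h3⟩ := ih hS' (by
      have : ((Finset.Ico t b).filter fun z => S'.Busy z) =
          ((Finset.Ico t b).filter fun z => S.Busy z).erase y' := by
        ext z
        simp only [Finset.mem_filter, Finset.mem_erase, Finset.mem_Ico, hb']
        constructor
        · rintro ⟨h1, h2 | h2⟩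
          · omega
          · exact ⟨h2.1, h1, h2.2⟩
        · rintro ⟨h1, h2, h3⟩
          exact ⟨h2, Or.inr ⟨h1, h3⟩⟩
      rw [this, Finset.card_erase_of_mem, hm]
      · rfl
      · rw [Finset.mem_filter, Finset.mem_Ico]
        exact ⟨⟨hy', (h.busy_window hby').2⟩, hby'⟩)
    refine ⟨S'', h1, fun z hz hz' => h2 z hz ((hlt z hz).2 (Or.inr hz')), h3.trans ?_⟩
    exact Schedule.gapCount_fill_le (e := e) (fun z _ hz => hlt z hz)
      (fun h => hbusy _ (by omega) h)

/-- Every schedule can be rearranged to an earliest-deadline one. -/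
theorem edf (h : Fits r d w a b S) :
    ∃ S', Fits r d w a b S' ∧ (∀ t, S'.Busy t ↔ S.Busy t) ∧
      ∀ t j, S' t = some j → ∀ t' i, t ≤ t' → S' t' = some i → r i ≤ t → d j ≤ d i := by
  classical
  -- Rearrangement potential: the sum of the products `(b - t) * (d j - a)` drops strictly when a
  -- unit with a later deadline is exchanged with a later unit with an earlier deadline. All factors
  -- are nonnegative.
  let f : Schedule → ℤ → ℤ := fun S t => (S t).elim 0 fun j => (b - t) * (d j - a)
  let Φ : Schedule → ℤ := fun S => ∑ t ∈ Finset.Ico a b, f S t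
  have hΦ : ∀ S, Fits r d w a b S → 0 ≤ Φ S := by
    intro S hS
    refine Finset.sum_nonneg fun t _ => ?_
    simp only [f]
    rcases hSt : S t with _ | j
    · simp
    · have := hS.window t j hSt
      have := hS.deadline t j hSt
      simp only [Option.elim_some]
      exact mul_nonneg (by omega) (by omega)
  obtain ⟨S', ⟨h1, h2⟩, hmin⟩ := (measure fun S => (Φ S).toNat).wf.has_min
    {S' | Fits r d w a b S' ∧ ∀ t, S'.Busy t ↔ S.Busy t} ⟨S, h, fun _ => Iff.rfl⟩
  refine ⟨S', h1, h2, fun t j ht t' i htt' ht' hri => ?_⟩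
  by_contra hd
  push Not at hd
  have hne : t ≠ t' := by
    rintro rfl
    rw [ht] at ht'
    cases ht'
    omega
  have hw := h1.window t j ht
  have hw' := h1.window t' i ht'
  have hd' := h1.deadline t' i ht'
  have hr := h1.release t j ht
  have hfit : Fits r d w a b (S' ∘ Equiv.swap t t') := by
    refine h1.comp _ fun u k hu => ?_
    by_cases hu1 : u = t
    · subst hu1
      rw [Equiv.swap_apply_left, ht'] at hu
      cases hu
      exact ⟨hw.1, hw.2, hri, by omega⟩
    · by_cases hu2 : u = t'
      · subst hu2
        rw [Equiv.swap_apply_right, ht] at hu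
        cases hu
        exact ⟨hw'.1, hw'.2, by omega, by omega⟩
      · rw [Equiv.swap_apply_of_ne_of_ne hu1 hu2] at hu
        exact ⟨(h1.window u k hu).1, (h1.window u k hu).2, h1.release u k hu, h1.deadline u k hu⟩
  refine hmin (S' ∘ Equiv.swap t t') ⟨hfit, fun u => ?_⟩ ?_
  · rw [← h2]
    by_cases hu1 : u = t
    · subst hu1
      simp [Schedule.Busy, ht, ht']
    · by_cases hu2 : u = t'
      · subst hu2
        simp [Schedule.Busy, ht, ht']
      · simp [Schedule.Busy, Equiv.swap_apply_of_ne_of_ne hu1 hu2]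
  · have hlt : Φ (S' ∘ Equiv.swap t t') - Φ S' < 0 := by
      simp only [Φ]
      rw [← Finset.sum_sub_distrib, ← Finset.sum_subset (s₁ := {t, t'})]
      · rw [Finset.sum_pair hne]
        simp only [f, Function.comp, Equiv.swap_apply_left, Equiv.swap_apply_right, ht, ht',
          Option.elim_some]
        have : (t' - t) * (d i - d j) < 0 := mul_neg_of_pos_of_neg (by omega) (by omega)
        linarith
      · intro u hu
        rw [Finset.mem_insert, Finset.mem_singleton] at hu
        rw [Finset.mem_Ico]
        rcases hu with rfl | rfl
        · exact hw
        · exact hw'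
      · intro u _ hu
        rw [Finset.mem_insert, Finset.mem_singleton] at hu
        push Not at hu
        simp [f, Equiv.swap_apply_of_ne_of_ne hu.1 hu.2]
    have := hΦ _ hfit
    change (Φ (S' ∘ Equiv.swap t t')).toNat < (Φ S').toNat
    omega

/-- If some job is released at the beginning of the window, then the jobs released before some
later time `t` can be executed in `[a, t)` without idle times. -/
theorem exists_block {J : Finset ℕ} (h : Fits r d w a b S) (hJ : ∀ j, w j ≠ 0 → j ∈ J)
    (hr : ∀ j, w j ≠ 0 → a ≤ r j) {i : ℕ} (hi : r i = a) (hwi : w i ≠ 0) :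
    ∃ t S', a < t ∧ t ≤ b ∧ Fits r d (fun j => if r j < t then w j else 0) a t S' ∧
      ∀ z, a ≤ z → z < t → S'.Busy z := by
  classical
  let work : ℤ → ℕ := fun x => ∑ j ∈ J with r j < x, w j
  have hmono : ∀ x y, x ≤ y → work x ≤ work y := by
    intro x y hxy
    refine Finset.sum_le_sum_of_subset fun j hj => ?_
    rw [Finset.mem_filter] at hj ⊢
    exact ⟨hj.1, by omega⟩
  obtain ⟨y, hy⟩ := h.exists_slot hwi
  have hyw := h.window y i hy
  -- `t` is the first time after `a` at which the work released so far fits. By minimality it fits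
  -- exactly, and for `a < x < t` the work released before `x` exceeds `x - a`, so that the work
  -- released in `[x, t)` is less than `t - x`.
  obtain ⟨t, hat, htb, ht, htmin⟩ := Schedule.exists_first
    (p := fun t => (work t : ℤ) ≤ t - a) (show a + 1 ≤ b by omega) (by
      have h1 : work b ≤ ∑ j ∈ J, w j := Finset.sum_le_sum_of_subset (Finset.filter_subset _ _)
      have h2 := h.sum_eq J
      have h3 := Finset.card_filter_le (Finset.Ico a b) fun t => ∃ j ∈ J, S t = some j
      rw [Int.card_Ico] at h3
      have : (b - a).toNat = b - a := by omega
      zify at *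
      omega)
  have heq : (work t : ℤ) = t - a := by
    refine le_antisymm ht ?_
    by_cases hta : t = a + 1
    · have : w i ≤ work t := Finset.single_le_sum (f := w) (fun _ _ => Nat.zero_le _)
        (Finset.mem_filter.2 ⟨hJ i hwi, by omega⟩)
      omega
    · have h1 := htmin (t - 1) (by omega) (by omega)
      have h2 := hmono (t - 1) t (by omega)
      omega
  have hsum : ∀ x, x ≤ t → ∑ j ∈ J with ¬ x ≤ r j, (if r j < t then w j else 0) = work x := by
    intro x hx
    simp only [not_le]
    exact Finset.sum_congr rfl fun j hj => if_pos ((Finset.mem_filter.1 hj).2.trans_le hx)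
  have htot : ∑ j ∈ J, (if r j < t then w j else 0) = work t := by
    rw [← Finset.sum_filter]
  have hres : Fits r d (fun j => if r j < t then w j else 0) a b _ :=
    (h.restrict {j | r j < t}).congr fun j => by simp
  obtain ⟨S', h1, -, -⟩ := hres.compress (J := J) (t := t)
    (fun j hj => hJ j fun h0 => hj (by simp [h0]))
    (fun j hj => hr j fun h0 => hj (by simp [h0])) (by omega) (by
      intro x hax hxt
      have h1 := Finset.sum_filter_add_sum_filter_not J (fun j => x ≤ r j)
        (fun j => if r j < t then w j else 0)
      rw [hsum x hxt, htot] at h1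
      rcases hxt.lt_or_eq with hxt' | hxt'
      · rcases hax.lt_or_eq with hax' | hax'
        · have h2 := htmin x (by omega) hxt'
          omega
        · omega
      · rw [Finset.sum_eq_zero fun j hj => if_neg (by
          rw [not_lt, ← hxt']; exact (Finset.mem_filter.1 hj).2)]
        omega)
  refine ⟨t, S', by omega, htb, h1, fun z hz hzt => ?_⟩
  have h2 := h1.sum_eq J
  rw [htot] at h2
  -- There are as many units as slots, so no slot is idle.
  have h3 : ((Finset.Ico a t).filter fun t => ∃ j ∈ J, S' t = some j) = Finset.Ico a t :=
    Finset.eq_of_subset_of_card_le (Finset.filter_subset _ _) (by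
      rw [← h2, Int.card_Ico]
      omega)
  have h4 : z ∈ (Finset.Ico a t).filter fun t => ∃ j ∈ J, S' t = some j := by
    rw [h3, Finset.mem_Ico]
    exact ⟨hz, hzt⟩
  obtain ⟨j, _, hj⟩ := (Finset.mem_filter.1 h4).2
  exact Schedule.busy_iff.2 ⟨j, hj⟩

end Fits


/-! ### Completion times and the two tables in terms of workloads -/

namespace Schedule

theorem cmax_of_not_exists {S : Schedule} (h : ¬ ∃ t, S.Busy t) (a : ℤ) : S.cmax a = a :=
  if_neg h

/-- The bound `B` is needed since the supremum of an unbounded set of integers is only a default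
value. -/
theorem cmax_spec {S : Schedule} {B : ℤ} (hB : ∀ t, S.Busy t → t < B) (h : ∃ t, S.Busy t)
    (a : ℤ) : (∀ t, S.Busy t → t < S.cmax a) ∧ S.Busy (S.cmax a - 1) := by
  have hbdd : BddAbove {c | ∃ t, S.Busy t ∧ c = t + 1} := by
    refine ⟨B, ?_⟩
    rintro c ⟨t, ht, rfl⟩
    have := hB t ht
    omega
  have hc : S.cmax a = sSup {c | ∃ t, S.Busy t ∧ c = t + 1} := if_pos h
  rw [hc]
  constructor
  · intro t ht
    have : t + 1 ≤ sSup {c | ∃ t, S.Busy t ∧ c = t + 1} := le_csSup hbdd ⟨t, ht, rfl⟩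
    omega
  · obtain ⟨t, ht⟩ := h
    obtain ⟨u, hu, hue⟩ := Int.csSup_mem (s := {c | ∃ t, S.Busy t ∧ c = t + 1})
      ⟨t + 1, t, ht, rfl⟩ hbdd
    rw [hue]
    simpa using hu

theorem cmax_eq {S : Schedule} {c : ℤ} (hlt : ∀ t, S.Busy t → t < c) (hc : S.Busy (c - 1))
    (a : ℤ) : S.cmax a = c := by
  have h := cmax_spec hlt ⟨_, hc⟩ a
  have h1 := h.1 _ hc
  have h2 := hlt _ h.2
  omega

end Schedule

namespace Jobs

variable (I : Jobs)

/-- The work to be done for the jobs `j ≤ k` that are released in `[a, c)`. -/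
def work (k : ℕ) (a c : ℤ) (j : ℕ) : ℕ :=
  if 1 ≤ j ∧ j ≤ k ∧ a ≤ I.r j ∧ I.r j < c then I.p j else 0

/-- The amounts `q` of job `k` that, together with the jobs `j < k` released in `[r_s, r_l)`, can
be executed in this interval with at most `g` gaps. -/
def amountsIn (s k g l : ℕ) : Set ℕ :=
  {q | ∃ S, Fits I.r I.d (I.work (k - 1) (I.r s) (I.r l) + Pi.single k q) (I.r s) (I.r l) S ∧
    S.gapCount (I.r s) (I.r l) ≤ g}

/-- The jobs `j < k` released in some interval `[x, t)`, where `a ≤ x`, do not fit into it. -/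
def Overloaded (k : ℕ) (a t : ℤ) : Prop :=
  ∃ x, a ≤ x ∧ x ≤ t ∧
    t - x < ((∑ j ∈ Finset.Ico 1 k with x ≤ I.r j ∧ I.r j < t, I.p j : ℕ) : ℤ)

variable {I}

theorem work_ne_zero {k j : ℕ} {a c : ℤ} (h : I.work k a c j ≠ 0) :
    1 ≤ j ∧ j ≤ k ∧ a ≤ I.r j ∧ I.r j < c := by
  by_contra h'
  exact h (if_neg h')

theorem work_add {k : ℕ} {a b c : ℤ} (hab : a ≤ b) (hbc : b ≤ c) :
    I.work k a b + I.work k b c = I.work k a c := by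
  funext j
  simp only [Pi.add_apply, work]
  by_cases h1 : 1 ≤ j ∧ j ≤ k <;> by_cases h2 : a ≤ I.r j <;> by_cases h3 : I.r j < b <;>
    by_cases h4 : I.r j < c <;> simp [h1, h2, h3, h4] <;> omega

theorem work_eq_add_single {k : ℕ} (hk : 1 ≤ k) {a c : ℤ} (ha : a ≤ I.r k) (hc : I.r k < c) :
    I.work k a c = I.work (k - 1) a c + Pi.single k (I.p k) := by
  funext j
  simp only [Pi.add_apply, work]
  by_cases hj : j = k
  · subst hj
    have : ¬ j ≤ j - 1 := by omega
    simp [ha, hc, hk, this]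
  · have : j ≤ k ↔ j ≤ k - 1 := by omega
    simp [hj, this]

theorem work_eq_pred {k : ℕ} (hk : 1 ≤ k) {a c : ℤ} (h : I.r k < a ∨ c ≤ I.r k) :
    I.work k a c = I.work (k - 1) a c := by
  funext j
  simp only [work]
  by_cases hj : j = k
  · subst hj
    have : ¬ j ≤ j - 1 := by omega
    rw [if_neg (by omega), if_neg (by omega)]
  · have : j ≤ k ↔ j ≤ k - 1 := by omega
    simp [this]

theorem work_eq_of_no_release {k : ℕ} {a c c' : ℤ}
    (h : ∀ j, 1 ≤ j → j ≤ k → a ≤ I.r j → (I.r j < c ↔ I.r j < c')) :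
    I.work k a c = I.work k a c' := by
  funext j
  simp only [work]
  by_cases hj : 1 ≤ j ∧ j ≤ k ∧ a ≤ I.r j
  · simp [h j hj.1 hj.2.1 hj.2.2]
  · rw [if_neg (by tauto), if_neg (by tauto)]

theorem work_eq_zero {k : ℕ} {a c : ℤ} (h : ∀ j, 1 ≤ j → j ≤ k → a ≤ I.r j → c ≤ I.r j) :
    I.work k a c = 0 := by
  funext j
  simp only [work, Pi.zero_apply]
  rw [if_neg]
  rintro ⟨h1, h2, h3, h4⟩
  have := h j h1 h2 h3
  omega

theorem work_pred_self {k : ℕ} (a c : ℤ) (hk : 1 ≤ k) : I.work (k - 1) a c k = 0 :=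
  if_neg (by omega)

theorem prevr_lt_iff {k : ℕ} {t x : ℤ} :
    I.prevr k t < (x : WithBot ℤ) ↔ ∀ j, 1 ≤ j → j ≤ k → I.r j < t → I.r j < x := by
  unfold prevr
  rw [Finset.sup_lt_iff (WithBot.bot_lt_coe x)]
  simp only [Finset.mem_filter, Finset.mem_Icc, WithBot.coe_lt_coe]
  exact ⟨fun h j h1 h2 h3 => h j ⟨⟨h1, h2⟩, h3⟩, fun h j hj => h j hj.1.1 hj.1.2 hj.2⟩

theorem Executes.fits {k : ℕ} {a c B : ℤ} {S : Schedule}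
    (h : I.Executes {j | 1 ≤ j ∧ j ≤ k ∧ a ≤ I.r j ∧ I.r j < c} S)
    (hB : ∀ t, S.Busy t → t < B) : Fits I.r I.d (I.work k a c) a B S where
  window t j ht := ⟨(h.1 t j ht).1.2.2.1.trans (h.1 t j ht).2.1,
    hB t (Schedule.busy_iff.2 ⟨j, ht⟩)⟩
  release t j ht := (h.1 t j ht).2.1
  deadline t j ht := (h.1 t j ht).2.2
  amount j := by
    by_cases hj : 1 ≤ j ∧ j ≤ k ∧ a ≤ I.r j ∧ I.r j < c
    · rw [work, if_pos hj]
      exact h.2 j hj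
    · rw [work, if_neg hj]
      convert Set.ncard_empty ℤ
      ext t
      simp only [Set.mem_ofPred_eq, Set.mem_empty_iff_false, iff_false]
      exact fun ht => hj (h.1 t j ht).1

theorem executes_of_fits {k : ℕ} {a c a' B : ℤ} {S : Schedule}
    (h : Fits I.r I.d (I.work k a c) a' B S) :
    I.Executes {j | 1 ≤ j ∧ j ≤ k ∧ a ≤ I.r j ∧ I.r j < c} S := by
  refine ⟨fun t j ht => ⟨work_ne_zero (h.amount_ne_zero ht), h.release t j ht,
    h.deadline t j ht⟩, fun j hj => ?_⟩
  rw [h.amount j]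
  exact if_pos hj

namespace Normalized

variable (hI : I.Normalized)
include hI

theorem d_le {j k : ℕ} (hj : 1 ≤ j) (hjk : j ≤ k) (hk : k ≤ I.n) : I.d j ≤ I.d k :=
  hI.d_strictMono.monotoneOn ⟨hj, by omega⟩ ⟨by omega, hk⟩ hjk

theorem d_lt {j k : ℕ} (hj : 1 ≤ j) (hjk : j < k) (hk : k ≤ I.n) : I.d j < I.d k :=
  hI.d_strictMono ⟨hj, by omega⟩ ⟨by omega, hk⟩ hjk

theorem p_ne_zero {j : ℕ} (hj : 1 ≤ j) (hjn : j ≤ I.n) : I.p j ≠ 0 := by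
  have := hI.p_pos j ⟨hj, hjn⟩
  omega

/-- The given schedule of the whole instance is restricted to these jobs. It ends by `d_k` because
the deadlines increase with the index. All feasibility used later comes from here. -/
theorem exists_fits {k : ℕ} (hk : k ≤ I.n) (a c : ℤ) :
    ∃ F, Fits I.r I.d (I.work k a c) a (I.d k) F := by
  obtain ⟨F, hF⟩ := hI.feasible
  have hb : ∀ t, F.Busy t → I.r 1 ≤ t ∧ t < I.d I.n := by
    intro t ht
    obtain ⟨j, hj⟩ := Schedule.busy_iff.1 ht
    obtain ⟨h1, h2, h3⟩ := hF.1 t j hj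
    exact ⟨(hI.r_one_le j h1).trans h2, h3.trans_le (hI.d_le h1.1 h1.2 le_rfl)⟩
  have hfit : Fits I.r I.d (fun j => if j ∈ Set.Icc 1 I.n then I.p j else 0) (I.r 1) (I.d I.n)
      F := by
    refine ⟨fun t j ht => hb t (Schedule.busy_iff.2 ⟨j, ht⟩), fun t j ht => (hF.1 t j ht).2.1,
      fun t j ht => (hF.1 t j ht).2.2, fun j => ?_⟩
    by_cases hj : j ∈ Set.Icc 1 I.n
    · rw [if_pos hj, hF.2 j hj]
    · rw [if_neg hj]
      convert Set.ncard_empty ℤ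
      ext t
      simp only [Set.mem_ofPred_eq, Set.mem_empty_iff_false, iff_false]
      exact fun ht => hj (hF.1 t j ht).1
  refine ⟨_, ((hfit.restrict {j | 1 ≤ j ∧ j ≤ k ∧ a ≤ I.r j ∧ I.r j < c}).congr
    (w' := I.work k a c) fun j => ?_).mono fun t j ht => ?_⟩
  · simp only [work, Set.mem_ofPred_eq, Set.mem_Icc]
    by_cases hj : 1 ≤ j ∧ j ≤ k ∧ a ≤ I.r j ∧ I.r j < c
    · rw [if_pos hj, if_pos hj, if_pos (by omega)]
    · rw [if_neg hj, if_neg hj]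
  · simp only [Option.filter_eq_some_iff, Set.mem_ofPred_eq, decide_eq_true_eq] at ht
    obtain ⟨h1, h2⟩ := ht
    obtain ⟨_, h4, h5⟩ := hF.1 t j h1
    have := hI.d_le h2.1 h2.2.1 hk
    exact ⟨by omega, by omega, h4, h5⟩

theorem r_add_p_le {j : ℕ} (hj : 1 ≤ j) (hjn : j ≤ I.n) : I.r j + I.p j ≤ I.d j := by
  obtain ⟨F, hF⟩ := hI.exists_fits hjn (I.r j) (I.r j + 1)
  have hp := hI.p_ne_zero hj hjn
  have hw : I.work j (I.r j) (I.r j + 1) j = I.p j := by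
    rw [work, if_pos]
    omega
  obtain ⟨t, ht⟩ := hF.exists_slot (j := j) (by rwa [hw])
  have h1 := hF.window t j ht
  have := hF.sum_le (A := {j}) (x := I.r j) (by simp) (by omega)
  rw [Finset.sum_singleton, hw] at this
  omega

theorem r_lt_d {j k : ℕ} (hj : 1 ≤ j) (hjk : j ≤ k) (hk : k ≤ I.n) : I.r j < I.d k := by
  have h1 := hI.r_add_p_le hj (hjk.trans hk)
  have h2 := hI.d_le hj hjk hk
  have h3 := hI.p_ne_zero hj (hjk.trans hk)
  omega

/-- This removes `cmax` from the definition. The condition `C_max ≤ d_k` is automatic, because the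
job in the last busy slot has an index at most `k`; and `c` is a completion time if the slot before
it is busy or if `c = r_s`, the convention for the empty schedule. -/
theorem mem_completions {s k g : ℕ} (hk : k ≤ I.n) {c : ℤ} :
    c ∈ I.completions s k g ↔ ∃ S, Fits I.r I.d (I.work k (I.r s) c) (I.r s) c S ∧
      (c = I.r s ∨ S.Busy (c - 1)) ∧ S.gapCount (I.r s) c ≤ g := by
  constructor
  · rintro ⟨S, ⟨hS1, hS2⟩, hg, rfl⟩
    rw [Schedule.ncard_gapsIn] at hg
    refine ⟨S, ?_, ?_, hg⟩
    · refine Executes.fits hS2 fun t ht => ?_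
      refine (Schedule.cmax_spec (B := I.d k) (fun t ht => ?_) ⟨t, ht⟩ _).1 t ht
      obtain ⟨j, hj⟩ := Schedule.busy_iff.1 ht
      obtain ⟨h1, _, h3⟩ := hS2.1 t j hj
      exact h3.trans_le (hI.d_le h1.1 h1.2.1 hk)
    · by_cases hb : ∃ t, S.Busy t
      · refine Or.inr (Schedule.cmax_spec (B := I.d k) (fun t ht => ?_) hb _).2
        obtain ⟨j, hj⟩ := Schedule.busy_iff.1 ht
        obtain ⟨h1, _, h3⟩ := hS2.1 t j hj
        exact h3.trans_le (hI.d_le h1.1 h1.2.1 hk)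
      · exact Or.inl (Schedule.cmax_of_not_exists hb _)
  · rintro ⟨S, hS, hc, hg⟩
    have hcm : S.cmax (I.r s) = c := by
      rcases hc with rfl | hc
      · refine Schedule.cmax_of_not_exists ?_ _
        rintro ⟨t, ht⟩
        have := hS.busy_window ht
        omega
      · exact Schedule.cmax_eq (fun t ht => (hS.busy_window ht).2) hc _
    refine ⟨S, ⟨fun ⟨t, ht⟩ => ?_, ?_⟩, ?_, hcm.symm⟩
    · rw [hcm]
      rcases hc with hc | hc
      · have := hS.busy_window ht
        omega
      · obtain ⟨j, hj⟩ := Schedule.busy_iff.1 hc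
        have h1 := hS.deadline _ j hj
        have h2 := work_ne_zero (hS.amount_ne_zero hj)
        have := hI.d_le h2.1 h2.2.1 hk
        omega
    · rw [hcm]
      exact executes_of_fits hS
    · rw [Schedule.ncard_gapsIn, hcm]
      exact hg

/-- The condition on `prevr` holds since every job below `k` released in `[r_s, r_l)` is executed
after its release, hence released before `C_max`. -/
theorem amountsIn_subset {s k g l : ℕ} (hk1 : 1 ≤ k) (hkn : k ≤ I.n) (hl1 : 1 ≤ l) (hlk : l < k)
    (hsl : I.r s ≤ I.r l) : I.amountsIn s k g l ⊆ I.amounts s k g l := by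
  rintro q ⟨S, hS, hg⟩
  have hrld := hI.r_lt_d hl1 hlk.le hkn
  have hB : ∀ t, S.Busy t → t < I.r l := fun t ht => (hS.busy_window ht).2
  have hc : I.r s ≤ S.cmax (I.r s) ∧ S.cmax (I.r s) ≤ I.r l := by
    by_cases hb : ∃ t, S.Busy t
    · have h := hS.busy_window (Schedule.cmax_spec hB hb (I.r s)).2
      omega
    · rw [Schedule.cmax_of_not_exists hb]
      omega
  have hlt : ∀ t j, S t = some j → t < S.cmax (I.r s) := fun t j ht =>
    (Schedule.cmax_spec hB ⟨t, Schedule.busy_iff.2 ⟨j, ht⟩⟩ _).1 t (Schedule.busy_iff.2 ⟨j, ht⟩)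
  have hrs : (I.modify s k q).r s = I.r s := by
    simp only [modify]
    by_cases h : s = k
    · subst h
      simp
    · simp [h]
  have hwk : (I.work (k - 1) (I.r s) (I.r l) + Pi.single k q : ℕ → ℕ) k = q := by
    simp [work_pred_self _ _ hk1]
  have hwj : ∀ j, j ≠ k → (I.work (k - 1) (I.r s) (I.r l) + Pi.single k q : ℕ → ℕ) j =
      I.work (k - 1) (I.r s) (I.r l) j := by
    intro j hj
    simp [hj]
  refine ⟨S, ⟨fun _ => ?_, ?_, ?_⟩, ?_, hc.2, ?_⟩
  · rw [hrs]
    simp only [modify]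
    omega
  · intro t j ht
    have h1 := hlt t j ht
    have h2 := hS.release t j ht
    have h3 := hS.deadline t j ht
    have h4 := hS.window t j ht
    rw [hrs]
    by_cases hj : j = k
    · subst hj
      simp only [modify, Function.update_self, Set.mem_ofPred_eq]
      omega
    · have h5 := hS.amount_ne_zero ht
      rw [hwj j hj] at h5
      have h6 := work_ne_zero h5
      simp only [modify, Function.update_of_ne hj, Set.mem_ofPred_eq]
      omega
  · intro j hj
    rw [hS.amount j]
    by_cases hjk : j = k
    · subst hjk
      rw [hwk]
      simp [modify]
    · rw [hrs] at hj
      simp only [modify, Function.update_of_ne hjk, Set.mem_ofPred_eq] at hj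
      rw [hwj j hjk, work, if_pos (by omega)]
      simp [modify, hjk]
  · rw [prevr_lt_iff]
    intro j hj1 hjk hjl
    by_cases hsj : I.r s ≤ I.r j
    · have : (I.work (k - 1) (I.r s) (I.r l) + Pi.single k q : ℕ → ℕ) j ≠ 0 := by
        rw [hwj j (by omega), work, if_pos (by omega)]
        exact hI.p_ne_zero hj1 (by omega)
      obtain ⟨t, ht⟩ := hS.exists_slot this
      exact (hS.release t j ht).trans_lt (hlt t j ht)
    · omega
  · rw [Schedule.ncard_gapsIn]
    exact hg

/-- The condition on `prevr` ensures that all jobs below `k` released in `[r_s, r_l)` are executed.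
The amount may shrink: if the modified release time of `k` is not before `C_max`, then `k` is not
executed at all. So the number of slots that `k` really occupies takes the place of `q`. -/
theorem exists_mem_amountsIn {s k g l q : ℕ} (hk1 : 1 ≤ k) (hkn : k ≤ I.n)
    (hq : q ∈ I.amounts s k g l) : ∃ q' ≤ q, q' ∈ I.amountsIn s k g l := by
  obtain ⟨S, ⟨_, h2, h3⟩, h4, h5, h6⟩ := hq
  have hrs : (I.modify s k q).r s = I.r s := by
    simp only [modify]
    by_cases h : s = k
    · subst h
      simp
    · simp [h]
  have hrj : ∀ j, j ≠ k → (I.modify s k q).r j = I.r j := by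
    intro j hj
    simp [modify, hj]
  have hrk : (I.modify s k q).r k = max (I.r s) (I.r k) := by simp [modify]
  have hd : (I.modify s k q).d = I.d := rfl
  rw [prevr_lt_iff] at h4
  rw [Schedule.ncard_gapsIn] at h6
  simp only [hrs, Set.mem_ofPred_eq, hd] at h2 h3
  have hB : ∀ t, S.Busy t → t < I.d k := by
    intro t ht
    obtain ⟨j, hj⟩ := Schedule.busy_iff.1 ht
    obtain ⟨h7, _, h9⟩ := h2 t j hj
    exact h9.trans_le (hI.d_le h7.1 h7.2.1 hkn)
  have hlt : ∀ t j, S t = some j → t < S.cmax (I.r s) := fun t j ht =>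
    (Schedule.cmax_spec hB ⟨t, Schedule.busy_iff.2 ⟨j, ht⟩⟩ _).1 t (Schedule.busy_iff.2 ⟨j, ht⟩)
  refine ⟨{t | S t = some k}.ncard, ?_, S, ⟨fun t j ht => ?_, fun t j ht => ?_,
    fun t j ht => (h2 t j ht).2.2, fun j => ?_⟩, h6⟩
  · by_cases hk : (I.modify s k q).r k < S.cmax (I.r s)
    · rw [h3 k ⟨hk1, le_rfl, by rw [hrk]; exact le_max_left _ _, hk⟩]
      simp [modify]
    · convert Nat.zero_le q
      convert Set.ncard_empty ℤ
      ext t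
      simp only [Set.mem_ofPred_eq, Set.mem_empty_iff_false, iff_false]
      exact fun ht => hk (h2 t k ht).1.2.2.2
  · have h7 := h2 t j ht
    have := hlt t j ht
    omega
  · have h7 := h2 t j ht
    by_cases hj : j = k
    · subst hj
      rw [hrk] at h7
      omega
    · rw [hrj j hj] at h7
      omega
  · by_cases hj : j = k
    · subst hj
      simp [work_pred_self _ _ hk1]
    · simp only [Pi.add_apply, Pi.single_eq_of_ne hj, add_zero]
      by_cases hw : 1 ≤ j ∧ j ≤ k - 1 ∧ I.r s ≤ I.r j ∧ I.r j < I.r l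
      · rw [work, if_pos hw, h3 j ⟨hw.1, by omega, by rw [hrj j hj]; exact hw.2.2.1, by
          rw [hrj j hj]; exact h4 j hw.1 hw.2.1 hw.2.2.2⟩]
        simp [modify, hj]
      · rw [work, if_neg hw]
        convert Set.ncard_empty ℤ
        ext t
        simp only [Set.mem_ofPred_eq, Set.mem_empty_iff_false, iff_false]
        intro ht
        have h7 := (h2 t j ht).1
        rw [hrj j hj] at h7
        exact hw ⟨h7.1, by omega, h7.2.2.1, by omega⟩

theorem P_eq {s k g l : ℕ} (hk1 : 1 ≤ k) (hkn : k ≤ I.n) (hl1 : 1 ≤ l) (hlk : l < k)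
    (hsl : I.r s ≤ I.r l) : (I.amountsIn s k g l = ∅ ∧ I.P s k g l = ⊤) ∨
      ∃ q, IsLeast (I.amountsIn s k g l) q ∧ I.P s k g l = q := by
  by_cases h : (I.amountsIn s k g l).Nonempty
  · refine Or.inr ⟨sInf (I.amountsIn s k g l), ⟨Nat.sInf_mem h, fun q hq => Nat.sInf_le hq⟩, ?_⟩
    refine le_antisymm (iInf₂_le _ (hI.amountsIn_subset hk1 hkn hl1 hlk hsl (Nat.sInf_mem h))) ?_
    refine le_iInf₂ fun q hq => ?_
    obtain ⟨q', h1, h2⟩ := hI.exists_mem_amountsIn hk1 hkn hq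
    exact_mod_cast (Nat.sInf_le h2).trans h1
  · rw [Set.not_nonempty_iff_eq_empty] at h
    refine Or.inl ⟨h, ?_⟩
    unfold P
    rw [iInf₂_eq_top]
    intro q hq
    obtain ⟨q', _, h2⟩ := hI.exists_mem_amountsIn hk1 hkn hq
    rw [h] at h2
    exact h2.elim

end Normalized

theorem sum_work_pred {k : ℕ} {a t x : ℤ} (hax : a ≤ x) :
    ∑ j ∈ Finset.Ico 1 k with x ≤ I.r j, I.work (k - 1) a t j =
      ∑ j ∈ Finset.Ico 1 k with x ≤ I.r j ∧ I.r j < t, I.p j := by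
  rw [← Finset.filter_filter, Finset.sum_filter (fun j => I.r j < t)]
  refine Finset.sum_congr rfl fun j hj => ?_
  rw [Finset.mem_filter, Finset.mem_Ico] at hj
  unfold work
  by_cases h : I.r j < t
  · rw [if_pos h, if_pos (by omega)]
  · rw [if_neg h, if_neg (by omega)]

theorem not_overloaded {k : ℕ} {a t : ℤ} {w : ℕ → ℕ} {d : ℕ → ℤ} {S : Schedule}
    (h : Fits I.r d w a t S)
    (hw : ∀ j, 1 ≤ j → j < k → a ≤ I.r j → I.r j < t → I.p j ≤ w j) : ¬ I.Overloaded k a t := by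
  rintro ⟨x, hax, hxt, hlt⟩
  have h1 := h.sum_le (A := Finset.Ico 1 k |>.filter fun j => x ≤ I.r j ∧ I.r j < t) (x := x)
    (fun j hj => (Finset.mem_filter.1 hj).2.1) hxt
  have h2 : ∑ j ∈ Finset.Ico 1 k with x ≤ I.r j ∧ I.r j < t, I.p j ≤
      ∑ j ∈ Finset.Ico 1 k with x ≤ I.r j ∧ I.r j < t, w j := by
    refine Finset.sum_le_sum fun j hj => ?_
    rw [Finset.mem_filter, Finset.mem_Ico] at hj
    exact hw j hj.1.1 hj.1.2 (by omega) hj.2.2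
  omega

/-- Compressing the jobs `j < k` that are released before `t` into `[a, t)`. -/
theorem exists_compressed {k : ℕ} {a t c b : ℤ} {S : Schedule}
    (h : Fits I.r I.d (I.work (k - 1) a c) a b S) (hat : a ≤ t) (htc : t ≤ c)
    (hov : ¬ I.Overloaded k a t) :
    ∃ S', Fits I.r I.d (I.work (k - 1) a t) a t S' ∧ S'.gapCount a t ≤ S.gapCount a t := by
  have hw : ∀ j, I.work (k - 1) a t j ≠ 0 → 1 ≤ j ∧ j < k ∧ a ≤ I.r j := by
    intro j hj
    have := work_ne_zero hj
    omega
  have h' : Fits I.r I.d (I.work (k - 1) a t) a b _ :=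
    (h.restrict {j | I.r j < t}).congr fun j => by
      unfold work
      simp only [Set.mem_ofPred_eq]
      split_ifs <;> first | rfl | omega
  obtain ⟨S', h1, _, h3⟩ := h'.compress (J := Finset.Ico 1 k) (t := t)
    (fun j hj => Finset.mem_Ico.2 ⟨(hw j hj).1, (hw j hj).2.1⟩) (fun j hj => (hw j hj).2.2) hat
    (fun x hax hxt => by
      rw [sum_work_pred hax]
      by_contra hlt
      exact hov ⟨x, hax, hxt, not_le.1 hlt⟩)
  refine ⟨S', h1, h3.trans_eq (Schedule.gapCount_congr fun z _ hzt => ?_)⟩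
  rw [Schedule.busy_iff, Schedule.busy_iff]
  constructor
  · rintro ⟨j, hj⟩
    simp only [Option.filter_eq_some_iff] at hj
    exact ⟨j, hj.1⟩
  · rintro ⟨j, hj⟩
    refine ⟨j, ?_⟩
    simp only [Option.filter_eq_some_iff, Set.mem_ofPred_eq, decide_eq_true_eq]
    exact ⟨hj, (h.release z j hj).trans_lt hzt⟩

end Jobs


/-! ### Overload, earliest completion times and the maximum `U` -/

namespace Schedule

theorem gapCount_extend {S : Schedule} {a c b : ℤ} (hac : a < c) (hc : ¬ S.Busy (c - 1))
    (h : ∀ t, c ≤ t → t < b → ¬ S.Busy t) : S.gapCount a b ≤ S.gapCount a c := by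
  classical
  unfold gapCount
  refine Finset.card_le_card fun t ht => ?_
  simp only [Finset.mem_filter, Finset.mem_Ico] at ht ⊢
  refine ⟨⟨ht.1.1, ?_⟩, ht.2⟩
  by_contra htc
  rcases ht.2.2 with h' | h'
  · omega
  · by_cases htc' : t = c
    · subst htc'
      exact hc h'
    · exact h (t - 1) (by omega) (by omega) h'

/-- Emptying an interval that contains an idle slot does not create a gap. -/
theorem gapCount_clear_le {S S' : Schedule} {c m b e : ℤ} (hmb : m ≤ b)
    (h : ∀ t, m ≤ t → (S'.Busy t ↔ S.Busy t)) (h' : ∀ t, c ≤ t → t < m → ¬ S'.Busy t)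
    (hce : c ≤ e) (hem : e < m) (he : ¬ S.Busy e) : S'.gapCount c b ≤ S.gapCount c b := by
  classical
  obtain ⟨f, hf1, hf2, hf3, hf4⟩ := exists_first (p := fun t => ¬ S.Busy t) hce he
  let R : Finset ℤ := (Finset.Ico (m + 1) b).filter fun t => ¬ S.Busy t ∧ S.Busy (t - 1)
  have hR : ∀ x, x < m → x ∉ R := by
    intro x hx hxR
    simp only [R, Finset.mem_filter, Finset.mem_Ico] at hxR
    omega
  calc S'.gapCount c b ≤ (insert c R).card := by
        unfold gapCount
        refine Finset.card_le_card fun t ht => ?_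
        simp only [R, Finset.mem_filter, Finset.mem_Ico, Finset.mem_insert] at ht ⊢
        obtain ⟨⟨h1, h2⟩, h3, h4⟩ := ht
        rcases h4 with h4 | h4
        · exact Or.inl h4
        · by_cases htc : t = c
          · exact Or.inl htc
          have : m ≤ t - 1 := by
            by_contra hlt
            exact h' (t - 1) (by omega) (by omega) h4
          exact Or.inr ⟨⟨by omega, h2⟩, (h t (by omega)).not.1 h3, (h _ this).1 h4⟩
    _ = (insert f R).card := by
        rw [Finset.card_insert_of_notMem (hR c (by omega)),
          Finset.card_insert_of_notMem (hR f (by omega))]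
    _ ≤ S.gapCount c b := by
        unfold gapCount
        refine Finset.card_le_card fun t ht => ?_
        simp only [R, Finset.mem_filter, Finset.mem_Ico, Finset.mem_insert] at ht ⊢
        rcases ht with rfl | ht
        · refine ⟨⟨hf1, by omega⟩, hf3, ?_⟩
          by_cases h1 : t = c
          · exact Or.inl h1
          · exact Or.inr (not_not.1 (hf4 (t - 1) (by omega) (by omega)))
        · exact ⟨⟨by omega, ht.1.2⟩, ht.2.1, Or.inr ht.2.2⟩

end Schedule

theorem Fits.exists_concat {r d : ℕ → ℤ} {w₁ w₂ : ℕ → ℕ} {a b c : ℤ} {S₁ S₂ : Schedule}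
    (h₁ : Fits r d w₁ a b S₁) (h₂ : Fits r d w₂ b c S₂) (hab : a ≤ b) (hbc : b ≤ c) :
    ∃ S, Fits r d (w₁ + w₂) a c S ∧ S.gapCount a c ≤ S₁.gapCount a b + S₂.gapCount b c ∧
      (∀ t, t < b → S t = S₁ t) ∧ ∀ t, b ≤ t → S t = S₂ t := by
  refine ⟨_, h₁.concat h₂ hab hbc, ?_, fun t ht => if_pos ht, fun t ht => if_neg (not_lt.2 ht)⟩
  refine (Schedule.gapCount_le_add _ hab).trans (Nat.add_le_add ?_ ?_)
  · refine (Schedule.gapCount_congr fun t _ ht => ?_).le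
    simp [Schedule.Busy, ht]
  · refine (Schedule.gapCount_congr fun t ht _ => ?_).le
    simp [Schedule.Busy, not_lt.2 ht]

namespace Jobs

variable {I : Jobs}

namespace Normalized

variable (hI : I.Normalized)
include hI

/-- The end `c` of the window may lie after the completion time. This is harmless, since a job
released before `c` is executed and thus released before the completion time. -/
theorem isSK_of_fits {s k : ℕ} (hk : k ≤ I.n) {c : ℤ} {S : Schedule}
    (h : Fits I.r I.d (I.work k (I.r s) c) (I.r s) c S) : I.IsSK s k S := by
  have hc : ∀ t, S.Busy t → t < c := fun t ht => (h.busy_window ht).2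
  refine ⟨fun hb => ?_, ?_⟩
  · obtain ⟨j, hj⟩ := Schedule.busy_iff.1 (Schedule.cmax_spec hc hb (I.r s)).2
    have h1 := h.deadline _ j hj
    have h2 := work_ne_zero (h.amount_ne_zero hj)
    have := hI.d_le h2.1 h2.2.1 hk
    omega
  · refine executes_of_fits (a' := I.r s) (B := c) (h.congr fun j => congrFun
      (work_eq_of_no_release fun j hj1 hjk hsj => ⟨fun hjc => ?_, fun hjc => ?_⟩) j)
    · obtain ⟨t, ht⟩ := h.exists_slot (j := j) (by
        rw [work, if_pos ⟨hj1, hjk, hsj, hjc⟩]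
        exact hI.p_ne_zero hj1 (by omega))
      have hb : S.Busy t := Schedule.busy_iff.2 ⟨j, ht⟩
      exact (h.release t j ht).trans_lt ((Schedule.cmax_spec hc ⟨t, hb⟩ _).1 t hb)
    · by_cases hb : ∃ t, S.Busy t
      · have := hc _ (Schedule.cmax_spec hc hb (I.r s)).2
        omega
      · rw [Schedule.cmax_of_not_exists hb] at hjc
        omega

theorem exists_earliestDeadline {s k i : ℕ} (hk : k ≤ I.n) {c : ℤ} {S : Schedule}
    (h : Fits I.r I.d (I.work k (I.r s) c) (I.r s) c S) (hi1 : 1 ≤ i) (hik : i ≤ k)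
    (hsi : I.r s ≤ I.r i) (hic : I.r i < c) :
    ∃ c' ≤ c, ∃ S', I.IsSK s k S' ∧ I.EarliestDeadline S' ∧ S'.CompletesAt i c' := by
  obtain ⟨S', h1, _, h3⟩ := h.edf
  obtain ⟨t, ht⟩ := h1.exists_slot (j := i) (by
    rw [work, if_pos ⟨hi1, hik, hsi, hic⟩]
    exact hI.p_ne_zero hi1 (by omega))
  obtain ⟨u, hu1, hu2, hu3, hu4⟩ := Schedule.exists_last (p := fun t => S' t = some i) (b := c)
    (h1.window t i ht).2.le ht
  have := (h1.window u i hu3).2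
  refine ⟨u + 1, by omega, S', hI.isSK_of_fits hk h1, h3, by simpa using hu3,
    fun v hv hvi => ?_⟩
  exact hu4 v (by omega) (h1.window v i hvi).2.le hvi

/-- Without overload, the jobs below `k` released in `[r_s, t)` can be compressed into this interval
and put in earliest-deadline order, so each of their times `C_{s,j}` is at most `t`. With overload,
the latest-deadline job of a suitably chosen interval completes after `t` in every earliest-deadline
schedule. -/
theorem overloaded_iff {s k : ℕ} (hk1 : 1 ≤ k) (hkn : k ≤ I.n) {t : ℤ} (hst : I.r s ≤ t) :
    (∃ j ∈ Finset.Ico 1 k, I.r s ≤ I.r j ∧ I.r j < t ∧ t < I.earliest s j) ↔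
      I.Overloaded k (I.r s) t := by
  classical
  constructor
  · rintro ⟨j, hj, hsj, hjt, hlt⟩
    rw [Finset.mem_Ico] at hj
    by_contra hov
    obtain ⟨F, hF⟩ := hI.exists_fits (k := k - 1) (by omega) (I.r s) t
    obtain ⟨S, hS, _⟩ := exists_compressed hF hst le_rfl hov
    obtain ⟨c, hct, S', h1, h2, h3⟩ := hI.exists_earliestDeadline (k := k - 1) (by omega) hS hj.1
      (by omega) hsj hjt
    have : I.earliest s j ≤ c := by
      refine csInf_le ⟨I.r j, ?_⟩ ⟨k - 1, S', by omega, by omega, h1, h2, h3⟩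
      rintro c' ⟨k', S'', _, _, h4, _, h6⟩
      have := (h4.2.1 _ _ h6.1).2.1
      omega
    omega
  · rintro ⟨x₀, hx₀, hx₀t, hlt₀⟩
    let W : ℤ → ℤ → ℤ := fun x y =>
      ((∑ j ∈ Finset.Ico 1 k with x ≤ I.r j ∧ I.r j < y, I.p j : ℕ) : ℤ)
    have hW : ∀ x y, x ≤ y → y ≤ t → W x t = W x y + W y t := by
      intro x y hxy hyt
      simp only [W]
      rw [← Nat.cast_add, ← Finset.sum_union]
      · congr 2
        ext j
        simp only [Finset.mem_filter, Finset.mem_union]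
        by_cases h : I.r j < y
        · simp [h]; omega
        · simp [h]; intros; omega
      · rw [Finset.disjoint_left]
        intro j hj hj'
        simp only [Finset.mem_filter] at hj hj'
        omega
    -- `x` will be the last maximizer of the excess `W x t - (t - x)`. Then the work released in
    -- `[x, y)` exceeds `y - x` for every `y` with `x < y ≤ t`.
    obtain ⟨x₁, hx₁, hmax⟩ := Finset.exists_max_image (Finset.Icc (I.r s) t)
      (fun x => W x t - (t - x)) ⟨t, Finset.mem_Icc.2 ⟨hst, le_rfl⟩⟩
    rw [Finset.mem_Icc] at hx₁
    obtain ⟨x, hx1, hxt, hx2, hx3⟩ := Schedule.exists_last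
      (p := fun x => W x t - (t - x) = W x₁ t - (t - x₁)) hx₁.2 rfl
    have hlt : ∀ y, x < y → y ≤ t → y - x < W x y := by
      intro y hxy hyt
      have h1 : W y t - (t - y) ≤ W x₁ t - (t - x₁) :=
        hmax y (Finset.mem_Icc.2 ⟨by omega, hyt⟩)
      have h2 := hx3 y hxy hyt
      have h3 := hW x y hxy.le hyt
      omega
    have hpos : 0 < W x t - (t - x) := by
      have : W x₀ t - (t - x₀) ≤ W x₁ t - (t - x₁) :=
        hmax x₀ (Finset.mem_Icc.2 ⟨hx₀, hx₀t⟩)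
      have h4 : t - x₀ < W x₀ t := hlt₀
      omega
    have hne : (Finset.filter (fun j => x ≤ I.r j ∧ I.r j < t) (Finset.Ico 1 k)).Nonempty := by
      rw [Finset.nonempty_iff_ne_empty]
      intro h0
      have : W x t = 0 := by
        simp only [W, h0, Finset.sum_empty, Nat.cast_zero]
      omega
    -- The largest index means the latest deadline among the jobs below `k` released in `[x, t)`.
    obtain ⟨i, hi, himax⟩ := Finset.exists_max_image _ (fun j => j) hne
    simp only [Finset.mem_filter, Finset.mem_Ico] at hi himax
    refine ⟨i, Finset.mem_Ico.2 hi.1, by omega, hi.2.2, ?_⟩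
    by_contra hle
    push Not at hle
    obtain ⟨F, hF⟩ := hI.exists_fits le_rfl (I.r s) (I.d I.n)
    obtain ⟨c', _, S', h1, h2, h3⟩ := hI.exists_earliestDeadline le_rfl hF hi.1.1
      (by omega) (by omega) (hI.r_lt_d hi.1.1 (by omega) le_rfl)
    obtain ⟨k', S, hik', hk'n, hS, hED, hcomp⟩ := Int.csInf_mem
      (s := {c | ∃ k S, i ≤ k ∧ k ≤ I.n ∧ I.IsSK s k S ∧ I.EarliestDeadline S ∧
        S.CompletesAt i c}) ⟨c', I.n, S', by omega, le_rfl, h1, h2, h3⟩ ⟨I.r i, by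
          rintro c' ⟨k', S'', _, _, h4, _, h6⟩
          have := (h4.2.1 _ _ h6.1).2.1
          omega⟩
    change S.CompletesAt i (I.earliest s i) at hcomp
    set c := I.earliest s i with hc
    have hric : I.r i ≤ c - 1 := (hS.2.1 _ _ hcomp.1).2.1
    have hB : ∀ t, S.Busy t → t < I.d k' := by
      intro u hu
      obtain ⟨j, hj⟩ := Schedule.busy_iff.1 hu
      obtain ⟨h7, _, h9⟩ := hS.2.1 u j hj
      exact h9.trans_le (hI.d_le h7.1 h7.2.1 hk'n)
    have hcm : c - 1 < S.cmax (I.r s) := by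
      have hb : S.Busy (c - 1) := Schedule.busy_iff.2 ⟨i, hcomp.1⟩
      exact (Schedule.cmax_spec hB ⟨_, hb⟩ _).1 _ hb
    have hfit := Executes.fits hS.2 hB
    -- Job `i` runs in slot `c - 1` although its deadline is the latest among these jobs, so those
    -- released before `c` are no longer pending at `c`. All of them are executed within `[x, c)`,
    -- which contradicts the overload of this interval.
    have hA := (hfit.restrict {j | j ∈ Finset.Ico 1 k ∧ x ≤ I.r j ∧ I.r j < c}).mono
      (r' := I.r) (d' := I.d) (a' := x) (b' := c) (by
        intro u j hu
        simp only [Option.filter_eq_some_iff, Set.mem_ofPred_eq, decide_eq_true_eq,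
          Finset.mem_Ico] at hu
        obtain ⟨hu, hj1, hj2, hj3⟩ := hu
        have hru := hfit.release u j hu
        refine ⟨by omega, ?_, hru, hfit.deadline u j hu⟩
        by_contra huc
        push Not at huc
        have hd := hED (c - 1) i hcomp.1 u j (by omega) hu (by omega)
        have hji : j ≤ i := himax j ⟨hj1, hj2, by omega⟩
        have : j ≠ i := by
          rintro rfl
          exact hcomp.2 u huc hu
        have := hI.d_lt (j := j) (k := i) hj1.1 (by omega) (by omega)
        omega)
    have h5 := hA.sum_le (A := (Finset.Ico 1 k).filter fun j => x ≤ I.r j ∧ I.r j < c) (x := x)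
      (fun j hj => (Finset.mem_filter.1 hj).2.1) (by omega)
    rw [Finset.sum_congr rfl (g := fun j => I.p j) (by
      intro j hj
      rw [Finset.mem_filter] at hj
      have hj1 := Finset.mem_Ico.1 hj.1
      have hji : j ≤ i := himax j ⟨hj1, hj.2.1, by omega⟩
      simp only [Set.mem_ofPred_eq]
      rw [if_pos hj, work, if_pos (by omega)])] at h5
    have h6 : c - x < W x c := hlt c (by omega) hle
    simp only [W] at h6
    omega

/-- Job `l` is released at `r_l`, so a busy block can be appended there. It contains the jobs
released during the block and costs no gap. -/
theorem exists_completion_gt {s k l g : ℕ} (hk : k ≤ I.n) (hl1 : 1 ≤ l) (hlk : l ≤ k)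
    (hsl : I.r s ≤ I.r l) {S : Schedule}
    (hS : Fits I.r I.d (I.work k (I.r s) (I.r l)) (I.r s) (I.r l) S)
    (hg : S.gapCount (I.r s) (I.r l) ≤ g) : ∃ c ∈ I.completions s k g, I.r l < c := by
  obtain ⟨F, hF⟩ := hI.exists_fits hk (I.r l) (I.d k)
  have hrd := hI.r_lt_d hl1 hlk hk
  obtain ⟨t, S', hlt, htd, hS', hbusy⟩ := hF.exists_block (J := Finset.Icc 1 k) (i := l)
    (fun j hj => Finset.mem_Icc.2 ⟨(work_ne_zero hj).1, (work_ne_zero hj).2.1⟩)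
    (fun j hj => (work_ne_zero hj).2.2.1) rfl (by
      rw [work, if_pos ⟨hl1, hlk, le_rfl, hrd⟩]
      exact hI.p_ne_zero hl1 (by omega))
  have hS'' : Fits I.r I.d (I.work k (I.r l) t) (I.r l) t S' := hS'.congr fun j => by
    unfold work
    split_ifs <;> first | rfl | omega
  obtain ⟨T, hT, hTg, _, hT2⟩ := hS.exists_concat hS'' hsl hlt.le
  rw [work_add hsl hlt.le] at hT
  refine ⟨t, (hI.mem_completions hk).2 ⟨T, hT, Or.inr ?_, ?_⟩, hlt⟩
  · have := hbusy (t - 1) (by omega) (by omega)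
    unfold Schedule.Busy at this ⊢
    rwa [hT2 _ (by omega)]
  · rw [Schedule.gapCount_eq_zero hbusy] at hTg
    omega

theorem isGreatest_U {s k g : ℕ} (hk : k ≤ I.n) : IsGreatest (I.completions s k g) (I.U s k g) := by
  have hne : (I.completions s k g).Nonempty := by
    refine ⟨I.r s, (hI.mem_completions hk).2 ⟨fun _ => none, ?_, Or.inl rfl, ?_⟩⟩
    · rw [work_eq_zero fun j _ _ h => h]
      exact Fits.empty _ _ _ _
    · rw [Schedule.gapCount_self]
      exact Nat.zero_le _
  have hbdd : BddAbove (I.completions s k g) := by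
    refine ⟨max (I.r s) (I.d k), fun c hc => ?_⟩
    obtain ⟨S, hS, hc | hc, _⟩ := (hI.mem_completions hk).1 hc
    · exact hc.le.trans (le_max_left _ _)
    · obtain ⟨j, hj⟩ := Schedule.busy_iff.1 hc
      have h1 := hS.deadline _ j hj
      have h2 := work_ne_zero (hS.amount_ne_zero hj)
      have := hI.d_le h2.1 h2.2.1 hk
      exact le_trans (by omega) (le_max_right _ _)
  exact ⟨Int.csSup_mem hne hbdd, fun c hc => le_csSup hbdd hc⟩

theorem le_U_of_mem {s k g : ℕ} (hk : k ≤ I.n) {c : ℤ} (hc : c ∈ I.completions s k g) :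
    c ≤ I.U s k g := (hI.isGreatest_U hk).2 hc

theorem U_mem {s k g : ℕ} (hk : k ≤ I.n) : I.U s k g ∈ I.completions s k g :=
  (hI.isGreatest_U hk).1

end Normalized

end Jobs


/-! ### The recurrence for `P` -/

namespace Jobs

variable {I : Jobs}

namespace Normalized

variable (hI : I.Normalized)
include hI

/-- Concatenation of an `(s,k-1)`-schedule ending at `u`, job `k` alone in `[u, r_j)`, and a
schedule from `r_j` on. No job below `k` is released in `[u, r_j)`, and the middle part is busy, so
the bounds on the gaps add up. -/
theorem add_mem_amountsIn {s k g h l j q : ℕ} {u : ℤ} (hk1 : 1 ≤ k) (hkn : k ≤ I.n)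
    (hl1 : 1 ≤ l) (hlk : l < k) (hu : u ∈ I.completions s (k - 1) h)
    (hrel : ∀ i, 1 ≤ i → i ≤ k - 1 → I.r i < I.r j → I.r i < u) (huj : u < I.r j)
    (hku : I.r k ≤ u) (hsu : I.r s ≤ u) (hjl : I.r j ≤ I.r l) (hq : q ∈ I.amountsIn j k g l) :
    (I.r j - u).toNat + q ∈ I.amountsIn s k (h + g) l := by
  obtain ⟨S₁, h1, _, h3⟩ := (hI.mem_completions (by omega)).1 hu
  obtain ⟨S₃, h4, h5⟩ := hq
  have hld := hI.r_lt_d hl1 hlk.le hkn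
  have hblock := Fits.block (r := I.r) (d := I.d) (k := k) (a := u) (b := I.r j) hku (by omega)
  obtain ⟨T, hT, hTg, _⟩ := h1.exists_concat hblock hsu huj.le
  rw [Schedule.gapCount_eq_zero (a := u) (b := I.r j) (fun t h1 h2 => by
    rw [Schedule.Busy, if_pos ⟨h1, h2⟩]; simp)] at hTg
  obtain ⟨T', hT', hTg', _⟩ := hT.exists_concat h4 (by omega) hjl
  refine ⟨T', hT'.congr fun i => ?_, by omega⟩
  rw [work_eq_of_no_release (c' := I.r j) fun i hi1 hik _ => ⟨fun h => by omega, hrel i hi1 hik⟩,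
    ← work_add (k := k - 1) (a := I.r s) (b := I.r j) (c := I.r l) (by omega) hjl, Pi.single_add]
  simp only [Pi.add_apply]
  ring

/-- An optimal schedule in earliest-deadline order is cut at the first slot `t₀` of `k` and at the
next release time `r_j` of a job below `k`; `h` is the number of gaps before `t₀`. Minimality of `q`
makes `k` occupy the whole of `[t₀, r_j)`. Replacing the part before `t₀` by one that ends at
`U_{s,k-1,h} ≥ t₀` can only shorten this stretch. -/
theorem exists_split_of_isLeast {s k g l q : ℕ} (hk1 : 1 ≤ k) (hkn : k ≤ I.n)
    (hl1 : 1 ≤ l) (hlk : l < k) (hsl : I.r s ≤ I.r l) (hq : IsLeast (I.amountsIn s k g l) q)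
    (hU : I.U s (k - 1) g < I.r l) :
    ∃ h ≤ g, ∃ j, 1 ≤ j ∧ j < k ∧ I.r s < I.r j ∧ I.r j ≤ I.r l ∧
      (∀ i, 1 ≤ i → i ≤ k - 1 → I.r i < I.r j → I.r i < I.U s (k - 1) h) ∧
      I.U s (k - 1) h < I.r j ∧ I.r k ≤ I.U s (k - 1) h ∧
      ∃ q' ∈ I.amountsIn j k (g - h) l, (I.r j - I.U s (k - 1) h).toNat + q' ≤ q := by
  have hkn' : k - 1 ≤ I.n := by omega
  obtain ⟨⟨S₀, hS₀, hg₀⟩, hmin⟩ := hq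
  obtain ⟨S, hS, hSb, hED⟩ := hS₀.edf
  have hg : S.gapCount (I.r s) (I.r l) ≤ g :=
    (Schedule.gapCount_congr fun t _ _ => hSb t).trans_le hg₀
  clear hS₀ hg₀ hSb S₀
  have hwk : (I.work (k - 1) (I.r s) (I.r l) + Pi.single k q : ℕ → ℕ) k = q := by
    simp [work_pred_self _ _ hk1]
  have hwj : ∀ j, j ≠ k → (I.work (k - 1) (I.r s) (I.r l) + Pi.single k q : ℕ → ℕ) j =
      I.work (k - 1) (I.r s) (I.r l) j := by
    intro j hj
    simp [hj]
  have hslot : ∀ t j, S t = some j → j ≠ k →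
      1 ≤ j ∧ j ≤ k - 1 ∧ I.r s ≤ I.r j ∧ I.r j < I.r l := by
    intro t j ht hj
    have := hS.amount_ne_zero ht
    rw [hwj j hj] at this
    exact work_ne_zero this
  -- With `q = 0`, a block appended at `r_l` would give an `(s,k-1)`-schedule that ends after `r_l`,
  -- against `hU`.
  have hq0 : q ≠ 0 := by
    rintro rfl
    obtain ⟨c, hc, hlc⟩ := hI.exists_completion_gt hkn' hl1 (by omega) hsl
      (hS.congr (w' := I.work (k - 1) (I.r s) (I.r l)) fun j => by simp) hg
    have := hI.le_U_of_mem hkn' hc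
    omega
  obtain ⟨t₁, ht₁⟩ := hS.exists_slot (j := k) (by rwa [hwk])
  obtain ⟨t₀, hst₀, -, ht₀, hfirst⟩ := Schedule.exists_first (p := fun t => S t = some k)
    (hS.window t₁ k ht₁).1 ht₁
  have ht₀l := (hS.window t₀ k ht₀).2
  have hkt₀ := hS.release t₀ k ht₀
  -- Job `k` has the latest deadline, so by the earliest-deadline order nothing else is pending when
  -- it starts.
  have hpend : ∀ t j, t₀ ≤ t → S t = some j → j ≠ k → t₀ < I.r j := by
    intro t j htt hj hjk
    by_contra hle
    have h1 := hslot t j hj hjk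
    have h2 := hED t₀ k ht₀ t j htt hj (by omega)
    have := hI.d_lt (j := j) (k := k) h1.1 (by omega) hkn
    omega
  have hexec : ∀ j, 1 ≤ j → j ≤ k - 1 → I.r s ≤ I.r j → I.r j < I.r l → ∃ t, S t = some j := by
    intro j h1 h2 h3 h4
    refine hS.exists_slot ?_
    rw [hwj j (by omega), work, if_pos ⟨h1, h2, h3, h4⟩]
    exact hI.p_ne_zero h1 (by omega)
  obtain ⟨j, hj, hjmin⟩ := Finset.exists_min_image
    ((Finset.Ico 1 k).filter fun j => t₀ ≤ I.r j) I.r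
    ⟨l, Finset.mem_filter.2 ⟨Finset.mem_Ico.2 ⟨hl1, hlk⟩, ht₀l.le⟩⟩
  rw [Finset.mem_filter, Finset.mem_Ico] at hj
  obtain ⟨⟨hj1, hjk⟩, ht₀j⟩ := hj
  have hjl : I.r j ≤ I.r l :=
    hjmin l (Finset.mem_filter.2 ⟨Finset.mem_Ico.2 ⟨hl1, hlk⟩, ht₀l.le⟩)
  have hrel : ∀ i, 1 ≤ i → i ≤ k - 1 → I.r i < I.r j → I.r i < t₀ := by
    intro i hi1 hik hij
    by_contra hle
    have := hjmin i (Finset.mem_filter.2 ⟨Finset.mem_Ico.2 ⟨hi1, by omega⟩, not_lt.1 hle⟩)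
    omega
  have ht₀j' : t₀ < I.r j := by
    rcases ht₀j.lt_or_eq with h | h
    · exact h
    · obtain ⟨t, ht⟩ := hexec j hj1 (by omega) (by omega) (by omega)
      have := hpend t j (h.trans_le (hS.release t j ht)) ht (by omega)
      omega
  -- the part of the schedule before the first slot of `k`
  have hbefore := hS.before (w' := I.work (k - 1) (I.r s) t₀) t₀ (by
    intro i
    by_cases hi : 1 ≤ i ∧ i ≤ k - 1 ∧ I.r s ≤ I.r i ∧ I.r i < t₀
    · have h1 := hS.amount i
      rw [hwj i (by omega), work, if_pos (by omega)] at h1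
      rw [work, if_pos hi, ← h1]
      congr 1
      ext t
      simp only [Set.mem_ofPred_eq, and_iff_right_iff_imp]
      intro ht
      by_contra hle
      have := hpend t i (not_lt.1 hle) ht (by omega)
      omega
    · rw [work, if_neg hi]
      convert Set.ncard_empty ℤ
      ext t
      simp only [Set.mem_ofPred_eq, Set.mem_empty_iff_false, iff_false]
      rintro ⟨h1, h2⟩
      by_cases hik : i = k
      · subst hik
        exact hfirst t (hS.window t i h2).1 h1 h2
      · have h3 := hslot t i h2 hik
        have h4 := hS.release t i h2
        omega)
  set Sb : Schedule := fun t => if t < t₀ then S t else none with hSb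
  have hSbb : ∀ t, t < t₀ → (Sb.Busy t ↔ S.Busy t) := by
    intro t ht
    simp [hSb, Schedule.Busy, ht]
  have hSbi : ∀ t, t₀ ≤ t → ¬ Sb.Busy t := by
    intro t ht
    simp [hSb, Schedule.Busy, not_lt.2 ht]
  have hbg : Sb.gapCount (I.r s) t₀ = S.gapCount (I.r s) t₀ :=
    Schedule.gapCount_congr fun t _ ht => hSbb t ht
  have hwb : I.work (k - 1) (I.r s) t₀ = I.work (k - 1) (I.r s) (I.r j) :=
    work_eq_of_no_release fun i hi1 hik _ => ⟨fun h => by omega, hrel i hi1 hik⟩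
  have hbefore' : Fits I.r I.d (I.work (k - 1) (I.r s) (I.r j)) (I.r s) (I.r j) Sb := by
    rw [← hwb]
    exact hbefore.mono fun t i ht => ⟨(hbefore.window t i ht).1,
      (hbefore.window t i ht).2.trans ht₀j', hbefore.release t i ht, hbefore.deadline t i ht⟩
  -- the part of the schedule after the next release
  set q' := {t | I.r j ≤ t ∧ S t = some k}.ncard with hq'
  have hafter := hS.after (w' := I.work (k - 1) (I.r j) (I.r l) + Pi.single k q') (I.r j) (by
    intro i
    by_cases hik : i = k
    · subst hik
      simp [work_pred_self _ _ hk1, hq']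
    · rw [Pi.add_apply, Pi.single_eq_of_ne hik, add_zero]
      by_cases hi : 1 ≤ i ∧ i ≤ k - 1 ∧ I.r j ≤ I.r i ∧ I.r i < I.r l
      · have h1 := hS.amount i
        rw [hwj i (by omega), work, if_pos (by omega)] at h1
        rw [work, if_pos hi, ← h1]
        congr 1
        ext t
        simp only [Set.mem_ofPred_eq, and_iff_right_iff_imp]
        exact fun ht => hi.2.2.1.trans (hS.release t i ht)
      · rw [work, if_neg hi]
        convert Set.ncard_empty ℤ
        ext t
        simp only [Set.mem_ofPred_eq, Set.mem_empty_iff_false, iff_false]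
        rintro ⟨h1, h2⟩
        have h3 := hslot t i h2 hik
        have h4 := hpend t i (by omega) h2 hik
        have h5 := hrel i h3.1 h3.2.1
        omega)
  set Sa : Schedule := fun t => if t < I.r j then none else S t with hSa
  have hSab : ∀ t, I.r j ≤ t → (Sa.Busy t ↔ S.Busy t) := by
    intro t ht
    simp [hSa, Schedule.Busy, not_lt.2 ht]
  have hag : Sa.gapCount (I.r j) (I.r l) = S.gapCount (I.r j) (I.r l) :=
    Schedule.gapCount_congr fun t ht _ => hSab t ht
  have hbt₀ : S.Busy t₀ := Schedule.busy_iff.2 ⟨k, ht₀⟩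
  have hsplit := S.gapCount_add (a := I.r s) (c := t₀) (b := I.r l) hst₀ ht₀l.le
    (Or.inr (Or.inr hbt₀))
  have hq'q : q' < q := by
    have h1 := hS.amount k
    rw [hwk] at h1
    rw [← h1]
    refine Set.ncard_lt_ncard ⟨fun t ht => ht.2, fun hsub => ?_⟩ (hS.finite k)
    have := (hsub ht₀).1
    omega
  have hnot : ∀ m, m ∈ I.amountsIn s k g l → q ≤ m := fun m hm => hmin hm
  -- If some slot of `[t₀, r_j)` were idle, the whole interval could be emptied without a new gap,
  -- and the smaller amount `q'` would suffice.
  have hidle : ∀ t, t₀ ≤ t → t < I.r j → S.Busy t := by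
    intro e he1 he2
    by_contra he3
    obtain ⟨T, hT, _, hT1, hT2⟩ := hbefore'.exists_concat hafter (by omega) hjl
    refine absurd (hnot q' ⟨T, hT.congr fun i => ?_, ?_⟩) (not_le.2 hq'q)
    · rw [← work_add (k := k - 1) (a := I.r s) (b := I.r j) (c := I.r l) (by omega) hjl]
      simp only [Pi.add_apply]
      ring
    · refine le_trans (T.gapCount_le_add hst₀) (le_trans ?_ hg)
      rw [← hsplit]
      refine Nat.add_le_add (le_of_eq ?_) ?_
      · rw [← hbg]
        exact Schedule.gapCount_congr fun t _ ht => by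
          rw [Schedule.Busy, hT1 t (by omega), ← Schedule.Busy]
      · refine Schedule.gapCount_clear_le (m := I.r j) hjl (fun t ht => ?_) (fun t h1 h2 => ?_)
          he1 he2 he3
        · rw [Schedule.Busy, hT2 t ht]
          exact hSab t ht
        · rw [Schedule.Busy, hT1 t h2]
          exact hSbi t h1
  have hslots : ∀ t, t₀ ≤ t → t < I.r j → S t = some k := by
    intro t h1 h2
    obtain ⟨i, hi⟩ := Schedule.busy_iff.1 (hidle t h1 h2)
    by_cases hik : i = k
    · rwa [← hik]
    · have h3 := hslot t i hi hik
      have h4 := hpend t i h1 hi hik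
      have h5 := hS.release t i hi
      have h6 := hrel i h3.1 h3.2.1 (by omega)
      omega
  have hqeq : q = (I.r j - t₀).toNat + q' := by
    have h1 := hS.amount k
    rw [hwk] at h1
    have h2 : {t | S t = some k} = ↑(Finset.Ico t₀ (I.r j)) ∪ {t | I.r j ≤ t ∧ S t = some k} := by
      ext t
      simp only [Set.mem_ofPred_eq, Set.mem_union, Finset.coe_Ico, Set.mem_Ico]
      constructor
      · intro ht
        by_cases htj : I.r j ≤ t
        · exact Or.inr ⟨htj, ht⟩
        · refine Or.inl ⟨?_, not_le.1 htj⟩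
          by_contra hlt
          exact hfirst t (hS.window t k ht).1 (not_le.1 hlt) ht
      · rintro (ht | ht)
        · exact hslots t ht.1 ht.2
        · exact ht.2
    rw [h2, Set.ncard_union_eq _ (Finset.finite_toSet _) ((hS.finite k).subset fun t ht => ht.2),
      Set.ncard_coe_finset, Int.card_Ico] at h1
    · exact h1.symm
    · rw [Set.disjoint_left]
      intro t ht ht'
      simp only [Finset.coe_Ico, Set.mem_Ico, Set.mem_ofPred_eq] at ht ht'
      omega
  set h := S.gapCount (I.r s) t₀ with hh
  have hsplit' := S.gapCount_add (a := t₀) (c := I.r j) (b := I.r l) ht₀j hjl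
    (Or.inr (Or.inl (hidle _ (by omega) (by omega))))
  rw [Schedule.gapCount_eq_zero hidle] at hsplit'
  -- If `t₀ ≠ r_s` and the slot before `t₀` is idle, the gap there extends to `r_j` for free. A
  -- block appended at `r_j` then gives a completion time even beyond `r_j`.
  have ht₀U : t₀ ≤ I.U s (k - 1) h := by
    by_cases hcase : t₀ = I.r s ∨ S.Busy (t₀ - 1)
    · refine hI.le_U_of_mem hkn' ((hI.mem_completions hkn').2 ⟨Sb, hbefore, ?_, hbg.le⟩)
      rwa [hSbb (t₀ - 1) (by omega)]
    · push Not at hcase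
      obtain ⟨c, hc, hlc⟩ := hI.exists_completion_gt (g := h) hkn' hj1 (by omega) (by omega)
        hbefore' (by
          rw [← hbg]
          exact Schedule.gapCount_extend (by omega)
            (by rw [hSbb (t₀ - 1) (by omega)]; exact hcase.2) fun t ht _ => hSbi t ht)
      have := hI.le_U_of_mem hkn' hc
      omega
  -- Otherwise the schedule that attains `U_{s,k-1,h}` could be compressed into `[r_s, r_j)` with at
  -- most `h` gaps, and the units of `k` before `r_j` would be superfluous.
  have hUj : I.U s (k - 1) h < I.r j := by
    by_contra hle
    push Not at hle
    obtain ⟨T, hT, _, hTg⟩ := (hI.mem_completions hkn').1 (hI.U_mem (s := s) (g := h) hkn')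
    obtain ⟨T', hT', hTg'⟩ := exists_compressed hT (t := I.r j) (by omega) hle
      (not_overloaded hbefore' fun i h1 h2 h3 h4 => by rw [work, if_pos (by omega)])
    obtain ⟨T'', hT'', hTg'', _⟩ := hT'.exists_concat hafter (by omega) hjl
    refine absurd (hnot q' ⟨T'', hT''.congr fun i => ?_, ?_⟩) (not_le.2 hq'q)
    · rw [← work_add (k := k - 1) (a := I.r s) (b := I.r j) (c := I.r l) (by omega) hjl]
      simp only [Pi.add_apply]
      ring
    · have := T.gapCount_mono_right (a := I.r s) hle
      omega
  refine ⟨h, by omega, j, hj1, hjk, by omega, hjl, fun i hi1 hik hij => ?_, hUj, by omega, q',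
    ⟨Sa, hafter, by omega⟩, by omega⟩
  exact (hrel i hi1 hik hij).trans_le ht₀U

/-- Induction on `r_l - r_s`, since the recurrence passes from `s` to a job `j` released later. One
inequality is the splitting of an optimal schedule, the other one is concatenation. -/
theorem stepP_eq {k : ℕ} (hk1 : 1 ≤ k) (hkn : k ≤ I.n) {V : ℕ → ℕ → WithBot ℤ}
    (hV : ∀ s g, 1 ≤ s → s ≤ I.n → g < I.n → V s g = (I.U s (k - 1) g : WithBot ℤ))
    {l : ℕ} (hl1 : 1 ≤ l) (hlk : l < k) (m : ℕ) :
    ∀ s g, (I.r l - I.r s).toNat ≤ m → 1 ≤ s → s ≤ I.n → g < I.n → I.r s ≤ I.r l →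
      I.stepP k V l s g = I.P s k g l := by
  induction m using Nat.strong_induction_on with
  | _ m ih =>
  intro s g hm hs1 hsn hgn hsl
  have hkn' : k - 1 ≤ I.n := by omega
  rw [stepP]
  have hov := hI.overloaded_iff (s := s) hk1 hkn hsl
  by_cases hbad : I.Overloaded k (I.r s) (I.r l)
  · rw [if_pos (hov.2 hbad)]
    rcases hI.P_eq (g := g) hk1 hkn hl1 hlk hsl with ⟨_, h⟩ | ⟨q, ⟨⟨S, hS, _⟩, _⟩, _⟩
    · exact h.symm
    · refine absurd hbad (not_overloaded hS fun i h1 h2 h3 h4 => ?_)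
      rw [Pi.add_apply, work, if_pos (by omega)]
      omega
  rw [if_neg (mt hov.1 hbad), hV s g hs1 hsn hgn]
  clear hov
  by_cases hU : I.r l ≤ I.U s (k - 1) g
  · rw [if_pos (WithBot.coe_le_coe.2 hU)]
    obtain ⟨T, hT, _, hTg⟩ := (hI.mem_completions hkn').1 (hI.U_mem (s := s) (g := g) hkn')
    obtain ⟨T', hT', hTg'⟩ := exists_compressed hT hsl hU hbad
    have h0 : 0 ∈ I.amountsIn s k g l := ⟨T', hT'.congr fun i => by simp, by
      have := T.gapCount_mono_right (a := I.r s) hU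
      omega⟩
    rcases hI.P_eq (g := g) hk1 hkn hl1 hlk hsl with ⟨h, _⟩ | ⟨q, hq, h⟩
    · rw [h] at h0
      exact h0.elim
    · have := hq.2 h0
      rw [h, Nat.le_zero.1 this]
      rfl
  rw [if_neg (mt WithBot.coe_le_coe.1 hU)]
  push Not at hU
  refine le_antisymm ?_ ?_
  · rcases hI.P_eq (g := g) hk1 hkn hl1 hlk hsl with ⟨_, h⟩ | ⟨q, hq, h⟩
    · rw [h]
      exact le_top
    · obtain ⟨h, hhg, j, hj1, hjk, hsj, hjl, hrel, hUj, hkU, q', hq', hle⟩ :=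
        hI.exists_split_of_isLeast hk1 hkn hl1 hlk hsl hq hU
      refine (Finset.inf_le (Finset.mem_range.2 (show h < g + 1 by omega))).trans ?_
      refine (Finset.inf_le (Finset.mem_Ico.2 ⟨hj1, hjk⟩)).trans ?_
      have hP : I.P j k (g - h) l ≤ q' := by
        rcases hI.P_eq (g := g - h) hk1 hkn hl1 hlk hjl with ⟨h1, _⟩ | ⟨q₁, hq₁, h1⟩
        · rw [h1] at hq'
          exact hq'.elim
        · rw [h1]
          exact_mod_cast hq₁.2 hq'
      rw [hV s h hs1 hsn (by omega), dif_pos ⟨hsj, hjl, prevr_lt_iff.2 hrel,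
        WithBot.coe_lt_coe.2 hUj, WithBot.coe_le_coe.2 hkU⟩,
        ih (I.r l - I.r j).toNat (by omega) j (g - h) le_rfl hj1 (by omega) (by omega) hjl,
        WithBot.unbotD_coe, ‹I.P s k g l = q›]
      refine (add_le_add_right hP _).trans ?_
      exact_mod_cast hle
  · refine Finset.le_inf fun h hh => Finset.le_inf fun j hj => ?_
    rw [Finset.mem_range] at hh
    rw [Finset.mem_Ico] at hj
    rw [hV s h hs1 hsn (by omega)]
    split_ifs with hcond
    · obtain ⟨hsj, hjl, hrel, hUj, hkU⟩ := hcond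
      rw [prevr_lt_iff] at hrel
      rw [WithBot.coe_lt_coe] at hUj
      rw [WithBot.coe_le_coe] at hkU
      rw [ih (I.r l - I.r j).toNat (by omega) j (g - h) le_rfl hj.1 (by omega) (by omega) hjl,
        WithBot.unbotD_coe]
      rcases hI.P_eq (g := g - h) hk1 hkn hl1 hlk hjl with ⟨_, h1⟩ | ⟨q₁, hq₁, h1⟩
      · rw [h1, add_top]
        exact le_top
      · have hsU : I.r s ≤ I.U s (k - 1) h := by
          obtain ⟨T, hT, hc, _⟩ := (hI.mem_completions hkn').1 (hI.U_mem (s := s) (g := h) hkn')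
          rcases hc with hc | hc
          · exact hc.ge
          · have := hT.busy_window hc
            omega
        have h2 := hI.add_mem_amountsIn hk1 hkn hl1 hlk (hI.U_mem (s := s) (g := h) hkn') hrel hUj
          hkU hsU hjl hq₁.1
        rw [show h + (g - h) = g by omega] at h2
        rw [h1]
        rcases hI.P_eq (g := g) hk1 hkn hl1 hlk hsl with ⟨h3, _⟩ | ⟨q, hq, h3⟩
        · rw [h3] at h2
          exact h2.elim
        · rw [h3]
          exact_mod_cast hq.2 h2
    · exact le_top

end Normalized

end Jobs


/-! ### Schedules for the options in the recurrence for `U` -/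

namespace Schedule

/-- Emptying a slot before an idle slot does not create a gap. -/
theorem gapCount_erase_le_of_right {S S' : Schedule} {a b y : ℤ} (hay : a ≤ y) (hyb : y + 1 < b)
    (h : ∀ z, S'.Busy z ↔ z ≠ y ∧ S.Busy z) (hy : S.Busy y) (hy1 : ¬ S.Busy (y + 1)) :
    S'.gapCount a b ≤ S.gapCount a b := by
  classical
  unfold gapCount
  set R := (Finset.Ico a b).filter fun t => ¬ S.Busy t ∧ (t = a ∨ S.Busy (t - 1)) with hR
  have hmem : y + 1 ∈ R := by
    rw [hR, Finset.mem_filter, Finset.mem_Ico]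
    exact ⟨⟨by omega, hyb⟩, hy1, Or.inr (by simpa using hy)⟩
  calc _ ≤ (insert y (R.erase (y + 1))).card := by
        refine Finset.card_le_card fun t ht => ?_
        simp only [hR, Finset.mem_filter, Finset.mem_Ico, Finset.mem_insert,
          Finset.mem_erase, h] at ht ⊢
        obtain ⟨h1, h2, h3⟩ := ht
        by_cases hty : t = y
        · exact Or.inl hty
        · refine Or.inr ⟨?_, h1, fun hb => h2 ⟨hty, hb⟩, h3.imp_right And.right⟩
          rintro rfl
          rcases h3 with h3 | h3
          · omega
          · exact h3.1 (by omega)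
    _ ≤ (R.erase (y + 1)).card + 1 := Finset.card_insert_le _ _
    _ = R.card := Finset.card_erase_add_one hmem

/-- Emptying a slot after an idle slot does not create a gap. -/
theorem gapCount_erase_le_of_left {S S' : Schedule} {a b y : ℤ} (hay : a < y)
    (h : ∀ z, S'.Busy z ↔ z ≠ y ∧ S.Busy z) (hy1 : ¬ S.Busy (y - 1)) :
    S'.gapCount a b ≤ S.gapCount a b := by
  classical
  unfold gapCount
  refine Finset.card_le_card fun t ht => ?_
  simp only [Finset.mem_filter, Finset.mem_Ico, h] at ht ⊢
  obtain ⟨h1, h2, h3⟩ := ht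
  refine ⟨h1, fun hb => h2 ⟨?_, hb⟩, h3.imp_right And.right⟩
  rintro rfl
  rcases h3 with h3 | h3
  · omega
  · exact hy1 h3.2

end Schedule

namespace Jobs

variable {I : Jobs}

theorem amountsIn_self_zero (I : Jobs) {s k : ℕ} : 0 ∈ I.amountsIn s k 0 s := by
  refine ⟨fun _ => none, (Fits.empty _ _ _ _).congr fun j => ?_, ?_⟩
  · rw [work_eq_zero fun j _ _ h => h]
    simp
  · rw [Schedule.gapCount_self]

theorem completions_mono {s k g g' : ℕ} (hg : g ≤ g') :
    I.completions s k g ⊆ I.completions s k g' := by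
  rintro c ⟨S, h1, h2, h3⟩
  exact ⟨S, h1, h2.trans hg, h3⟩

namespace Normalized

variable (hI : I.Normalized)
include hI

theorem le_of_mem_completions {s k g : ℕ} (hk : k ≤ I.n) {c : ℤ}
    (hc : c ∈ I.completions s k g) : I.r s ≤ c := by
  obtain ⟨S, hS, hc | hc, _⟩ := (hI.mem_completions hk).1 hc
  · exact hc.ge
  · have := hS.busy_window hc
    omega

theorem completion_lt_d {l k g : ℕ} (hkn : k ≤ I.n) (hld : I.r l < I.d k) {u : ℤ}
    (hu : u ∈ I.completions l (k - 1) g) : u < I.d k := by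
  obtain ⟨S, hS, hc | hc, _⟩ := (hI.mem_completions (by omega)).1 hu
  · omega
  · obtain ⟨j, hj⟩ := Schedule.busy_iff.1 hc
    have h1 := hS.deadline _ j hj
    have h2 := work_ne_zero (hS.amount_ne_zero hj)
    have := hI.d_lt (j := j) (k := k) h2.1 (by omega) hkn
    omega

theorem exists_prefix {s k h g l q : ℕ} (hkn : k ≤ I.n) (hsl : I.r s ≤ I.r l)
    (hq : q ∈ I.amountsIn s k h l) {u : ℤ} (hu : u ∈ I.completions l (k - 1) g) :
    ∃ S, Fits I.r I.d (I.work (k - 1) (I.r s) u + Pi.single k q) (I.r s) u S ∧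
      S.gapCount (I.r s) u ≤ h + g ∧ (u = I.r l ∨ S.Busy (u - 1)) := by
  have hlu := hI.le_of_mem_completions (by omega) hu
  obtain ⟨S₁, h1, h2⟩ := hq
  obtain ⟨S₂, h3, h4, h5⟩ := (hI.mem_completions (by omega)).1 hu
  obtain ⟨S, h6, h7, _, h9⟩ := h1.exists_concat h3 hsl hlu
  refine ⟨S, h6.congr fun j => ?_, by omega, ?_⟩
  · rw [← work_add (k := k - 1) hsl hlu]
    simp only [Pi.add_apply]
    ring
  · rcases h4 with h4 | h4
    · exact Or.inl h4
    · right
      have := h3.busy_window h4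
      unfold Schedule.Busy at h4 ⊢
      rwa [h9 _ (by omega)]

/-- Starting from the amount `q` of job `k` before `r_l` and an `(l,k-1)`-schedule with completion
time `u`, the remaining amount of `k` can be executed from `u` on, without additional gaps. -/
theorem exists_completion_ge {s k h g l q : ℕ} (hk1 : 1 ≤ k) (hkn : k ≤ I.n)
    (hsk : I.r s ≤ I.r k) (hsl : I.r s ≤ I.r l) (hld : I.r l < I.d k)
    (hq : q ∈ I.amountsIn s k h l) (hqp : q ≤ I.p k) {u : ℤ}
    (hu : u ∈ I.completions l (k - 1) g) (hku : I.r k ≤ u) (hqu : q < I.p k ∨ I.r l < u) :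
    ∃ c ∈ I.completions s k (h + g), min (u + (I.p k - q)) (I.d k) ≤ c := by
  obtain ⟨T₀, hT₀, hg₀, hb₀⟩ := hI.exists_prefix hkn hsl hq hu
  have hud := hI.completion_lt_d hkn hld hu
  have hlu := hI.le_of_mem_completions (by omega) hu
  -- If `q = p_k`, nothing remains to be executed, and `hqu` guarantees that the concatenated
  -- schedule ends with a busy slot.
  rcases hqp.lt_or_eq with hqlt | rfl
  swap
  · obtain ⟨t, ht⟩ := hT₀.exists_slot (j := k) (by
      simp only [Pi.add_apply, Pi.single_eq_same]
      have := hI.p_ne_zero hk1 hkn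
      omega)
    have h1 := hT₀.window t k ht
    have h2 := hT₀.release t k ht
    refine ⟨u, (hI.mem_completions hkn).2 ⟨T₀, ?_, ?_, hg₀⟩, ?_⟩
    · rwa [work_eq_add_single hk1 hsk (by omega)]
    · rcases hb₀ with hb | hb
      · omega
      · exact Or.inr hb
    · rw [sub_self, add_zero]
      exact min_le_left _ _
  obtain ⟨m, hm⟩ : ∃ m : ℕ, I.p k = q + m := ⟨I.p k - q, by omega⟩
  have hm0 : m ≠ 0 := by omega
  -- Job `k` is regarded as released at `u`, so that a block can start there. Its deadline is
  -- postponed by `m`, so that a feasible placement is evident: the other jobs before `d_k` and the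
  -- `m` remaining units of `k` after it.
  let r' := Function.update I.r k u
  let d' := Function.update I.d k (I.d k + m)
  have hr'k : r' k = u := Function.update_self ..
  have hd'k : d' k = I.d k + m := Function.update_self ..
  have hr' : ∀ j, j ≠ k → r' j = I.r j := fun j hj => Function.update_of_ne hj ..
  have hd' : ∀ j, j ≠ k → d' j = I.d j := fun j hj => Function.update_of_ne hj ..
  have hdd' : ∀ j, I.d j ≤ d' j := by
    intro j
    by_cases hj : j = k
    · subst hj
      omega
    · rw [hd' j hj]
  obtain ⟨F, hF⟩ := hI.exists_fits (k := k - 1) (by omega) u (I.d k)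
  have hF' : Fits r' d' (I.work (k - 1) u (I.d k)) u (I.d k) F := hF.mono fun t j ht => by
    have h1 := work_ne_zero (hF.amount_ne_zero ht)
    have h2 := hI.d_lt (j := j) (k := k) h1.1 (by omega) hkn
    have h3 := hF.deadline t j ht
    rw [hr' j (by omega), hd' j (by omega)]
    exact ⟨(hF.window t j ht).1, by omega, hF.release t j ht, h3⟩
  have hblock : Fits r' d' (Pi.single k m) (I.d k) (I.d k + m) _ :=
    (Fits.block (r := r') (d := d') (k := k) (a := I.d k) (b := I.d k + m)
      (by omega) (by omega)).congr fun j => by congr; omega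
  obtain ⟨F₂, hF₂, _⟩ := hF'.exists_concat hblock hud.le (by omega)
  have hwF : ∀ j, (I.work (k - 1) u (I.d k) + Pi.single k m : ℕ → ℕ) j ≠ 0 →
      j = k ∨ (1 ≤ j ∧ j < k ∧ u ≤ I.r j) := by
    intro j hj
    by_cases hjk : j = k
    · exact Or.inl hjk
    · rw [Pi.add_apply, Pi.single_eq_of_ne hjk, add_zero] at hj
      have := work_ne_zero hj
      exact Or.inr (by omega)
  obtain ⟨t, S', hut, _, hS', hbusy⟩ := hF₂.exists_block (J := Finset.Icc 1 k) (i := k)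
    (fun j hj => by
      have := hwF j hj
      rw [Finset.mem_Icc]
      omega)
    (fun j hj => by
      rcases hwF j hj with rfl | h1
      · exact hr'k.ge
      · rw [hr' j (by omega)]
        exact h1.2.2) hr'k (by
      simp only [Pi.add_apply, Pi.single_eq_same]
      omega)
  have hmt := hS'.sum_le (A := {k}) (x := u) (by simp [hr'k]) hut.le
  rw [Finset.sum_singleton, hr'k, if_pos hut, Pi.add_apply, work_pred_self _ _ hk1,
    Pi.single_eq_same, zero_add] at hmt
  have hS'' : Fits I.r d' (I.work (k - 1) u t + Pi.single k m) u t S' := by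
    refine (hS'.congr fun j => ?_).mono fun x j hx => ?_
    · by_cases hjk : j = k
      · subst hjk
        rw [hr'k, if_pos hut]
        simp [work_pred_self _ _ hk1]
      · rw [hr' j hjk]
        simp only [Pi.add_apply, Pi.single_eq_of_ne hjk, add_zero, work]
        by_cases hj : 1 ≤ j ∧ j ≤ k - 1
        · have := hI.r_lt_d (k := k) hj.1 (by omega) hkn
          split_ifs <;> first | rfl | omega
        · split_ifs <;> first | rfl | omega
    · have h1 := hS'.release x j hx
      refine ⟨(hS'.window x j hx).1, (hS'.window x j hx).2, ?_, hS'.deadline x j hx⟩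
      by_cases hjk : j = k
      · subst hjk
        omega
      · rwa [hr' j hjk] at h1
  have hT₀' : Fits I.r d' _ (I.r s) u T₀ := hT₀.mono fun x j hx =>
    ⟨(hT₀.window x j hx).1, (hT₀.window x j hx).2, hT₀.release x j hx,
      (hT₀.deadline x j hx).trans_le (hdd' j)⟩
  obtain ⟨T, hT, hTg, _, hT2⟩ := hT₀'.exists_concat hS'' (by omega) hut.le
  rw [Schedule.gapCount_eq_zero hbusy] at hTg
  have hTb : ∀ z, u ≤ z → z < t → T.Busy z := by
    intro z h1 h2
    have := hbusy z h1 h2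
    unfold Schedule.Busy at this ⊢
    rwa [hT2 z h1]
  have hTw : Fits I.r d' (I.work k (I.r s) t) (I.r s) t T := hT.congr fun j => by
    rw [work_eq_add_single hk1 hsk (by omega), ← work_add (k := k - 1) (a := I.r s) (b := u) (c := t) (by omega) hut.le,
      hm, Pi.single_add]
    simp only [Pi.add_apply]
    ring
  have hdl : ∀ {b T'}, Fits I.r d' (I.work k (I.r s) t) (I.r s) b T' → b ≤ I.d k →
      Fits I.r I.d (I.work k (I.r s) t) (I.r s) b T' := by
    intro b T' h1 hb
    refine h1.mono fun x j hx => ?_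
    have h2 := h1.window x j hx
    refine ⟨h2.1, h2.2, h1.release x j hx, ?_⟩
    by_cases hjk : j = k
    · subst hjk
      omega
    · rw [← hd' j hjk]
      exact h1.deadline x j hx
  by_cases htd : t ≤ I.d k
  · refine ⟨t, (hI.mem_completions hkn).2 ⟨T, hdl hTw htd, Or.inr (hTb _ (by omega) (by omega)),
      by omega⟩, (min_le_left _ _).trans (by omega)⟩
  · push Not at htd
    -- The block runs beyond `d_k`. No interval that ends at `d_k` is overloaded because the
    -- original instance is feasible, so everything can be compressed to end there. This restores
    -- the deadline of `k`, and the slot before `d_k` stays busy.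
    obtain ⟨S₃, h1, h2, h3⟩ := hTw.compress (J := Finset.Icc 1 k) (t := I.d k)
      (fun j hj => Finset.mem_Icc.2 ⟨(work_ne_zero hj).1, (work_ne_zero hj).2.1⟩)
      (fun j hj => (work_ne_zero hj).2.2.1) (by omega) (fun x hx hxd => by
        obtain ⟨F₃, hF₃⟩ := hI.exists_fits hkn x (I.d k)
        have h4 := hF₃.sum_le (A := (Finset.Icc 1 k).filter fun j => x ≤ I.r j) (x := x)
          (fun j hj => (Finset.mem_filter.1 hj).2) hxd
        refine le_trans (le_of_eq ?_) h4
        congr 1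
        refine Finset.sum_congr rfl fun j hj => ?_
        rw [Finset.mem_filter, Finset.mem_Icc] at hj
        have := hI.r_lt_d hj.1.1 hj.1.2 hkn
        rw [work, work, if_pos (by omega), if_pos (by omega)])
    refine ⟨I.d k, (hI.mem_completions hkn).2 ⟨S₃, ?_, Or.inr (h2 _ (by omega)
      (hTb _ (by omega) (by omega))), ?_⟩, min_le_right _ _⟩
    · refine (hdl h1 le_rfl).congr fun j => congrFun (work_eq_of_no_release fun j hj hjk _ => ?_) j
      have := hI.r_lt_d hj hjk hkn
      exact ⟨fun _ => this, fun _ => by omega⟩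
    · have := T.gapCount_mono_right (a := I.r s) htd.le
      omega

/-- The remaining units of `k` are executed immediately before `d_k`. The idle period before them
costs one gap, and `hrel` says that no job below `k` is released from `u` up to `d_k`. -/
theorem d_mem_completions {s k h g l q : ℕ} (hk1 : 1 ≤ k) (hkn : k ≤ I.n)
    (hsk : I.r s ≤ I.r k) (hsl : I.r s ≤ I.r l)
    (hq : q ∈ I.amountsIn s k h l) (hqp : q < I.p k) {u : ℤ}
    (hu : u ∈ I.completions l (k - 1) g) (hud : I.p k - q < I.d k - u)
    (hrel : ∀ j, 1 ≤ j → j ≤ k - 1 → I.r j < I.d k → I.r j < u) :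
    I.d k ∈ I.completions s k (h + g + 1) := by
  obtain ⟨T₀, hT₀, hg₀, -⟩ := hI.exists_prefix hkn hsl hq hu
  have hlu := hI.le_of_mem_completions (by omega) hu
  have hrp := hI.r_add_p_le hk1 hkn
  obtain ⟨m, hm⟩ : ∃ m : ℕ, I.p k = q + m := ⟨I.p k - q, by omega⟩
  obtain ⟨T₁, h1, h2, _⟩ := hT₀.exists_concat (Fits.empty I.r I.d u (I.d k - m)) (by omega)
    (by omega)
  have h3 : Schedule.gapCount (fun _ => none) u (I.d k - m) ≤ 1 :=
    Schedule.gapCount_le_one fun t _ _ h => h rfl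
  have hbusy : ∀ z, I.d k - m ≤ z → z < I.d k → Schedule.Busy
      (fun t => if I.d k - m ≤ t ∧ t < I.d k then some k else none) z := by
    intro z hz hz'
    rw [Schedule.Busy, if_pos ⟨hz, hz'⟩]
    simp
  obtain ⟨T₂, h4, h5, _, h6⟩ := h1.exists_concat
    (Fits.block (r := I.r) (d := I.d) (k := k) (a := I.d k - m) (b := I.d k) (by omega) le_rfl)
    (by omega) (by omega)
  rw [Schedule.gapCount_eq_zero hbusy] at h5
  refine (hI.mem_completions hkn).2 ⟨T₂, h4.congr fun j => ?_, Or.inr ?_, by omega⟩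
  · have hkd := hI.r_lt_d hk1 le_rfl hkn
    rw [work_eq_add_single hk1 hsk hkd, work_eq_of_no_release (c' := I.d k)
      fun i hi hik _ => ⟨fun h => by omega, hrel i hi hik⟩, hm, Pi.single_add,
      show (I.d k - (I.d k - (m : ℤ))).toNat = m by omega]
    simp only [Pi.add_apply, Pi.zero_apply]
    ring
  · have := hbusy (I.d k - 1) (by omega) (by omega)
    unfold Schedule.Busy at this ⊢
    rwa [h6 _ (by omega)]

/-- A block at `r_l` extends the empty schedule. This supplies the condition `r_l < u` that
`exists_completion_ge` requires when no unit of `k` is left. -/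
theorem r_lt_U {l k g : ℕ} (hl1 : 1 ≤ l) (hlk : l ≤ k) (hkn : k ≤ I.n) : I.r l < I.U l k g := by
  obtain ⟨c, hc, hlc⟩ := hI.exists_completion_gt (s := l) (l := l) (g := g) hkn hl1 hlk le_rfl
    (S := fun _ => none) (by
      rw [work_eq_zero fun j _ _ h => h]
      exact Fits.empty _ _ _ _) (by
      rw [Schedule.gapCount_self]
      exact Nat.zero_le _)
  exact hlc.trans_le (hI.le_U_of_mem hkn hc)

end Normalized

end Jobs


/-! ### Splitting an optimal schedule for `U` -/

namespace Jobs

variable {I : Jobs}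

namespace Normalized

variable (hI : I.Normalized)
include hI

/-- There is an earliest-deadline `(s,k)`-schedule with completion time `c` and at most `g` gaps in
which, before `c`, no slot of `k` is followed by an idle slot. -/
theorem exists_late_schedule {s k g : ℕ} (hkn : k ≤ I.n) {c : ℤ} (hc : c ∈ I.completions s k g)
    (hsc : I.r s < c) :
    ∃ S, Fits I.r I.d (I.work k (I.r s) c) (I.r s) c S ∧ S.Busy (c - 1) ∧
      S.gapCount (I.r s) c ≤ g ∧
      (∀ t j, S t = some j → ∀ t' i, t ≤ t' → S t' = some i → I.r i ≤ t → I.d j ≤ I.d i) ∧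
      ∀ t, S t = some k → t + 1 < c → S.Busy (t + 1) := by
  classical
  -- Minimizing `Φ` pushes the busy slots to the right. It depends on the busy slots only, so the
  -- earliest-deadline order can be arranged afterwards.
  let Φ : Schedule → ℕ := fun S => ∑ t ∈ Finset.Ico (I.r s) c with S.Busy t, (c - t).toNat
  have hne : ∃ S, Fits I.r I.d (I.work k (I.r s) c) (I.r s) c S ∧ S.Busy (c - 1) ∧
      S.gapCount (I.r s) c ≤ g := by
    obtain ⟨S, h1, h2, h3⟩ := (hI.mem_completions hkn).1 hc
    exact ⟨S, h1, h2.resolve_left (by omega), h3⟩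
  obtain ⟨S₀, ⟨h1, h2, h3⟩, hmin⟩ := (measure Φ).wf.has_min
    {S | Fits I.r I.d (I.work k (I.r s) c) (I.r s) c S ∧ S.Busy (c - 1) ∧
      S.gapCount (I.r s) c ≤ g} hne
  obtain ⟨S, hS, hSb, hED⟩ := h1.edf
  have hSΦ : Φ S = Φ S₀ := by
    simp only [Φ, hSb]
  have hSg : S.gapCount (I.r s) c = S₀.gapCount (I.r s) c :=
    Schedule.gapCount_congr fun t _ _ => hSb t
  refine ⟨S, hS, (hSb _).2 h2, by omega, hED, fun t ht htc => ?_⟩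
  by_contra hidle
  -- `v` is the next busy slot, and the unit in slot `t` could move to `v - 1`. Vacating a slot
  -- before an idle one and filling a slot before a busy one create no gap, so this contradicts the
  -- minimality of `Φ`.
  obtain ⟨v, hv1, hv2, hv3, hv4⟩ := Schedule.exists_first (p := fun z => S.Busy z)
    (show t + 1 ≤ c - 1 by omega) ((hSb _).2 h2)
  have hvt : v ≠ t + 1 := by
    rintro rfl
    exact hidle hv3
  have htw := hS.window t k ht
  have htr := hS.release t k ht
  have hbt : S.Busy t := Schedule.busy_iff.2 ⟨k, ht⟩
  have he : ¬ S.Busy (v - 1) := hv4 _ (by omega) (by omega)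
  have hcd : c ≤ I.d k := by
    obtain ⟨j, hj⟩ := Schedule.busy_iff.1 ((hSb _).2 h2)
    have h4 := hS.deadline _ j hj
    have h5 := work_ne_zero (hS.amount_ne_zero hj)
    have := hI.d_le h5.1 h5.2.1 hkn
    omega
  have hmove := hS.move ht (Schedule.not_busy_iff.1 he) (by omega) (by omega) (by omega) (by omega)
  have hb := Schedule.busy_swap (y := t) he
  simp only [hbt, and_true] at hb
  set S' : Schedule := S ∘ Equiv.swap (v - 1) t
  let S₁ : Schedule := Function.update S t none
  have hS₁ : ∀ z, S₁.Busy z ↔ z ≠ t ∧ S.Busy z := by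
    intro z
    by_cases hz : z = t
    · subst hz
      simp [S₁, Schedule.Busy]
    · simp [S₁, Schedule.Busy, hz]
  have hg1 : S₁.gapCount (I.r s) c ≤ S.gapCount (I.r s) c :=
    Schedule.gapCount_erase_le_of_right htw.1 htc hS₁ hbt hidle
  have hg2 : S'.gapCount (I.r s) c ≤ S₁.gapCount (I.r s) c :=
    Schedule.gapCount_fill_le (e := v - 1) (fun z _ _ => by rw [hb, hS₁]) fun _ => by
      rw [hS₁, sub_add_cancel]
      exact ⟨by omega, hv3⟩
  refine hmin S' ⟨hmove, (hb _).2 (Or.inr ⟨by omega, (hSb _).2 h2⟩), by omega⟩ ?_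
  change Φ S' < Φ S₀
  rw [← hSΦ]
  simp only [Φ]
  set B := (Finset.Ico (I.r s) c).filter fun z => S.Busy z with hB
  have hfil : (Finset.Ico (I.r s) c).filter (fun z => S'.Busy z) = insert (v - 1) (B.erase t) := by
    ext z
    simp only [hB, Finset.mem_filter, Finset.mem_insert, Finset.mem_erase, hb, Finset.mem_Ico]
    constructor
    · rintro ⟨h4, h5 | h5⟩
      · exact Or.inl h5
      · exact Or.inr ⟨h5.1, h4, h5.2⟩
    · rintro (h5 | h5)
      · exact ⟨by omega, Or.inl h5⟩
      · exact ⟨h5.2.1, Or.inr ⟨h5.1, h5.2.2⟩⟩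
  have hsum : (c - t).toNat + ∑ x ∈ B.erase t, (c - x).toNat = ∑ x ∈ B, (c - x).toNat :=
    Finset.add_sum_erase B (fun x => (c - x).toNat)
      (Finset.mem_filter.2 ⟨Finset.mem_Ico.2 htw, hbt⟩)
  rw [hfil, Finset.sum_insert (by simp [hB, he])]
  omega

/-- If some unit of `k` precedes another job, `l` is the job right after the last such unit. It was
released at that moment, because an earlier release would have given it priority over `k`. From
`r_l` on, the other jobs run first and end at `c₁`. If there is no such unit, the cut is at `r_s`
itself, and the pair `(s, 0)` is needed when `s ≥ k`. -/
theorem exists_split_of_isGreatest {s k g : ℕ} (hk1 : 1 ≤ k) (hkn : k ≤ I.n) (hs1 : 1 ≤ s)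
    (hsk : I.r s ≤ I.r k) {c : ℤ} (hc : IsGreatest (I.completions s k g) c) (hkc : I.r k < c) :
    ∃ l h q c₁, h ≤ g ∧ (1 ≤ l ∧ l < k ∨ k ≤ s ∧ l = s ∧ h = 0 ∧ q = 0) ∧ I.r s ≤ I.r l ∧
      q ∈ I.amountsIn s k h l ∧ q ≤ I.p k ∧
      (∀ j, 1 ≤ j → j ≤ k - 1 → I.r j < c → I.r j < c₁) ∧
      (c₁ ∈ I.completions l (k - 1) (g - h) ∧ c = c₁ + (I.p k - q) ∧ I.r k ≤ c₁ ∨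
        h < g ∧ q < I.p k ∧ c = I.d k ∧ c₁ ∈ I.completions l (k - 1) (g - h - 1)) := by
  have hkn' : k - 1 ≤ I.n := by omega
  obtain ⟨S, hS, hbc, hg, hED, hlate⟩ := hI.exists_late_schedule hkn hc.1 (by omega)
  have hslot : ∀ t j, S t = some j → 1 ≤ j ∧ j ≤ k ∧ I.r s ≤ I.r j ∧ I.r j < c :=
    fun t j ht => work_ne_zero (hS.amount_ne_zero ht)
  have hpend : ∀ t t' i, S t = some k → t ≤ t' → S t' = some i → i ≠ k → t < I.r i := by
    intro t t' i ht htt' ht' hik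
    by_contra hle
    have h1 := hslot t' i ht'
    have h2 := hED t k ht t' i htt' ht' (by omega)
    have := hI.d_lt (j := i) (k := k) h1.1 (by omega) hkn
    omega
  have hexec : ∀ j, 1 ≤ j → j ≤ k → I.r s ≤ I.r j → I.r j < c → ∃ t, S t = some j := by
    intro j h1 h2 h3 h4
    refine hS.exists_slot ?_
    rw [work, if_pos ⟨h1, h2, h3, h4⟩]
    exact hI.p_ne_zero h1 (by omega)
  have hcd : c ≤ I.d k := by
    obtain ⟨j, hj⟩ := Schedule.busy_iff.1 hbc
    have h4 := hS.deadline _ j hj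
    have h5 := hslot _ j hj
    have := hI.d_le h5.1 h5.2.1 hkn
    omega
  have hwk : I.work k (I.r s) c k = I.p k := if_pos ⟨hk1, le_rfl, hsk, hkc⟩
  -- the release time `b` after which `k` is executed only after all the other jobs
  obtain ⟨l, hl, hsl, hlc, hlb, hbef, haft⟩ : ∃ l, (1 ≤ l ∧ l < k ∨ k ≤ s ∧ l = s) ∧
      I.r s ≤ I.r l ∧ I.r l ≤ c ∧ (I.r l = I.r s ∨ S.Busy (I.r l - 1)) ∧
      (∀ t i, S t = some i → i ≠ k → I.r i < I.r l → t < I.r l) ∧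
      ∀ t t' i, S t = some k → I.r l ≤ t → t < t' → S t' = some i → i = k := by
    by_cases hex : ∃ t, S t = some k ∧ ∃ t' i, t < t' ∧ S t' = some i ∧ i ≠ k
    · obtain ⟨t, ht, hex⟩ := hex
      obtain ⟨t₁, h1, h2, ⟨h3, t', i, h4, h5, h6⟩, h7⟩ := Schedule.exists_last
        (p := fun t => S t = some k ∧ ∃ t' i, t < t' ∧ S t' = some i ∧ i ≠ k)
        (hS.window t k ht).2.le ⟨ht, hex⟩
      have ht'w := hS.window t' i h5
      -- The slot after `t₁` is busy by the choice of the schedule, and it does not belong to `k`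
      -- because `t₁` is the last slot of `k` before another job.
      obtain ⟨l, hl⟩ := Schedule.busy_iff.1 (hlate t₁ h3 (by omega))
      have hlk : l ≠ k := by
        rintro rfl
        have htt' : t₁ + 1 ≠ t' := by
          rintro rfl
          rw [hl] at h5
          cases h5
          exact h6 rfl
        exact h7 (t₁ + 1) (by omega) (by omega) ⟨hl, t', i, by omega, h5, h6⟩
      have h8 := hpend t₁ (t₁ + 1) l h3 (by omega) hl hlk
      have h9 := hS.release _ l hl
      have h10 := hslot _ l hl
      have hrl : I.r l = t₁ + 1 := by omega
      refine ⟨l, Or.inl ⟨h10.1, by omega⟩, h10.2.2.1, by omega, Or.inr ?_, ?_, ?_⟩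
      · rw [hrl, add_sub_cancel_right]
        exact Schedule.busy_iff.2 ⟨k, h3⟩
      · intro t i hti hik hil
        by_contra hle
        have := hpend t₁ t i h3 (by omega) hti hik
        omega
      · intro t t' i hti hlt htt' hi
        by_contra hik
        exact h7 t (by omega) (hS.window t k hti).2.le ⟨hti, t', i, htt', hi, hik⟩
    · refine ⟨s, ?_, le_rfl, by omega, Or.inl rfl, fun t i hti _ his => ?_,
        fun t t' i hti _ htt' hi => ?_⟩
      · by_cases hks : k ≤ s
        · exact Or.inr ⟨hks, rfl⟩
        · exact Or.inl ⟨hs1, not_le.1 hks⟩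
      · have := hslot t i hti
        omega
      · by_contra hik
        exact hex ⟨t, hti, t', i, htt', hi, hik⟩
  -- the completion time of the other jobs
  obtain ⟨c₁, hlc₁, hc₁c, hc₁b, hc₁⟩ : ∃ c₁, I.r l ≤ c₁ ∧ c₁ ≤ c ∧
      (c₁ = I.r l ∨ ∃ i, S (c₁ - 1) = some i ∧ i ≠ k) ∧
      ∀ t i, S t = some i → c₁ ≤ t → i = k := by
    by_cases hex : ∃ t, I.r l ≤ t ∧ ∃ i, S t = some i ∧ i ≠ k
    · obtain ⟨t, hlt, i, hi, hik⟩ := hex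
      obtain ⟨e, h1, h2, ⟨i', h3, h4⟩, h5⟩ := Schedule.exists_last
        (p := fun t => ∃ i, S t = some i ∧ i ≠ k) (hS.window t i hi).2.le ⟨i, hi, hik⟩
      have := hS.window e i' h3
      refine ⟨e + 1, by omega, by omega, Or.inr ⟨i', by simpa using h3, h4⟩, fun z i hz hez => ?_⟩
      by_contra hik
      exact h5 z (by omega) (hS.window z i hz).2.le ⟨i, hz, hik⟩
    · refine ⟨I.r l, le_rfl, hlc, Or.inl rfl, fun t i hi hlt => ?_⟩
      by_contra hik
      exact hex ⟨t, hlt, i, hi, hik⟩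
  have hmid : ∀ t, I.r l ≤ t → t < c₁ → S t ≠ some k := by
    intro t h1 h2 h3
    rcases hc₁b with h | ⟨i, h4, h5⟩
    · omega
    · by_cases h6 : t = c₁ - 1
      · rw [← h6, h3] at h4
        cases h4
        exact h5 rfl
      · exact h5 (haft t (c₁ - 1) i h3 h1 (by omega) h4)
  have hrel : ∀ j, 1 ≤ j → j ≤ k - 1 → I.r j < c → I.r j < c₁ := by
    intro j h1 h2 h3
    by_cases h4 : I.r l ≤ I.r j
    · obtain ⟨t, ht⟩ := hexec j h1 (by omega) (by omega) h3
      have h5 := hS.release t j ht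
      by_contra h6
      have := hc₁ t j ht (by omega)
      omega
    · omega
  -- the part before `b`
  set q := {t | t < I.r l ∧ S t = some k}.ncard with hq
  have hbefore := hS.before (w' := I.work (k - 1) (I.r s) (I.r l) + Pi.single k q) (I.r l) (by
    intro i
    by_cases hik : i = k
    · subst hik
      simp [work_pred_self _ _ hk1, hq]
    · rw [Pi.add_apply, Pi.single_eq_of_ne hik, add_zero]
      by_cases hi : 1 ≤ i ∧ i ≤ k - 1 ∧ I.r s ≤ I.r i ∧ I.r i < I.r l
      · have h1 := hS.amount i
        rw [work, if_pos (by omega)] at h1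
        rw [work, if_pos hi, ← h1]
        congr 1
        ext t
        simp only [Set.mem_ofPred_eq, and_iff_right_iff_imp]
        exact fun ht => hbef t i ht hik hi.2.2.2
      · rw [work, if_neg hi]
        convert Set.ncard_empty ℤ
        ext t
        simp only [Set.mem_ofPred_eq, Set.mem_empty_iff_false, iff_false]
        rintro ⟨h1, h2⟩
        have h3 := hslot t i h2
        have h4 := hS.release t i h2
        omega)
  have hqp : q ≤ I.p k := by
    rw [← hwk, ← hS.amount k]
    exact Set.ncard_le_ncard (fun t ht => ht.2) (hS.finite k)
  have hgb : Schedule.gapCount (fun t => if t < I.r l then S t else none) (I.r s) (I.r l) =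
      S.gapCount (I.r s) (I.r l) := Schedule.gapCount_congr fun t _ ht => by
    simp [Schedule.Busy, ht]
  -- the part between `b` and `c₁`
  have hmiddle : Fits I.r I.d (I.work (k - 1) (I.r l) c₁) (I.r l) c₁ _ :=
    (hS.after (w' := fun i => {t | I.r l ≤ t ∧ S t = some i}.ncard) (I.r l)
      fun i => rfl).before (w' := I.work (k - 1) (I.r l) c₁) c₁ (by
    intro i
    have hset : {t | t < c₁ ∧ (if t < I.r l then none else S t) = some i} =
        {t | I.r l ≤ t ∧ t < c₁ ∧ S t = some i} := by
      ext t
      simp only [Set.mem_ofPred_eq]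
      split_ifs with h
      · simp [h]
      · simp [not_lt.1 h]
    rw [hset]
    by_cases hi : 1 ≤ i ∧ i ≤ k - 1 ∧ I.r l ≤ I.r i ∧ I.r i < c₁
    · have h1 := hS.amount i
      rw [work, if_pos (by omega)] at h1
      rw [work, if_pos hi, ← h1]
      congr 1
      ext t
      simp only [Set.mem_ofPred_eq]
      refine ⟨fun ht => ht.2.2, fun ht => ⟨hi.2.2.1.trans (hS.release t i ht), ?_, ht⟩⟩
      by_contra h6
      have := hc₁ t i ht (by omega)
      omega
    · rw [work, if_neg hi]
      convert Set.ncard_empty ℤ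
      ext t
      simp only [Set.mem_ofPred_eq, Set.mem_empty_iff_false, iff_false]
      rintro ⟨h1, h2, h3⟩
      have h4 := hslot t i h3
      have h5 := hS.release t i h3
      by_cases hik : i = k
      · subst hik
        exact hmid t h1 h2 h3
      · have := hbef t i h3 hik
        omega)
  have hgm : Schedule.gapCount (fun t => if t < c₁ then (if t < I.r l then none else S t) else none)
      (I.r l) c₁ = S.gapCount (I.r l) c₁ := Schedule.gapCount_congr fun t h1 h2 => by
    simp [Schedule.Busy, h2, not_lt.2 h1]
  have hcomp : c₁ ∈ I.completions l (k - 1) (S.gapCount (I.r l) c₁) := by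
    refine (hI.mem_completions hkn').2 ⟨_, hmiddle, ?_, hgm.le⟩
    rcases hc₁b with h | ⟨i, h1, h2⟩
    · exact Or.inl h
    · by_cases h3 : c₁ = I.r l
      · exact Or.inl h3
      · right
        rw [Schedule.Busy, if_pos (by omega), if_neg (by omega), h1]
        simp
  have hsplit := S.gapCount_add hsl hlc (hlb.imp_right Or.inl)
  have hsplit' := S.gapCount_add hlc₁ hc₁c (by
    rcases hc₁b with h | ⟨i, h1, h2⟩
    · exact Or.inl h
    · exact Or.inr (Or.inl (Schedule.busy_iff.2 ⟨i, h1⟩)))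
  have hkset : (q : ℤ) + {t | c₁ ≤ t ∧ S t = some k}.ncard = I.p k := by
    have h1 := hS.amount k
    have h2 : {t | S t = some k} = {t | t < I.r l ∧ S t = some k} ∪
        {t | c₁ ≤ t ∧ S t = some k} := by
      ext t
      simp only [Set.mem_ofPred_eq, Set.mem_union]
      refine ⟨fun ht => ?_, fun ht => ht.elim And.right And.right⟩
      by_cases h3 : t < I.r l
      · exact Or.inl ⟨h3, ht⟩
      · refine Or.inr ⟨?_, ht⟩
        by_contra h4
        exact hmid t (by omega) (by omega) ht
    rw [hwk, h2, Set.ncard_union_eq _ ((hS.finite k).subset fun t ht => ht.2)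
      ((hS.finite k).subset fun t ht => ht.2)] at h1
    · omega
    · rw [Set.disjoint_left]
      intro t ht ht'
      have := ht.1
      have := ht'.1
      omega
  have hpair : 1 ≤ l ∧ l < k ∨
      k ≤ s ∧ l = s ∧ S.gapCount (I.r s) (I.r l) = 0 ∧ q = 0 := by
    rcases hl with hl | ⟨h1, h2⟩
    · exact Or.inl hl
    · refine Or.inr ⟨h1, h2, ?_, ?_⟩
      · rw [h2, Schedule.gapCount_self]
      · rw [hq, h2]
        convert Set.ncard_empty ℤ
        ext t
        simp only [Set.mem_ofPred_eq, Set.mem_empty_iff_false, iff_false]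
        rintro ⟨h3, h4⟩
        have := hS.window t k h4
        omega
  refine ⟨l, S.gapCount (I.r s) (I.r l), q, c₁, by omega, hpair, hsl, ⟨_, hbefore, hgb.le⟩, hqp,
    hrel, ?_⟩
  clear hc₁b
  -- Only `k` is executed from `c₁` on. If it runs there without interruption, `c` is determined by
  -- the remaining amount; an idle slot costs an additional gap and forces `c = d_k`.
  by_cases hidle : ∃ e, c₁ ≤ e ∧ e < c ∧ ¬ S.Busy e
  swap
  · push Not at hidle
    left
    have hk : ∀ t, c₁ ≤ t → t < c → S t = some k := by
      intro t h1 h2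
      obtain ⟨i, hi⟩ := Schedule.busy_iff.1 (hidle t h1 h2)
      rwa [hc₁ t i hi h1] at hi
    refine ⟨completions_mono (by omega) hcomp, ?_, ?_⟩
    · have h1 : {t | c₁ ≤ t ∧ S t = some k} = ↑(Finset.Ico c₁ c) := by
        ext t
        simp only [Set.mem_ofPred_eq, Finset.coe_Ico, Set.mem_Ico]
        exact ⟨fun ht => ⟨ht.1, (hS.window t k ht.2).2⟩, fun ht => ⟨ht.1, hk t ht.1 ht.2⟩⟩
      rw [h1, Set.ncard_coe_finset, Int.card_Ico] at hkset
      omega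
    · rcases hc₁c.lt_or_eq with h1 | h1
      · exact hS.release c₁ k (hk c₁ le_rfl h1)
      · omega
  · obtain ⟨e, he1, he2, he3⟩ := hidle
    right
    have hg1 := Schedule.one_le_gapCount he1 he2 he3
    refine ⟨by omega, ?_, ?_, completions_mono (by omega) hcomp⟩
    · have : 0 < {t | c₁ ≤ t ∧ S t = some k}.ncard := by
        refine (Set.ncard_pos ((hS.finite k).subset fun t ht => ht.2)).2 ⟨c - 1, by omega, ?_⟩
        obtain ⟨i, hi⟩ := Schedule.busy_iff.1 hbc
        rwa [hc₁ _ i hi (by omega)] at hi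
      omega
    -- If `c < d_k`, a later completion time is possible with at most `g` gaps. Either a job below
    -- `k` is released at `c`, and a block is appended, or the first unit of the last busy block, a
    -- unit of `k`, moves to slot `c`.
    · by_contra hne
      have hclt : c < I.d k := by omega
      by_cases hrelc : ∃ j, 1 ≤ j ∧ j ≤ k - 1 ∧ I.r j = c
      · obtain ⟨j, h1, h2, h3⟩ := hrelc
        obtain ⟨c', h4, h5⟩ := hI.exists_completion_gt (s := s) (l := j) (g := g) hkn h1 (by omega)
          (by omega) (S := S) (by rwa [h3]) (by rwa [h3])
        have := hc.2 h4
        omega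
      · obtain ⟨f, hf1, hf2, hf3, hf4⟩ := Schedule.exists_last (p := fun z => ¬ S.Busy z)
          (show e ≤ c - 1 by omega) he3
        have hfc : f ≠ c - 1 := by
          rintro rfl
          exact hf3 hbc
        have hbf : S.Busy (f + 1) := not_not.1 (hf4 (f + 1) (by omega) (by omega))
        obtain ⟨i, hi⟩ := Schedule.busy_iff.1 hbf
        obtain rfl := hc₁ _ i hi (by omega)
        have hcidle : ¬ S.Busy c := fun h => by
          have := hS.busy_window h
          omega
        have hS' : Fits I.r I.d (I.work i (I.r s) (c + 1)) (I.r s) (c + 1) S := by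
          refine (hS.mono fun t j ht => ⟨(hS.window t j ht).1, ?_, hS.release t j ht,
            hS.deadline t j ht⟩).congr fun j => congrFun (work_eq_of_no_release
              fun j hj1 hjk _ => ⟨fun _ => by omega, fun h => ?_⟩) j
          · have := hS.window t j ht
            omega
          · by_contra h1
            refine hrelc ⟨j, hj1, ?_, by omega⟩
            by_contra h2
            obtain rfl : j = i := by omega
            omega
        have hmove := hS'.move (e := c) hi (Schedule.not_busy_iff.1 hcidle)
          (by have := hS.release _ _ hi; omega) hclt (by omega) (by omega)
        have hb := Schedule.busy_swap (y := f + 1) hcidle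
        simp only [hbf, and_true] at hb
        have hmem : c + 1 ∈ I.completions s i g := by
          refine (hI.mem_completions hkn).2 ⟨_, hmove, Or.inr ?_, ?_⟩
          · rw [add_sub_cancel_right]
            exact (hb c).2 (Or.inl rfl)
          -- The move is taken in two steps: filling slot `c` prolongs the last block, and vacating
          -- slot `f + 1` only prolongs the gap that contains `f`.
          · let S₁ : Schedule := Function.update S c (some i)
            have hS₁ : ∀ z, S₁.Busy z ↔ z = c ∨ S.Busy z := by
              intro z
              by_cases hz : z = c
              · subst hz
                simp [S₁, Schedule.Busy]
              · simp [S₁, Schedule.Busy, hz]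
            have h1 : S₁.gapCount (I.r s) (c + 1) ≤ S.gapCount (I.r s) c + 0 := by
              refine (S₁.gapCount_le_add (c := c) (by omega)).trans (Nat.add_le_add ?_ ?_)
              · refine (Schedule.gapCount_congr fun t _ ht => ?_).le
                rw [hS₁]
                exact or_iff_right (by omega)
              · refine (Schedule.gapCount_eq_zero fun t h1 h2 => (hS₁ t).2 (Or.inl ?_)).le
                omega
            refine (Schedule.gapCount_erase_le_of_left (S := S₁) (y := f + 1) (by omega)
              (fun z => ?_) ?_).trans (h1.trans hg)
            · rw [hb, hS₁]
              constructor
              · rintro (h | h)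
                · exact ⟨by omega, Or.inl h⟩
                · exact ⟨h.1, Or.inr h.2⟩
              · rintro ⟨h, h' | h'⟩
                · exact Or.inl h'
                · exact Or.inr ⟨h, h'⟩
            · rw [hS₁, add_sub_cancel_right]
              push Not
              exact ⟨by omega, hf3⟩
        have := hc.2 hmem
        omega

end Normalized

end Jobs


/-! ### Correctness of the tables and of the answer -/

namespace Schedule

theorem gaps_eq_gapsIn {S : Schedule} {a c : ℤ} (h : ∀ t, S.Busy t → a ≤ t ∧ t < c)
    (ha : S.Busy a) (hc : S.Busy (c - 1)) : S.gaps = S.gapsIn a c := by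
  ext ⟨u, v⟩
  simp only [gaps, gapsIn, Set.mem_ofPred_eq]
  constructor
  · rintro ⟨h1, h2, h3, h4⟩
    have h5 := h _ h2
    have h6 := h _ h3
    exact ⟨by omega, h1, by omega, Or.inr h2, Or.inr h3, h4⟩
  · rintro ⟨h1, h2, h3, h4, h5, h6⟩
    refine ⟨h2, h4.resolve_left ?_, h5.resolve_left ?_, h6⟩
    · rintro rfl
      exact h6 u le_rfl h2 ha
    · rintro rfl
      exact h6 (v - 1) (by omega) (by omega) hc

theorem energy_one {S : Schedule} : S.energy 1 = S.gaps.ncard := by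
  have h : S.energy 1 = ∑ᶠ I ∈ S.gaps, (1 : ℤ) := by
    refine finsum_mem_congr rfl fun I hI => ?_
    have := hI.1
    exact min_eq_right (by omega)
  by_cases hf : S.gaps.Finite
  · rw [h, finsum_mem_eq_finite_toFinset_sum _ hf, Finset.sum_const, Set.ncard_eq_toFinset_card _ hf]
    simp
  -- For infinitely many gaps, both sides take their default value `0`.
  · rw [h, finsum_mem_eq_zero_of_infinite (by simpa [Function.support_const] using hf),
      Set.Infinite.ncard hf]
    rfl

end Schedule

namespace Jobs

variable {I : Jobs}

namespace Normalized

variable (hI : I.Normalized)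
include hI

/-- Every applicable option is realized by a schedule: options (2) and (3) through
`exists_completion_ge` with `h` gaps before `r_l` and `g - h` after it, option (4) through
`d_mem_completions`, where one gap is spent before `d_k`. -/
theorem optU_le {s k g h l q : ℕ} (hk1 : 1 ≤ k) (hkn : k ≤ I.n)
    (hsk : I.r s ≤ I.r k) (hsl : I.r s ≤ I.r l) (hld : I.r l < I.d k)
    (hq : q ∈ I.amountsIn s k h l) (hhg : h ≤ g) (hgn : g < I.n) {V : ℕ → WithBot ℤ}
    (hV : ∀ g', g' < I.n → V g' = (I.U l (k - 1) g' : WithBot ℤ))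
    (hqu : q < I.p k ∨ I.r l < I.U l (k - 1) (g - h)) :
    I.optU k g h q V ≤ (I.U s k g : WithBot ℤ) := by
  have hkn' : k - 1 ≤ I.n := by omega
  unfold optU
  simp only [hV (g - h) (by omega), hV (g - h - 1) (by omega), WithBot.unbotD_coe, gt_iff_lt,
    ENat.toNat_natCast, Nat.cast_le, Nat.cast_lt, prevr_lt_iff, ge_iff_le]
  set u := I.U l (k - 1) (g - h) with hu
  have hA : ∀ x : ℤ, q ≤ I.p k → I.r k ≤ u → x ≤ u + (I.p k - q) → x ≤ I.d k →
      (x : WithBot ℤ) ≤ (I.U s k g : WithBot ℤ) := by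
    intro x h1 h2 h3 h4
    obtain ⟨c, hc, hle⟩ := hI.exists_completion_ge (u := u) (g := g - h) hk1 hkn hsk hsl hld hq
      h1 (hI.U_mem hkn') h2 hqu
    rw [show h + (g - h) = g by omega] at hc
    have := hI.le_U_of_mem hkn hc
    rw [WithBot.coe_le_coe]
    omega
  have hrp := hI.r_add_p_le hk1 hkn
  refine max_le ?_ (max_le ?_ ?_)
  · split_ifs with h1
    · exact hA _ h1.1 h1.2.2.1 le_rfl (by omega)
    · exact bot_le
  · split_ifs with h1
    · exact hA _ h1.1.le (by omega) (by omega) le_rfl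
    · exact bot_le
  · split_ifs with h1
    · have h2 := hI.d_mem_completions (g := g - h - 1) hk1 hkn hsk hsl hq h1.2.1 (hI.U_mem hkn')
        (by omega) h1.2.2.2
      rw [show h + (g - h - 1) + 1 = g by omega] at h2
      exact WithBot.coe_le_coe.2 (hI.le_U_of_mem hkn h2)
    · exact bot_le

/-- Replacing `q₀` by the smaller `q` and `c₁` by a maximal completion time can only increase the
resulting end, which `exists_completion_ge` bounds by `U_{s,k,g}`. So either option (2) gives the
same value, or `U_{s,k,g} = d_k` and option (3) applies. If the split leaves an idle slot after
`c₁`, then option (4) applies, or the remaining amount reaches `d_k` without an idle slot and option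
(3) does. The condition on `prevr` survives because it only asks for a large completion time. -/
theorem le_optU {s k g h l q q₀ : ℕ} (hk1 : 1 ≤ k) (hkn : k ≤ I.n)
    (hsk : I.r s ≤ I.r k) (hsl : I.r s ≤ I.r l) (hld : I.r l < I.d k)
    (hq : q ∈ I.amountsIn s k h l) (hqq : q ≤ q₀) (hqp : q₀ ≤ I.p k) (hhg : h ≤ g) (hgn : g < I.n)
    {V : ℕ → WithBot ℤ} (hV : ∀ g', g' < I.n → V g' = (I.U l (k - 1) g' : WithBot ℤ))
    (hqu : q < I.p k ∨ I.r l < I.U l (k - 1) (g - h)) {c₁ : ℤ}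
    (hrel : ∀ j, 1 ≤ j → j ≤ k - 1 → I.r j < I.U s k g → I.r j < c₁)
    (hc₁ : c₁ ∈ I.completions l (k - 1) (g - h) ∧ I.U s k g = c₁ + (I.p k - q₀) ∧ I.r k ≤ c₁ ∨
      h < g ∧ q₀ < I.p k ∧ I.U s k g = I.d k ∧ c₁ ∈ I.completions l (k - 1) (g - h - 1)) :
    (I.U s k g : WithBot ℤ) ≤ I.optU k g h q V := by
  have hkn' : k - 1 ≤ I.n := by omega
  unfold optU
  simp only [hV (g - h) (by omega), hV (g - h - 1) (by omega), WithBot.unbotD_coe, gt_iff_lt,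
    ENat.toNat_natCast, Nat.cast_le, Nat.cast_lt, prevr_lt_iff, ge_iff_le]
  have hud := hI.completion_lt_d (g := g - h) hkn hld (hI.U_mem hkn')
  rcases hc₁ with ⟨h1, h2, h3⟩ | ⟨h1, h2, h3, h4⟩
  · have h4 := hI.le_U_of_mem hkn' h1
    obtain ⟨c, hc, hle⟩ := hI.exists_completion_ge (g := g - h) hk1 hkn hsk hsl hld hq
      (by omega) (hI.U_mem hkn') (by omega) hqu
    rw [show h + (g - h) = g by omega] at hc
    have h5 := hI.le_U_of_mem hkn hc
    by_cases h6 : I.U l (k - 1) (g - h) + (I.p k - q) < I.d k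
    · refine le_trans ?_ (le_max_left _ _)
      have h7 : I.U l (k - 1) (g - h) + (I.p k - q) = I.U s k g := by omega
      rw [if_pos, h7]
      exact ⟨by omega, by omega, by omega, fun j hj1 hjk hj => (hrel j hj1 hjk (by omega)).trans_le h4⟩
    · refine le_trans ?_ (le_trans (le_max_left _ _) (le_max_right _ _))
      have h7 : I.U s k g = I.d k := by
        refine le_antisymm ?_ (by omega)
        rcases (hI.mem_completions hkn).1 (hI.U_mem (s := s) (g := g) hkn) with ⟨S, hS, h | h, _⟩
        · have := hI.r_lt_d hk1 le_rfl hkn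
          omega
        · obtain ⟨j, hj⟩ := Schedule.busy_iff.1 h
          have h8 := hS.deadline _ j hj
          have h9 := work_ne_zero (hS.amount_ne_zero hj)
          have := hI.d_le h9.1 h9.2.1 hkn
          omega
      rw [if_pos, h7]
      exact ⟨by omega, by omega, fun j hj1 hjk hj => (hrel j hj1 hjk (by omega)).trans_le h4⟩
  · have h5 := hI.le_U_of_mem hkn' h4
    have h6 := hI.le_U_of_mem hkn' (completions_mono (show g - h - 1 ≤ g - h by omega)
      (hI.U_mem (s := l) (k := k - 1) (g := g - h - 1) hkn'))
    refine le_trans ?_ (le_max_right _ _)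
    rw [h3]
    by_cases h7 : I.p k - q < I.d k - I.U l (k - 1) (g - h - 1)
    · refine le_trans ?_ (le_max_right _ _)
      rw [if_pos]
      exact ⟨h1, by omega, h7, fun j hj1 hjk hj => (hrel j hj1 hjk (by omega)).trans_le h5⟩
    · refine le_trans ?_ (le_max_left _ _)
      rw [if_pos]
      exact ⟨by omega, by omega, fun j hj1 hjk hj => (hrel j hj1 hjk (by omega)).trans_le (h5.trans h6)⟩

theorem stepU_eq {k : ℕ} (hk1 : 1 ≤ k) (hkn : k ≤ I.n) {V : ℕ → ℕ → WithBot ℤ}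
    (hV : ∀ s g, 1 ≤ s → s ≤ I.n → g < I.n → V s g = (I.U s (k - 1) g : WithBot ℤ)) {s g : ℕ}
    (hs1 : 1 ≤ s) (hsn : s ≤ I.n) (hgn : g < I.n) :
    I.stepU k V s g = (I.U s k g : WithBot ℤ) := by
  have hkn' : k - 1 ≤ I.n := by omega
  have hkd := hI.r_lt_d hk1 le_rfl hkn
  have hiff : ∀ c, I.r k < I.r s ∨ c ≤ I.r k →
      (c ∈ I.completions s k g ↔ c ∈ I.completions s (k - 1) g) := by
    intro c hc
    rw [hI.mem_completions hkn, hI.mem_completions hkn', work_eq_pred hk1 hc]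
  unfold stepU
  by_cases hks : I.r k < I.r s
  · rw [if_pos hks, hV s g hs1 hsn hgn]
    congr 1
    exact le_antisymm (hI.le_U_of_mem hkn ((hiff _ (Or.inl hks)).2 (hI.U_mem hkn')))
      (hI.le_U_of_mem hkn' ((hiff _ (Or.inl hks)).1 (hI.U_mem hkn)))
  have hp := hI.p_ne_zero hk1 hkn
  rw [if_neg hks, hV s g hs1 hsn hgn]
  push Not at hks
  refine le_antisymm (max_le ?_ (max_le ?_ ?_)) ?_
  · split_ifs with h1
    · rw [WithBot.coe_lt_coe] at h1
      exact WithBot.coe_le_coe.2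
        (hI.le_U_of_mem hkn ((hiff _ (Or.inr h1.le)).2 (hI.U_mem hkn')))
    · exact bot_le
  · refine Finset.sup_le fun h hh => Finset.sup_le fun l hl => ?_
    rw [Finset.mem_range] at hh
    rw [Finset.mem_filter, Finset.mem_Ico] at hl
    rw [hI.stepP_eq hk1 hkn hV hl.1.1 hl.1.2 _ s h le_rfl hs1 hsn (by omega) hl.2]
    rcases hI.P_eq (g := h) hk1 hkn hl.1.1 hl.1.2 hl.2 with ⟨_, h1⟩ | ⟨q, hq, h1⟩
    · rw [h1]
      simp [optU]
    · rw [h1]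
      exact hI.optU_le hk1 hkn hks hl.2 (hI.r_lt_d hl.1.1 hl.1.2.le hkn) hq.1 (by omega) hgn
        (fun g' hg' => hV l g' hl.1.1 (by omega) hg')
        (Or.inr (hI.r_lt_U hl.1.1 (by omega) hkn'))
  · split_ifs
    · exact hI.optU_le (q := 0) hk1 hkn hks le_rfl (by omega) I.amountsIn_self_zero
        (Nat.zero_le _) hgn (fun g' hg' => hV s g' hs1 hsn hg') (Or.inl (by omega))
    · exact bot_le
  -- A schedule that ends by `r_k` does not contain job `k`; this is option (1).
  by_cases hkU : I.U s k g ≤ I.r k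
  · refine le_trans ?_ (le_max_left _ _)
    have h1 := hI.le_U_of_mem hkn' ((hiff _ (Or.inr hkU)).1 (hI.U_mem hkn))
    rw [if_pos]
    · exact WithBot.coe_le_coe.2 h1
    · rw [WithBot.coe_lt_coe]
      -- If `U_{s,k-1,g}` were at least `r_k`, executing `k` after it would give a completion time
      -- beyond `r_k`.
      by_contra h2
      obtain ⟨c, hc, hle⟩ := hI.exists_completion_ge (l := s) (h := 0) (g := g) (q := 0) hk1 hkn
        hks le_rfl (by omega) I.amountsIn_self_zero (Nat.zero_le _) (hI.U_mem hkn')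
        (not_lt.1 h2) (Or.inl (by omega))
      rw [zero_add] at hc
      have := hI.le_U_of_mem hkn hc
      omega
  · push Not at hkU
    refine le_trans ?_ (le_max_right _ _)
    obtain ⟨l, h, q₀, c₁, hhg, hpair, hsl, hq₀, hqp, hrel, hc₁⟩ :=
      hI.exists_split_of_isGreatest hk1 hkn hs1 hks (hI.isGreatest_U hkn) hkU
    rcases hpair with ⟨hl1, hlk⟩ | ⟨hks', rfl, rfl, rfl⟩
    · refine le_trans ?_ (le_max_left _ _)
      refine le_trans ?_ (Finset.le_sup (Finset.mem_range.2 (show h < g + 1 by omega)))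
      refine le_trans ?_ (Finset.le_sup (Finset.mem_filter.2
        ⟨Finset.mem_Ico.2 ⟨hl1, hlk⟩, hsl⟩))
      rw [hI.stepP_eq hk1 hkn hV hl1 hlk _ s h le_rfl hs1 hsn (by omega) hsl]
      rcases hI.P_eq (g := h) hk1 hkn hl1 hlk hsl with ⟨h1, _⟩ | ⟨q, hq, h1⟩
      · rw [h1] at hq₀
        exact hq₀.elim
      · rw [h1]
        exact hI.le_optU hk1 hkn hks hsl (hI.r_lt_d hl1 hlk.le hkn) hq.1 (hq.2 hq₀) hqp hhg hgn
          (fun g' hg' => hV l g' hl1 (by omega) hg')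
          (Or.inr (hI.r_lt_U hl1 (by omega) hkn')) hrel hc₁
    · rw [if_pos hks']
      refine le_trans ?_ (le_max_right _ _)
      exact hI.le_optU (q := 0) hk1 hkn hks le_rfl (by omega) hq₀ le_rfl hqp hhg hgn
        (fun g' hg' => hV l g' hs1 hsn hg') (Or.inl (by omega)) hrel hc₁

theorem algU_eq {k : ℕ} : k ≤ I.n → ∀ {s g : ℕ}, 1 ≤ s → s ≤ I.n → g < I.n →
    I.algU s k g = (I.U s k g : WithBot ℤ) := by
  induction k with
  | zero =>
    intro hk s g _ _ _
    have h0 : I.U s 0 g ∈ I.completions s 0 g := hI.U_mem hk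
    obtain ⟨S, hS, h | h, _⟩ := (hI.mem_completions hk).1 h0
    · rw [algU, h]
    · obtain ⟨j, hj⟩ := Schedule.busy_iff.1 h
      have := work_ne_zero (hS.amount_ne_zero hj)
      omega
  | succ k ih =>
    intro hk s g hs1 hsn hgn
    exact hI.stepU_eq (by omega) hk (fun s' g' h1 h2 h3 => ih (by omega) h1 h2 h3) hs1 hsn hgn

theorem algP_eq {s k g l : ℕ} (hs1 : 1 ≤ s) (hsn : s ≤ I.n) (hk1 : 1 ≤ k) (hkn : k ≤ I.n)
    (hgn : g < I.n) (hl1 : 1 ≤ l) (hlk : l < k) (hsl : I.r s ≤ I.r l) :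
    I.algP s k g l = I.P s k g l :=
  hI.stepP_eq hk1 hkn (fun _ _ h1 h2 h3 => hI.algU_eq (by omega) h1 h2 h3) hl1 hlk _ s g le_rfl
    hs1 hsn hgn hsl

/-- Job `1` fits only into this slot. So a complete schedule has no initial idle period, which would
count as a gap in the window but not in `gaps`. -/
theorem busy_r_one {S : Schedule} (hS : I.IsSchedule S) : S.Busy (I.r 1) := by
  have h1 : 1 ∈ Set.Icc 1 I.n := ⟨le_rfl, hI.one_le_n⟩
  have h2 := hS.2 1 h1
  rw [hI.p_one] at h2
  obtain ⟨t, ht⟩ := Set.nonempty_of_ncard_ne_zero (by omega : {t | S t = some 1}.ncard ≠ 0)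
  have h3 := hS.1 t 1 ht
  have h4 := hI.d_one
  rw [show I.r 1 = t by omega]
  exact Schedule.busy_iff.2 ⟨1, ht⟩

/-- A `(1,n)`-schedule is a complete schedule precisely when it ends after all release times. Both
ends of its window are busy, so the two notions of gaps agree. -/
theorem exists_isSchedule_iff {g : ℕ} :
    (∃ S, I.IsSchedule S ∧ S.gaps.ncard ≤ g) ↔ ∀ j, 1 ≤ j → j ≤ I.n → I.r j < I.U 1 I.n g := by
  have hset : ∀ c, (∀ j, 1 ≤ j → j ≤ I.n → I.r j < c) →
      {j | 1 ≤ j ∧ j ≤ I.n ∧ I.r 1 ≤ I.r j ∧ I.r j < c} = Set.Icc 1 I.n := by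
    intro c hc
    ext j
    simp only [Set.mem_ofPred_eq, Set.mem_Icc]
    exact ⟨fun h => ⟨h.1, h.2.1⟩, fun h => ⟨h.1, h.2, hI.r_one_le j h, hc j h.1 h.2⟩⟩
  constructor
  · rintro ⟨S, hS, hg⟩
    have hb : ∀ t, S.Busy t → t < I.d I.n := by
      intro t ht
      obtain ⟨j, hj⟩ := Schedule.busy_iff.1 ht
      obtain ⟨h1, _, h3⟩ := hS.1 t j hj
      exact h3.trans_le (hI.d_le h1.1 h1.2 le_rfl)
    have hb1 := hI.busy_r_one hS
    obtain ⟨e, he1, he2, he3, he4⟩ := Schedule.exists_last (p := fun t => S.Busy t)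
      (hb _ hb1).le hb1
    have hlt : ∀ t, S.Busy t → t < e + 1 := by
      intro t ht
      by_contra h
      exact he4 t (by omega) (hb t ht).le ht
    have hrlt : ∀ j, 1 ≤ j → j ≤ I.n → I.r j < e + 1 := by
      intro j h1 h2
      have h3 := hS.2 j ⟨h1, h2⟩
      have := hI.p_ne_zero h1 h2
      obtain ⟨t, ht⟩ := Set.nonempty_of_ncard_ne_zero (by omega : {t | S t = some j}.ncard ≠ 0)
      exact (hS.1 t j ht).2.1.trans_lt (hlt t (Schedule.busy_iff.2 ⟨j, ht⟩))
    have hex : I.Executes {j | 1 ≤ j ∧ j ≤ I.n ∧ I.r 1 ≤ I.r j ∧ I.r j < e + 1} S := by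
      rw [hset _ hrlt]
      exact hS
    have hfit := hex.fits hlt
    rw [Schedule.gaps_eq_gapsIn (fun t => hfit.busy_window) hb1 (by simpa using he3),
      Schedule.ncard_gapsIn] at hg
    have := hI.le_U_of_mem le_rfl ((hI.mem_completions le_rfl).2
      ⟨S, hfit, Or.inr (by simpa using he3), hg⟩)
    exact fun j h1 h2 => (hrlt j h1 h2).trans_le this
  · intro hU
    obtain ⟨S, h1, h2, h3⟩ := (hI.mem_completions le_rfl).1 (hI.U_mem (s := 1) (g := g) le_rfl)
    have hS : I.IsSchedule S := by
      have := executes_of_fits h1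
      rwa [hset _ hU] at this
    have hr1 := hU 1 le_rfl hI.one_le_n
    refine ⟨S, hS, ?_⟩
    rwa [Schedule.gaps_eq_gapsIn (fun t => h1.busy_window) (hI.busy_r_one hS)
      (h2.resolve_left (by omega)), Schedule.ncard_gapsIn]

/-- With the busy slots pushed to the left, the job that ends a gap is released at that moment, as
otherwise its unit could move one slot to the left. This job is not job `1`, and different gaps end
with different jobs. -/
theorem exists_isSchedule_gaps_lt : ∃ S, I.IsSchedule S ∧ S.gaps.ncard ≤ I.n - 1 := by
  classical
  have hset : {j | 1 ≤ j ∧ j ≤ I.n ∧ I.r 1 ≤ I.r j ∧ I.r j < I.d I.n} = Set.Icc 1 I.n := by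
    ext j
    simp only [Set.mem_ofPred_eq, Set.mem_Icc]
    exact ⟨fun h => ⟨h.1, h.2.1⟩, fun h => ⟨h.1, h.2, hI.r_one_le j h, hI.r_lt_d h.1 h.2 le_rfl⟩⟩
  let Φ : Schedule → ℕ := fun S =>
    ∑ t ∈ Finset.Ico (I.r 1) (I.d I.n) with S.Busy t, (t - I.r 1).toNat
  obtain ⟨S, hfit, hmin⟩ := (measure Φ).wf.has_min
    {S | Fits I.r I.d (I.work I.n (I.r 1) (I.d I.n)) (I.r 1) (I.d I.n) S}
    (hI.exists_fits le_rfl _ _)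
  simp only [Set.mem_ofPred_eq] at hfit hmin
  have hS : I.IsSchedule S := by
    have := executes_of_fits hfit
    rwa [hset] at this
  have hrel : ∀ v j, S v = some j → I.r 1 < v → ¬ S.Busy (v - 1) → I.r j = v := by
    intro v j hj hv hidle
    have hr := hfit.release v j hj
    by_contra hne
    have hb := Schedule.busy_swap (y := v) hidle
    have hbv : S.Busy v := Schedule.busy_iff.2 ⟨j, hj⟩
    simp only [hbv, and_true] at hb
    have hw := hfit.window v j hj
    have hd := hfit.deadline v j hj
    refine hmin _ (hfit.move hj (Schedule.not_busy_iff.1 hidle) (by omega) (by omega) (by omega)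
      (by omega)) ?_
    set S' : Schedule := S ∘ Equiv.swap (v - 1) v
    change Φ S' < Φ S
    simp only [Φ]
    set B := (Finset.Ico (I.r 1) (I.d I.n)).filter fun z => S.Busy z with hB
    have hfil : (Finset.Ico (I.r 1) (I.d I.n)).filter (fun z => S'.Busy z) =
        insert (v - 1) (B.erase v) := by
      ext z
      simp only [hB, Finset.mem_filter, Finset.mem_insert, Finset.mem_erase, hb, Finset.mem_Ico]
      constructor
      · rintro ⟨h4, h5 | h5⟩
        · exact Or.inl h5
        · exact Or.inr ⟨h5.1, h4, h5.2⟩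
      · rintro (h5 | h5)
        · exact ⟨by omega, Or.inl h5⟩
        · exact ⟨h5.2.1, Or.inr ⟨h5.1, h5.2.2⟩⟩
    have hsum : (v - I.r 1).toNat + ∑ x ∈ B.erase v, (x - I.r 1).toNat =
        ∑ x ∈ B, (x - I.r 1).toNat :=
      Finset.add_sum_erase B (fun x => (x - I.r 1).toNat)
        (Finset.mem_filter.2 ⟨Finset.mem_Ico.2 hw, hbv⟩)
    rw [hfil, Finset.sum_insert (by simp [hB, hidle])]
    omega
  have hgap : ∀ u v, (u, v) ∈ S.gaps → ∃ j, S v = some j ∧ I.r j = v ∧ I.r 1 < v := by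
    rintro u v ⟨h1, h2, h3, h4⟩
    obtain ⟨j, hj⟩ := Schedule.busy_iff.1 h3
    have hw := hfit.busy_window h2
    simp only at h1 hw
    exact ⟨j, hj, hrel v j hj (by omega) (h4 _ (by simp only; omega) (by simp)), by omega⟩
  refine ⟨S, hS, ?_⟩
  have h1 : (Set.Icc 2 I.n).ncard = I.n - 1 := by
    rw [← Finset.coe_Icc, Set.ncard_coe_finset, Nat.card_Icc]
    omega
  rw [← h1]
  refine Set.ncard_le_ncard_of_injOn (fun G => (S G.2).getD 0) ?_ ?_ (Set.finite_Icc _ _)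
  · rintro ⟨u, v⟩ huv
    obtain ⟨j, h2, h3, h4⟩ := hgap u v huv
    have h5 := hS.1 v j h2
    simp only [h2, Option.getD_some, Set.mem_Icc] at h5 ⊢
    refine ⟨?_, h5.1.2⟩
    by_contra h6
    obtain rfl : j = 1 := by omega
    omega
  · rintro ⟨u, v⟩ huv ⟨u', v'⟩ huv' heq
    obtain ⟨j, h2, h3, h4⟩ := hgap u v huv
    obtain ⟨j', h2', h3', h4'⟩ := hgap u' v' huv'
    simp only [h2, h2', Option.getD_some] at heq
    obtain rfl : v = v' := by rw [← h3, ← h3', heq]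
    obtain ⟨g1, g2, g3, g4⟩ := huv
    obtain ⟨g1', g2', g3', g4'⟩ := huv'
    simp only at g1 g2 g4 g1' g2' g4'
    have : u = u' := by
      rcases lt_trichotomy u u' with h | h | h
      · exact absurd g2' (g4 _ (by omega) (by omega))
      · exact h
      · exact absurd g2 (g4' _ (by omega) (by omega))
    rw [this]

theorem algGaps_spec : ∃ m : ℕ, I.algGaps = (m : ℕ∞) ∧
    IsLeast {x : ℕ | ∃ S, I.IsSchedule S ∧ x = S.gaps.ncard} m := by
  obtain ⟨S₀, h1, h2⟩ := hI.exists_isSchedule_gaps_lt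
  have hne : {x : ℕ | ∃ S, I.IsSchedule S ∧ x = S.gaps.ncard}.Nonempty := ⟨_, S₀, h1, rfl⟩
  have hleast : IsLeast {x : ℕ | ∃ S, I.IsSchedule S ∧ x = S.gaps.ncard}
      (sInf {x : ℕ | ∃ S, I.IsSchedule S ∧ x = S.gaps.ncard}) :=
    ⟨Nat.sInf_mem hne, fun x hx => Nat.sInf_le hx⟩
  set m := sInf {x : ℕ | ∃ S, I.IsSchedule S ∧ x = S.gaps.ncard}
  have hn := hI.one_le_n
  have hmn : m < I.n := by
    have := hleast.2 ⟨S₀, h1, rfl⟩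
    omega
  have hiff : ∀ g, g < I.n → ((Finset.Icc 1 I.n).sup (fun j => (I.r j : WithBot ℤ)) <
      I.algU 1 I.n g ↔ ∃ S, I.IsSchedule S ∧ S.gaps.ncard ≤ g) := by
    intro g hg
    rw [hI.exists_isSchedule_iff, hI.algU_eq le_rfl le_rfl hn hg,
      Finset.sup_lt_iff (WithBot.bot_lt_coe _)]
    simp only [Finset.mem_Icc, WithBot.coe_lt_coe]
    exact ⟨fun h j h3 h4 => h j ⟨h3, h4⟩, fun h j hj => h j hj.1 hj.2⟩
  refine ⟨m, le_antisymm ?_ ?_, hleast⟩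
  · obtain ⟨S, h3, h4⟩ := hleast.1
    exact Finset.inf_le (Finset.mem_filter.2 ⟨Finset.mem_range.2 hmn,
      (hiff m hmn).2 ⟨S, h3, h4.ge⟩⟩)
  · refine Finset.le_inf fun g hg => ?_
    rw [Finset.mem_filter, Finset.mem_range] at hg
    obtain ⟨S, h3, h4⟩ := (hiff g hg.1).1 hg.2
    exact_mod_cast (hleast.2 ⟨S, h3, rfl⟩).trans h4

end Normalized

end Jobs


/-! ### Reasoning about programs -/

/-- A bound for the number of steps of a program whose loops make at most `N` iterations. -/
def Prog.bound (N : ℕ) : Prog → ℕ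
  | skip => 1
  | assign _ e => e.cost + 1
  | load _ _ idx => idxCost idx + 1
  | store _ idx e => idxCost idx + e.cost + 1
  | seq c c' => c.bound N + c'.bound N
  | ite e f c c' => e.cost + f.cost + 1 + (c.bound N + c'.bound N)
  | loop e f c => (N + 1) * (e.cost + f.cost + 1) + N * c.bound N

/-- The nesting depth of loops. -/
def Prog.depth : Prog → ℕ
  | seq c c' => max c.depth c'.depth
  | ite _ _ c c' => max c.depth c'.depth
  | loop _ _ c => c.depth + 1
  | _ => 0

/-- The constant in the polynomial bound of the running time. -/
def Prog.factor : Prog → ℕ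
  | skip => 1
  | assign _ e => e.cost + 1
  | load _ _ idx => idxCost idx + 1
  | store _ idx e => idxCost idx + e.cost + 1
  | seq c c' => c.factor + c'.factor
  | ite e f c c' => e.cost + f.cost + 1 + (c.factor + c'.factor)
  | loop e f c => 2 * (e.cost + f.cost + 1) + c.factor

/-- Only the loop case needs `1 ≤ N`: its `N + 1` tests are estimated by `2 * N`, whence the `2` in
`factor`. -/
theorem Prog.bound_le {N : ℕ} (hN : 1 ≤ N) : ∀ c : Prog, c.bound N ≤ c.factor * N ^ c.depth := by
  have mono : ∀ {a b x y : ℕ}, a ≤ x * N ^ b → b ≤ y → a ≤ x * N ^ y := fun h hb =>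
    h.trans (Nat.mul_le_mul_left _ (Nat.pow_le_pow_right hN hb))
  intro c
  induction c with
  | skip => simp [bound, factor, depth]
  | assign x e => simp [bound, factor, depth]
  | load x a idx => simp [bound, factor, depth]
  | store a idx e => simp [bound, factor, depth]
  | seq c c' h h' =>
    simp only [bound, factor, depth, add_mul]
    exact Nat.add_le_add (mono h (le_max_left _ _)) (mono h' (le_max_right _ _))
  | ite e f c c' h h' =>
    simp only [bound, factor, depth]
    rw [add_mul, add_mul c.factor]
    refine Nat.add_le_add (Nat.le_mul_of_pos_right _ (by positivity)) ?_
    exact Nat.add_le_add (mono h (le_max_left _ _)) (mono h' (le_max_right _ _))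
  | loop e f c h =>
    simp only [bound, factor, depth]
    rw [add_mul (2 * (e.cost + f.cost + 1))]
    refine Nat.add_le_add ?_ ?_
    · calc (N + 1) * (e.cost + f.cost + 1) ≤ (2 * N) * (e.cost + f.cost + 1) :=
            Nat.mul_le_mul_right _ (by omega)
        _ = 2 * (e.cost + f.cost + 1) * N ^ 1 := by ring
        _ ≤ _ := Nat.mul_le_mul_left _ (Nat.pow_le_pow_right hN (by omega))
    · calc N * c.bound N ≤ N * (c.factor * N ^ c.depth) := Nat.mul_le_mul_left _ h
        _ = c.factor * N ^ (c.depth + 1) := by ring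

/-- Within the time bound for loops with at most `N` iterations, the program halts in a memory with
the property `Q`. -/
def Prog.Reaches (N : ℕ) (c : Prog) (Q : Mem → Prop) (m : Mem) : Prop :=
  ∃ t m', Runs c m t m' ∧ t ≤ c.bound N ∧ Q m'

/-- A precondition for reaching `Q`. -/
def Prog.wp (N : ℕ) : Prog → (Mem → Prop) → Mem → Prop
  | skip, Q, m => Q m
  | assign x e, Q, m => Q ⟨Function.update m.reg x (e.val m), m.arr⟩
  | load x a idx, Q, m => Q ⟨Function.update m.reg x (m.arr a (idx.map (Expr.val m))), m.arr⟩
  | store a idx e, Q, m => Q ⟨m.reg, Function.update m.arr a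
      (Function.update (m.arr a) (idx.map (Expr.val m)) (e.val m))⟩
  | seq c c', Q, m => c.wp N (c'.wp N Q) m
  | ite e f c c', Q, m =>
    (e.val m ≤ f.val m → c.wp N Q m) ∧ (f.val m < e.val m → c'.wp N Q m)
  -- Loops are not unfolded here. Instead, `wp_for` derives this condition from an invariant.
  | loop e f c, Q, m => (loop e f c).Reaches N Q m

theorem Prog.wp.reaches {N : ℕ} : ∀ {c : Prog} {Q : Mem → Prop} {m : Mem}, c.wp N Q m →
    c.Reaches N Q m := by
  intro c
  induction c with
  | skip => exact fun h => ⟨_, _, .skip _, le_rfl, h⟩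
  | assign x e => exact fun h => ⟨_, _, .assign _ _ _, le_rfl, h⟩
  | load x a idx => exact fun h => ⟨_, _, .load _ _ _ _, le_rfl, h⟩
  | store a idx e => exact fun h => ⟨_, _, .store _ _ _ _, le_rfl, h⟩
  | seq c c' ih ih' =>
    intro Q m h
    obtain ⟨t, m', hr, ht, h'⟩ := ih h
    obtain ⟨t', m'', hr', ht', h''⟩ := ih' h'
    exact ⟨_, _, .seq hr hr', Nat.add_le_add ht ht', h''⟩
  | ite e f c c' ih ih' =>
    intro Q m h
    rcases le_or_gt (e.val m) (f.val m) with hle | hlt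
    · obtain ⟨t, m', hr, ht, h'⟩ := ih (h.1 hle)
      exact ⟨_, _, .ite_true hle hr, by simp only [bound]; omega, h'⟩
    · obtain ⟨t, m', hr, ht, h'⟩ := ih' (h.2 hlt)
      exact ⟨_, _, .ite_false hlt hr, by simp only [bound]; omega, h'⟩
  | loop e f c ih => exact fun h => h

theorem Prog.wp.mono {N : ℕ} : ∀ {c : Prog} {Q Q' : Mem → Prop} {m : Mem}, c.wp N Q m →
    (∀ m, Q m → Q' m) → c.wp N Q' m := by
  intro c
  induction c with
  | seq c c' ih ih' => exact fun h hQ => ih h fun m h => ih' h hQ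
  | ite e f c c' ih ih' => exact fun h hQ => ⟨fun hle => ih (h.1 hle) hQ, fun hlt => ih' (h.2 hlt) hQ⟩
  | loop e f c ih => exact fun ⟨t, m', hr, ht, h⟩ hQ => ⟨t, m', hr, ht, hQ _ h⟩
  | _ => exact fun h hQ => hQ _ h

/-- Execute `c` for the values `lo, …, hi` of register `x`. -/
def Prog.for (x : ℕ) (lo hi : Expr) (c : Prog) : Prog :=
  .seq (.assign x lo) (.loop (.reg x) hi (.seq c (.assign x (.add (.reg x) (.const 1)))))

/-- The invariant must not depend on the loop variable, which is incremented after the body; the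
upper limit is evaluated anew in each round, hence `hhi`. The condition `B ≤ N + A` bounds the
number of rounds by `N`. -/
theorem Prog.wp_for {N A B b : ℕ} {lo hi : Expr} {c : Prog} {m : Mem} (J : ℕ → Mem → Prop)
    (hlo : lo.val m = A) (hAB : A ≤ B) (hN : B ≤ N + A) (h0 : J A m)
    (hJ : ∀ i m v, J i m → J i ⟨Function.update m.reg b v, m.arr⟩)
    (hhi : ∀ i m, J i m → hi.val m = (B : ℤ) - 1)
    (hstep : ∀ i m, A ≤ i → i < B → J i m → m.reg b = i →
      c.wp N (fun m' => J (i + 1) m' ∧ m'.reg b = i) m) :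
    (Prog.for b lo hi c).wp N (J B) m := by
  simp only [Prog.for, wp, hlo]
  have key : ∀ x i m, A ≤ i → i + x = B → J i m → m.reg b = i →
      ∃ t m', Runs (.loop (.reg b) hi (.seq c (.assign b (.add (.reg b) (.const 1))))) m t m' ∧
        t ≤ (x + 1) * ((Expr.reg b).cost + hi.cost + 1) +
          x * (Prog.seq c (.assign b (.add (.reg b) (.const 1)))).bound N ∧ J B m' := by
    intro x
    induction x with
    | zero =>
      intro i m _ hi' hJi hb
      obtain rfl : i = B := by omega
      exact ⟨_, _, .loop_end (by rw [hhi i m hJi, Expr.val, hb]; omega), by simp, hJi⟩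
    | succ x ih =>
      intro i m hAi hi' hJi hb
      obtain ⟨t, m', hr, ht, hJ', hb'⟩ := (hstep i m hAi (by omega) hJi hb).reaches
      have hb2 : (Expr.add (.reg b) (.const 1)).val m' = ((i + 1 : ℕ) : ℤ) := by
        simp [Expr.val, hb']
      obtain ⟨t', m'', hr', ht', h''⟩ := ih (i + 1)
        ⟨Function.update m'.reg b ((Expr.add (.reg b) (.const 1)).val m'), m'.arr⟩ (by omega)
        (by omega) (hJ _ _ _ hJ') (by simp [hb2])
      refine ⟨_, _, .loop_step (by rw [hhi i m hJi, Expr.val, hb]; omega)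
        (.seq hr (.assign _ _ _)) hr', ?_, h''⟩
      simp only [bound] at ht' ⊢
      nlinarith
  obtain ⟨t, m', hr, ht, h⟩ := key (B - A) A ⟨Function.update m.reg b A, m.arr⟩ le_rfl (by omega)
    (hJ _ _ _ h0) (by simp)
  refine ⟨t, m', hr, ht.trans ?_, h⟩
  simp only [bound]
  exact Nat.add_le_add (Nat.mul_le_mul_right _ (by omega)) (Nat.mul_le_mul_right _ (by omega))

/-- A loop with variable in register `b` that leaves the arrays and all registers before `b` except
`a` unchanged. -/
theorem Prog.wp_fold {N A B a b : ℕ} {lo hi : Expr} {c : Prog} {m : Mem} (J : ℕ → ℤ → Prop)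
    (hab : a < b) (hlo : lo.val m = A) (hAB : A ≤ B) (hN : B ≤ N + A)
    (hhi : ∀ m', (∀ x < b, x ≠ a → m'.reg x = m.reg x) → hi.val m' = (B : ℤ) - 1)
    (h0 : J A (m.reg a))
    (hstep : ∀ i m', A ≤ i → i < B → (∀ x < b, x ≠ a → m'.reg x = m.reg x) → m'.arr = m.arr →
      m'.reg b = (i : ℤ) → J i (m'.reg a) →
      c.wp N (fun m'' => (∀ x ≤ b, x ≠ a → m''.reg x = m'.reg x) ∧ m''.arr = m'.arr ∧
        J (i + 1) (m''.reg a)) m') :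
    (Prog.for b lo hi c).wp N (fun m' => (∀ x < b, x ≠ a → m'.reg x = m.reg x) ∧
      m'.arr = m.arr ∧ J B (m'.reg a)) m := by
  refine wp_for (fun i m' => (∀ x < b, x ≠ a → m'.reg x = m.reg x) ∧ m'.arr = m.arr ∧
    J i (m'.reg a)) hlo hAB hN ⟨fun _ _ _ => rfl, rfl, h0⟩ ?_ (fun i m' h => hhi m' h.1) ?_
  · rintro i m' v ⟨h1, h2, h3⟩
    refine ⟨fun x hx hxa => ?_, h2, ?_⟩
    · simpa [Function.update_of_ne hx.ne] using h1 x hx hxa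
    · simpa [Function.update_of_ne hab.ne] using h3
  · rintro i m' hAi hiB ⟨h1, h2, h3⟩ hb
    refine (hstep i m' hAi hiB h1 h2 hb h3).mono ?_
    rintro m'' ⟨h4, h5, h6⟩
    exact ⟨⟨fun x hx hxa => (h4 x hx.le hxa).trans (h1 x hx hxa), h5.trans h2, h6⟩,
      (h4 b le_rfl hab.ne').trans hb⟩

/-- From `m` to `m'`, the registers before `b` and the arrays other than `a` do not change, and
neither do the entries of `a` outside `D`; those in `D` satisfy `R` afterwards. -/
structure Upd (m m' : Mem) (b a : ℕ) (D : Set (List ℤ)) (R : List ℤ → ℤ → Prop) : Prop where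
  reg : ∀ x < b, m'.reg x = m.reg x
  other : ∀ a', a' ≠ a → m'.arr a' = m.arr a'
  out : ∀ idx, idx ∉ D → m'.arr a idx = m.arr a idx
  mem : ∀ idx ∈ D, R idx (m'.arr a idx)

/-- The cells treated in finished rounds are correct. A later round may overwrite some of them,
because the same relation `R` applies to all rounds. -/
theorem Prog.wp_fill {N A B a b : ℕ} {lo hi : Expr} {c : Prog} {m : Mem} (D : ℕ → Set (List ℤ))
    (R : List ℤ → ℤ → Prop) (hlo : lo.val m = A) (hAB : A ≤ B) (hN : B ≤ N + A)
    (hhi : ∀ m', (∀ x < b, m'.reg x = m.reg x) → hi.val m' = (B : ℤ) - 1)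
    (hstep : ∀ i m', A ≤ i → i < B →
      Upd m m' b a {idx | ∃ i', A ≤ i' ∧ i' < i ∧ idx ∈ D i'} R → m'.reg b = i →
      c.wp N (fun m'' => Upd m' m'' (b + 1) a (D i) R) m') :
    (Prog.for b lo hi c).wp N
      (fun m' => Upd m m' b a {idx | ∃ i', A ≤ i' ∧ i' < B ∧ idx ∈ D i'} R) m := by
  refine wp_for (fun i m' => Upd m m' b a {idx | ∃ i', A ≤ i' ∧ i' < i ∧ idx ∈ D i'} R) hlo hAB hN
    ⟨fun _ _ => rfl, fun _ _ => rfl, fun _ _ => rfl, ?_⟩ ?_ (fun i m' h => hhi m' h.reg) ?_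
  · rintro idx ⟨i', h1, h2, -⟩
    omega
  · intro i m' v h
    refine ⟨fun x hx => ?_, h.other, h.out, h.mem⟩
    simpa [Function.update_of_ne hx.ne] using h.reg x hx
  · intro i m' hAi hiB h hb
    refine (hstep i m' hAi hiB h hb).mono fun m'' h' => ⟨⟨fun x hx => ?_, fun a' ha => ?_,
      fun idx hidx => ?_, fun idx hidx => ?_⟩, (h'.reg b (by omega)).trans hb⟩
    · exact (h'.reg x (by omega)).trans (h.reg x hx)
    · exact (h'.other a' ha).trans (h.other a' ha)
    · rw [h'.out idx fun hD => hidx ⟨i, hAi, by omega, hD⟩]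
      exact h.out idx fun ⟨i', h1, h2, h3⟩ => hidx ⟨i', h1, by omega, h3⟩
    · by_cases hD : idx ∈ D i
      · exact h'.mem idx hD
      · rw [h'.out idx hD]
        obtain ⟨i', h1, h2, h3⟩ := hidx
        refine h.mem idx ⟨i', h1, ?_, h3⟩
        rcases Nat.lt_succ_iff_lt_or_eq.1 h2 with h4 | rfl
        · exact h4
        · exact absurd h3 hD

theorem Upd.of_store {m m' : Mem} {b a : ℕ} {idx : List ℤ} {v : ℤ} {R : List ℤ → ℤ → Prop}
    (hreg : ∀ x < b, m'.reg x = m.reg x) (harr : m'.arr = m.arr) (hv : R idx v) :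
    Upd m ⟨m'.reg, Function.update m'.arr a (Function.update (m'.arr a) idx v)⟩ b a {idx} R := by
  refine ⟨hreg, fun a' ha => ?_, fun i hi => ?_, ?_⟩
  · simp [Function.update_of_ne ha, harr]
  · have : i ≠ idx := hi
    simp [Function.update_of_ne this, harr]
  · rintro i rfl
    simpa using hv

/-- Execute `c` if all the comparisons `e ≤ f` in a list hold. -/
def Prog.guard : List (Expr × Expr) → Prog → Prog
  | [], c => c
  | ef :: L, c => .ite ef.1 ef.2 (Prog.guard L c) .skip

theorem Prog.wp_guard {N : ℕ} {c : Prog} {Q : Mem → Prop} {m : Mem} :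
    ∀ L : List (Expr × Expr), (Prog.guard L c).wp N Q m ↔
      ((∀ ef ∈ L, ef.1.val m ≤ ef.2.val m) → c.wp N Q m) ∧
      ((¬ ∀ ef ∈ L, ef.1.val m ≤ ef.2.val m) → Q m)
  | [] => by simp [guard]
  | ef :: L => by
    simp only [guard, wp, wp_guard L, List.forall_mem_cons]
    by_cases h : ef.1.val m ≤ ef.2.val m
    · simp [h, not_lt.2 h]
    · simp [h, lt_of_not_ge h]

/-- Replace register `a` by the maximum of its value and `e`. -/
def Prog.raise (a : ℕ) (e : Expr) : Prog := .ite (.reg a) e (.assign a e) .skip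

theorem Prog.wp_raise {N a : ℕ} {e : Expr} {Q : Mem → Prop} {m : Mem}
    (h : Q ⟨Function.update m.reg a (max (m.reg a) (e.val m)), m.arr⟩) :
    (Prog.raise a e).wp N Q m := by
  simp only [raise, wp, Expr.val]
  refine ⟨fun hle => ?_, fun hlt => ?_⟩
  · rwa [max_eq_right hle] at h
  · rwa [max_eq_left hlt.le, Function.update_eq_self] at h

/-- This matches the pattern `if … else ⊥` in `optU`: a register cannot hold `⊥`, so an option that
is not applicable leaves it unchanged. -/
theorem Prog.wp_guard_raise {N a : ℕ} {e : Expr} {Q : Mem → Prop} {m : Mem}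
    (L : List (Expr × Expr))
    (h : ∀ v : ℤ, (v : WithBot ℤ) = max (m.reg a : WithBot ℤ)
      (if ∀ ef ∈ L, ef.1.val m ≤ ef.2.val m then (e.val m : WithBot ℤ) else ⊥) →
      Q ⟨Function.update m.reg a v, m.arr⟩) :
    (Prog.guard L (Prog.raise a e)).wp N Q m := by
  rw [wp_guard]
  refine ⟨fun hL => wp_raise (h _ ?_), fun hL => ?_⟩
  · rw [if_pos hL]
    exact WithBot.coe_max _ _
  · have := h (m.reg a) (by rw [if_neg hL]; simp)
    rwa [Function.update_eq_self] at this


/-! ### The recurrences in terms of next releases and crowded pairs -/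

namespace Jobs

variable (I : Jobs)

/-- Job `j` is the first one of the jobs before `k` that is released at `u` or later; `j = 0` if
there is none. -/
def IsNext (k : ℕ) (u : ℤ) (j : ℕ) : Prop :=
  (j = 0 ∧ ∀ i, 1 ≤ i → i < k → I.r i < u) ∨
  (1 ≤ j ∧ j < k ∧ u ≤ I.r j ∧ ∀ i, 1 ≤ i → i < k → u ≤ I.r i → I.r j ≤ I.r i)

/-- The release time of job `j`, where that of job `0` is `d_k`. -/
def nextVal (k j : ℕ) : ℤ := if j = 0 then I.d k else I.r j

/-- The interval `[r_i, r_l)` is too short for the jobs before `k` released in it. -/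
def Tight (k l i : ℕ) : Prop :=
  I.r i < I.r l ∧ I.r l - I.r i <
    ((∑ j ∈ Finset.Ico 1 k with I.r i ≤ I.r j ∧ I.r j < I.r l, I.p j : ℕ) : ℤ)

/-- Some interval `[r_i, r_l)` with `r_s ≤ r_i` is too short for the jobs before `k` released in
it. -/
def Crowded (k s l : ℕ) : Prop := ∃ i, 1 ≤ i ∧ i < k ∧ I.r s ≤ I.r i ∧ I.Tight k l i

variable {I}

/-- No job below `k` is released in `[u, t)` precisely if the first release at or after `u` is not
before `t`. If there is no such release, the value `d_k` acts as infinity for `t ≤ d_k`. -/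
theorem IsNext.prevr_lt_iff {k j : ℕ} {u t : ℤ} (h : I.IsNext k u j) (ht : t ≤ I.d k) :
    I.prevr (k - 1) t < (u : WithBot ℤ) ↔ t ≤ I.nextVal k j := by
  rw [Jobs.prevr_lt_iff, nextVal]
  rcases h with ⟨rfl, h⟩ | ⟨hj1, hjk, hj, h⟩
  · simp only [if_true, ht, iff_true]
    exact fun i hi hik _ => h i hi (by omega)
  · rw [if_neg (by omega)]
    constructor
    · intro h'
      by_contra hlt
      have := h' j hj1 (by omega) (by omega)
      omega
    · intro h' i hi hik hit
      by_contra hlt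
      have := h i hi (by omega) (by omega)
      omega

/-- All conditions become comparisons of stored numbers. The data for `g - h - 1` are required only
for `h < g`; otherwise the subtraction is truncated, but option (4) is not applicable. -/
theorem optU_eq {k g h q j j' : ℕ} {u w : ℤ} {V : ℕ → WithBot ℤ} (hu : V (g - h) = u)
    (hj : I.IsNext k u j) (hw : h < g → V (g - h - 1) = w) (hj' : h < g → I.IsNext k w j') :
    I.optU k g h q V = max
      (if (q : ℤ) ≤ I.p k ∧ u + (I.p k - q) + 1 ≤ I.d k ∧ I.r k ≤ u ∧
        u + (I.p k - q) ≤ I.nextVal k j then ((u + (I.p k - q) : ℤ) : WithBot ℤ) else ⊥)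
      (max (if (q : ℤ) + 1 ≤ I.p k ∧ I.d k - u ≤ I.p k - q ∧ I.d k ≤ I.nextVal k j
          then (I.d k : WithBot ℤ) else ⊥)
        (if (h : ℤ) + 1 ≤ g ∧ (q : ℤ) + 1 ≤ I.p k ∧ w + (I.p k - q) + 1 ≤ I.d k ∧
          I.d k ≤ I.nextVal k j' then (I.d k : WithBot ℤ) else ⊥)) := by
  simp only [optU, hu, WithBot.unbotD_coe, ENat.toNat_natCast, Nat.cast_le, Nat.cast_lt, gt_iff_lt,
    ge_iff_le]
  congr 1
  · refine if_congr ?_ rfl rfl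
    constructor
    · rintro ⟨h1, h2, h3, h4⟩
      exact ⟨h1, by omega, h3, (hj.prevr_lt_iff (by omega)).1 h4⟩
    · rintro ⟨h1, h2, h3, h4⟩
      exact ⟨h1, by omega, h3, (hj.prevr_lt_iff (by omega)).2 h4⟩
  · congr 1
    · exact if_congr (and_congr (by omega) (and_congr Iff.rfl (hj.prevr_lt_iff le_rfl))) rfl rfl
    · by_cases hhg : h < g
      · rw [hw hhg, WithBot.unbotD_coe]
        exact if_congr (and_congr (by omega) (and_congr (by omega) (and_congr (by omega)
          ((hj' hhg).prevr_lt_iff le_rfl)))) rfl rfl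
      · rw [if_neg (fun h' => hhg h'.1), if_neg (fun h' => hhg (by omega))]

theorem optU_top {k g h : ℕ} {V : ℕ → WithBot ℤ} : I.optU k g h ⊤ V = ⊥ := by
  simp [optU]

namespace Normalized

variable (hI : I.Normalized)

include hI

/-- The left end of an overloaded interval can be moved up to the first release in it, so only the
intervals `[r_i, r_l)` have to be tested. -/
theorem crowded_iff {k s l : ℕ} (hk1 : 1 ≤ k) (hkn : k ≤ I.n) :
    (∃ j ∈ Finset.Ico 1 k, I.r s ≤ I.r j ∧ I.r j < I.r l ∧ I.r l < I.earliest s j) ↔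
      I.Crowded k s l := by
  rcases le_or_gt (I.r s) (I.r l) with hsl | hsl
  · rw [hI.overloaded_iff hk1 hkn hsl]
    constructor
    · rintro ⟨x, hx1, hx2, hx3⟩
      obtain ⟨j, hj⟩ : ((Finset.Ico 1 k).filter fun j => x ≤ I.r j ∧ I.r j < I.r l).Nonempty := by
        rw [Finset.nonempty_iff_ne_empty]
        intro h
        rw [h] at hx3
        simp at hx3
        omega
      obtain ⟨i, hi, hmin⟩ := Finset.exists_min_image _ I.r ⟨j, hj⟩
      simp only [Finset.mem_filter, Finset.mem_Ico] at hi hmin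
      refine ⟨i, hi.1.1, hi.1.2, by omega, hi.2.2, ?_⟩
      have : (Finset.Ico 1 k).filter (fun j => I.r i ≤ I.r j ∧ I.r j < I.r l) =
          (Finset.Ico 1 k).filter (fun j => x ≤ I.r j ∧ I.r j < I.r l) := by
        refine Finset.filter_congr fun j hj => ?_
        rw [Finset.mem_Ico] at hj
        constructor
        · rintro ⟨h1, h2⟩
          exact ⟨by omega, h2⟩
        · rintro ⟨h1, h2⟩
          exact ⟨hmin j ⟨hj, h1, h2⟩, h2⟩
      rw [this]
      omega
    · rintro ⟨i, -, -, h3, h4, h5⟩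
      exact ⟨I.r i, h3, h4.le, h5⟩
  · constructor
    · rintro ⟨j, -, h1, h2, -⟩
      omega
    · rintro ⟨i, -, -, h1, h2, -⟩
      omega

/-- The condition `prevr_{k-1}(r_j) < u < r_j` leaves only the next job released at or after `u`,
which is unique since release times are distinct. So the minimum over `j` disappears, which saves a
loop in the computation of `P`. -/
theorem stepP_eq_ite {k l s g : ℕ} (hkn : k ≤ I.n) (hl1 : 1 ≤ l) (hlk : l < k) (hs1 : 1 ≤ s)
    (hsn : s ≤ I.n) (hgn : g < I.n) {V : ℕ → ℕ → WithBot ℤ} {u : ℕ → ℕ → ℤ} {nx : ℕ → ℕ → ℕ}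
    (hV : ∀ s g, 1 ≤ s → s ≤ I.n → g < I.n → V s g = u s g)
    (hu : ∀ s g, 1 ≤ s → s ≤ I.n → g < I.n → I.r s ≤ u s g)
    (hnx : ∀ s g, 1 ≤ s → s ≤ I.n → g < I.n → I.IsNext k (u s g) (nx s g)) [Decidable (I.Crowded k s l)] :
    I.stepP k V l s g = if I.Crowded k s l then ⊤ else if I.r l ≤ u s g then 0 else
      (Finset.range (g + 1)).inf fun h =>
        if u s h + 1 ≤ I.nextVal k (nx s h) ∧ I.nextVal k (nx s h) ≤ I.r l ∧ I.r k ≤ u s h then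
          ((I.nextVal k (nx s h) - u s h).toNat : ℕ∞) + I.stepP k V l (nx s h) (g - h)
        else ⊤ := by
  rw [stepP]
  refine if_congr (hI.crowded_iff (by omega) hkn) rfl (if_congr ?_ rfl ?_)
  · rw [hV s g hs1 hsn hgn, WithBot.coe_le_coe]
  · refine Finset.inf_congr rfl fun h hh => ?_
    rw [Finset.mem_range] at hh
    have hVh := hV s h hs1 hsn (by omega)
    have huh := hu s h hs1 hsn (by omega)
    have hn := hnx s h hs1 hsn (by omega)
    have hld := hI.r_lt_d hl1 hlk.le hkn
    set j := nx s h
    have hiff : ∀ i ∈ Finset.Ico 1 k, (I.r s < I.r i ∧ I.r i ≤ I.r l ∧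
        I.prevr (k - 1) (I.r i) < V s h ∧ V s h < (I.r i : WithBot ℤ) ∧
        (I.r k : WithBot ℤ) ≤ V s h) ↔ i = j ∧ u s h + 1 ≤ I.nextVal k j ∧
          I.nextVal k j ≤ I.r l ∧ I.r k ≤ u s h := by
      intro i hi
      rw [Finset.mem_Ico] at hi
      rw [hVh, WithBot.coe_lt_coe, WithBot.coe_le_coe]
      constructor
      · rintro ⟨h1, h2, h3, h4, h5⟩
        rw [hn.prevr_lt_iff (by omega)] at h3
        rcases hn with ⟨hj, hn⟩ | ⟨hj1, hjk, hj, hn⟩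
        · have := hn i hi.1 hi.2
          omega
        · have h6 := hn i hi.1 hi.2 h4.le
          rw [nextVal, if_neg (by omega)] at h3 ⊢
          exact ⟨hI.r_injOn ⟨hi.1, by omega⟩ ⟨hj1, by omega⟩ (by omega), by omega, by omega, h5⟩
      · rintro ⟨rfl, h1, h2, h3⟩
        have hnv : I.nextVal k j = I.r j := if_neg (by omega)
        rw [hn.prevr_lt_iff (by rw [← hnv]; omega)]
        rw [hnv] at h1 h2 ⊢
        exact ⟨by omega, h2, le_rfl, by omega, h3⟩
    split_ifs with hc
    · have hjk : j ∈ Finset.Ico 1 k := by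
        rcases hn with ⟨hj, -⟩ | ⟨hj1, hjk, -⟩
        · rw [hj, nextVal, if_pos rfl] at hc
          omega
        · exact Finset.mem_Ico.2 ⟨hj1, hjk⟩
      have hnv : I.nextVal k j = I.r j := if_neg (by rw [Finset.mem_Ico] at hjk; omega)
      refine le_antisymm ?_ (Finset.le_inf fun i hi => ?_)
      · refine (Finset.inf_le hjk).trans ?_
        rw [dif_pos ((hiff j hjk).2 ⟨rfl, hc⟩), hVh, hnv, WithBot.unbotD_coe]
      · split_ifs with hi'
        · obtain ⟨rfl, -⟩ := (hiff i hi).1 hi'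
          rw [hVh, hnv, WithBot.unbotD_coe]
        · exact le_top
    · refine top_le_iff.1 (Finset.le_inf fun i hi => ?_)
      rw [dif_neg fun hi' => hc ((hiff i hi).1 hi').2]

end Normalized

@[simp]
theorem encode_top : encode ⊤ = -1 := if_pos rfl

@[simp]
theorem encode_natCast (q : ℕ) : encode (q : ℕ∞) = q := by
  simp [encode]

theorem encode_nonneg_or (q : ℕ∞) : (q = ⊤ ∧ encode q = -1) ∨ ∃ m : ℕ, q = m ∧ encode q = m := by
  cases q using ENat.recTopCoe with
  | top => exact Or.inl ⟨rfl, encode_top⟩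
  | coe m => exact Or.inr ⟨m, rfl, encode_natCast m⟩

/-- The number of jobs released after job `s`. -/
def rank (I : Jobs) (s : ℕ) : ℕ := ((Finset.Icc 1 I.n).filter fun j => I.r s < I.r j).card

theorem rank_lt_rank {s j : ℕ} (hj1 : 1 ≤ j) (hjn : j ≤ I.n) (h : I.r s < I.r j) :
    I.rank j < I.rank s := by
  refine Finset.card_lt_card (Finset.ssubset_iff_of_subset (fun i hi => ?_) |>.2 ⟨j, ?_, ?_⟩)
  · simp only [Finset.mem_filter] at hi ⊢
    exact ⟨hi.1, h.trans hi.2⟩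
  · simp [hj1, hjn, h]
  · simp

theorem rank_lt {s : ℕ} (hs1 : 1 ≤ s) (hsn : s ≤ I.n) : I.rank s < I.n := by
  have : I.rank s < (Finset.Icc 1 I.n).card :=
    Finset.card_lt_card (Finset.filter_ssubset.2 ⟨s, by simp [hs1, hsn], by simp⟩)
  simpa using this

theorem Normalized.rank_injOn (hI : I.Normalized) : Set.InjOn I.rank (Set.Icc 1 I.n) := by
  intro s hs j hj h
  refine hI.r_injOn hs hj ?_
  rcases lt_trichotomy (I.r s) (I.r j) with h' | h' | h'
  · exact absurd (rank_lt_rank hj.1 hj.2 h') (by omega)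
  · exact h'
  · exact absurd (rank_lt_rank hs.1 hs.2 h') (by omega)

theorem Normalized.exists_rank_eq (hI : I.Normalized) {x : ℕ} (hx : x < I.n) :
    ∃ s, 1 ≤ s ∧ s ≤ I.n ∧ I.rank s = x := by
  have h := Finset.surjOn_of_injOn_of_card_le (s := Finset.Icc 1 I.n) (t := Finset.range I.n) I.rank
    (fun s hs => ?_) (by simpa using hI.rank_injOn) (by simp)
  · obtain ⟨s, hs, rfl⟩ := h (by simpa using hx : x ∈ ((Finset.range I.n : Finset ℕ) : Set ℕ))
    simp only [Finset.coe_Icc, Set.mem_Icc] at hs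
    exact ⟨s, hs.1, hs.2, rfl⟩
  · simp only [Finset.coe_Icc, Set.mem_Icc] at hs
    simpa using rank_lt hs.1 hs.2

end Jobs


/-! ### The program: next releases -/

open GapSched.Expr GapSched.Prog

/-- Execute the programs in a list one after the other. -/
def Prog.block : List Prog → Prog
  | [] => .skip
  | c :: L => .seq c (Prog.block L)

/-- The memory holds the instance. -/
structure Jobs.Data (I : Jobs) (m : Mem) : Prop where
  n : m.reg 0 = I.n
  r : ∀ j : ℕ, 1 ≤ j → j ≤ I.n → m.arr 0 [(j : ℤ)] = I.r j
  d : ∀ j : ℕ, 1 ≤ j → j ≤ I.n → m.arr 1 [(j : ℤ)] = I.d j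
  p : ∀ j : ℕ, 1 ≤ j → j ≤ I.n → m.arr 2 [(j : ℤ)] = I.p j

namespace Jobs

variable {I : Jobs}

theorem Data.of_eq {m m' : Mem} (h : I.Data m) (hreg : m'.reg 0 = m.reg 0)
    (harr : m'.arr = m.arr) : I.Data m' :=
  ⟨hreg.trans h.n, by simpa [harr] using h.r, by simpa [harr] using h.d, by simpa [harr] using h.p⟩

theorem Data.of_upd {m m' : Mem} {b a : ℕ} {D : Set (List ℤ)} {R : List ℤ → ℤ → Prop}
    (h : I.Data m) (hu : Upd m m' b a D R) (hb : 0 < b) (ha : 3 ≤ a) : I.Data m' :=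
  ⟨(hu.reg 0 hb).trans h.n, by simpa [hu.other 0 (by omega)] using h.r,
    by simpa [hu.other 1 (by omega)] using h.d, by simpa [hu.other 2 (by omega)] using h.p⟩

/-- Find the first release time at or after the number in register `5`. -/
def nextLoop : Prog :=
  .for 7 (const 1) (sub (reg 2) (const 1)) (block [
    load 8 0 [reg 7],
    load 9 0 [reg 6],
    guard [(reg 5, reg 8), (add (reg 8) (const 1), reg 9)] (assign 6 (reg 7))])

/-- The invariant is `IsNext i u j` for the jobs before `i`. Cell `0` of the release times holds
`d_k`, a sentinel above the release times of all jobs below `k`, so the initial value `j = 0` needs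
no special treatment. -/
theorem wp_nextLoop {m : Mem} {k : ℕ} {u : ℤ} (hI : I.Normalized) (hm : I.Data m) (hk1 : 1 ≤ k) (hkn : k ≤ I.n)
    (hk : m.reg 2 = k) (hd : m.arr 0 [0] = I.d k) (hu : m.reg 5 = u) (h6 : m.reg 6 = 0) :
    nextLoop.wp I.n (fun m' => (∀ x < 7, x ≠ 6 → m'.reg x = m.reg x) ∧ m'.arr = m.arr ∧
      ∃ j : ℕ, m'.reg 6 = j ∧ I.IsNext k u j) m := by
  refine wp_fold (A := 1) (B := k) (fun i v => ∃ j : ℕ, v = j ∧ I.IsNext i u j) (by simp)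
    (by simp [Expr.val]) hk1 (by omega) (fun m' h => by simp [Expr.val, h, hk]) ⟨0, by simp [h6], ?_⟩ ?_
  · exact Or.inl ⟨rfl, by omega⟩
  · rintro i m' hi hik hreg harr h7 ⟨j, h6', hj⟩
    have hri : m'.arr 0 [(i : ℤ)] = I.r i := by rw [harr, hm.r i hi (by omega)]
    have hrj : m'.arr 0 [(j : ℤ)] = I.nextVal k j := by
      rw [harr, nextVal]
      rcases hj with ⟨rfl, -⟩ | ⟨hj1, hj2, -⟩
      · simpa using hd
      · rw [if_neg (by omega), hm.r j hj1 (by omega)]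
    simp [block, wp, wp_guard, Expr.val, hreg, h7, h6', hri, hrj, hu]
    refine ⟨fun h1 h2 => ⟨fun x hx hx' => by repeat rw [Function.update_of_ne (by omega)], ?_⟩,
      fun h1 => ⟨fun x hx hx' => by repeat rw [Function.update_of_ne (by omega)], ?_⟩⟩
    · refine Or.inr ⟨hi, by omega, h1, fun i' hi' hii' h3 => ?_⟩
      rcases Nat.lt_succ_iff_lt_or_eq.1 hii' with h4 | rfl
      · rcases hj with ⟨-, hj⟩ | ⟨hj1, hj2, -, hj⟩
        · have := hj i' hi' h4
          omega
        · have := hj i' hi' h4 h3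
          rw [nextVal, if_neg (by omega)] at h2
          omega
      · exact le_rfl
    · have hid := hI.r_lt_d hi hik.le hkn
      rcases hj with ⟨rfl, hj⟩ | ⟨hj1, hj2, h3, hj⟩
      · refine Or.inl ⟨rfl, fun i' hi' hii' => ?_⟩
        rw [nextVal, if_pos rfl] at h1
        rcases Nat.lt_succ_iff_lt_or_eq.1 hii' with h4 | rfl
        · exact hj i' hi' h4
        · omega
      · refine Or.inr ⟨hj1, by omega, h3, fun i' hi' hii' h4 => ?_⟩
        rw [nextVal, if_neg (by omega)] at h1
        rcases Nat.lt_succ_iff_lt_or_eq.1 hii' with h5 | rfl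
        · exact hj i' hi' h5 h4
        · exact h1 h4

/-- Fill array `6` with the first jobs before job `k` that are released at or after `U[s,k-1,g]`. -/
def nextStage : Prog :=
  .for 3 (const 1) (reg 0) (.for 4 (const 0) (sub (reg 0) (const 1)) (block [
    load 5 3 [reg 3, sub (reg 2) (const 1), reg 4],
    assign 6 (const 0),
    nextLoop,
    store 6 [reg 3, reg 4] (reg 6)]))

theorem wp_nextStage {m : Mem} {k : ℕ} {u : ℕ → ℕ → ℤ} (hI : I.Normalized) (hm : I.Data m)
    (hk1 : 1 ≤ k) (hkn : k ≤ I.n) (hk : m.reg 2 = k) (hd : m.arr 0 [0] = I.d k)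
    (hu : ∀ s g : ℕ, 1 ≤ s → s ≤ I.n → g < I.n → m.arr 3 [(s : ℤ), (k : ℤ) - 1, (g : ℤ)] = u s g) :
    nextStage.wp I.n (fun m' => Upd m m' 3 6 {idx | ∃ s, 1 ≤ s ∧ s < I.n + 1 ∧
        idx ∈ {idx | ∃ g, 0 ≤ g ∧ g < I.n ∧ idx ∈ ({[(s : ℤ), (g : ℤ)]} : Set (List ℤ))}}
      (fun idx v => ∀ s g : ℕ, idx = [(s : ℤ), (g : ℤ)] →
        ∃ j : ℕ, v = j ∧ I.IsNext k (u s g) j)) m := by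
  refine wp_fill (A := 1) (B := I.n + 1) _ _ (by simp [Expr.val]) (by omega) (by omega)
    (fun m' h => by simp [Expr.val, h, hm.n]) fun s m₁ hs1 hsn h₁ hs => ?_
  refine wp_fill (A := 0) (B := I.n) (fun g => {[(s : ℤ), (g : ℤ)]}) _ (by simp [Expr.val]) (by omega)
    (by omega) (fun m' h => by simp [Expr.val, h, h₁.reg, hm.n]) fun g m₂ hg1 hgn h₂ hg => ?_
  have hs₂ : m₂.reg 3 = s := (h₂.reg 3 (by omega)).trans hs
  have hk₂ : m₂.reg 2 = k := by rw [h₂.reg 2 (by omega), h₁.reg 2 (by omega), hk]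
  have hm₂ : I.Data m₂ := (hm.of_upd h₁ (by omega) (by omega)).of_upd h₂ (by omega) (by omega)
  have hd₂ : m₂.arr 0 [0] = I.d k := by rw [h₂.other 0 (by omega), h₁.other 0 (by omega), hd]
  have hu₂ : m₂.arr 3 [(s : ℤ), (k : ℤ) - 1, (g : ℤ)] = u s g := by
    rw [h₂.other 3 (by omega), h₁.other 3 (by omega), hu s g hs1 (by omega) hgn]
  simp [block, wp, Expr.val, hs₂, hk₂, hg, hu₂]
  refine wp.mono (wp_nextLoop (k := k) (u := u s g) hI ?_ hk1 hkn ?_ ?_ ?_ ?_) ?_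
  · exact hm₂.of_eq (by simp) rfl
  · simp [hk₂]
  · exact hd₂
  · simp
  · simp
  · rintro m₃ ⟨h3, h4, j, hj, hnext⟩
    have e3 : m₃.reg 3 = s := by rw [h3 3 (by omega) (by omega)]; simp [hs₂]
    have e4 : m₃.reg 4 = g := by rw [h3 4 (by omega) (by omega)]; simp [hg]
    rw [e3, e4]
    refine Upd.of_store (fun x hx => ?_) h4 ?_
    · rw [h3 x (by omega) (by omega)]
      dsimp only
      repeat rw [Function.update_of_ne (by omega)]
    · intro s' g' heq
      simp only [List.cons.injEq, Nat.cast_inj, and_true] at heq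
      obtain ⟨rfl, rfl⟩ := heq
      exact ⟨j, hj, hnext⟩

end Jobs


/-! ### The program: crowded pairs -/

open GapSched.Expr GapSched.Prog

namespace Jobs

variable {I : Jobs}

/-- Sum up the processing times of the jobs whose release times lie between registers `9` and
`5`. -/
def sumLoop : Prog :=
  .for 11 (const 1) (sub (reg 2) (const 1)) (block [
    load 12 0 [reg 11],
    load 13 2 [reg 11],
    guard [(reg 9, reg 12), (add (reg 12) (const 1), reg 5)] (assign 10 (add (reg 10) (reg 13)))])

theorem wp_sumLoop {m : Mem} {k : ℕ} {x t : ℤ} (hm : I.Data m) (hk1 : 1 ≤ k) (hkn : k ≤ I.n)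
    (hk : m.reg 2 = k) (hx : m.reg 9 = x) (ht : m.reg 5 = t) (h10 : m.reg 10 = 0) :
    sumLoop.wp I.n (fun m' => (∀ y < 11, y ≠ 10 → m'.reg y = m.reg y) ∧ m'.arr = m.arr ∧
      m'.reg 10 = ((∑ j ∈ Finset.Ico 1 k with x ≤ I.r j ∧ I.r j < t, I.p j : ℕ) : ℤ)) m := by
  refine wp_fold (A := 1) (B := k)
    (fun i v => v = ((∑ j ∈ Finset.Ico 1 i with x ≤ I.r j ∧ I.r j < t, I.p j : ℕ) : ℤ))
    (by norm_num) (by simp [Expr.val]) hk1 (by omega) (fun m' h => by simp [Expr.val, h, hk])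
    (by simp [h10]) ?_
  intro i m' hi hik hreg harr h11 h10'
  have hri : m'.arr 0 [(i : ℤ)] = I.r i := by rw [harr, hm.r i hi (by omega)]
  have hpi : m'.arr 2 [(i : ℤ)] = I.p i := by rw [harr, hm.p i hi (by omega)]
  simp [block, wp, wp_guard, Expr.val, hreg, h11, h10', hri, hpi, hx, ht,
    ← Finset.insert_Ico_right_eq_Ico_add_one hi, Finset.filter_insert]
  refine ⟨fun h1 h2 => ⟨fun x hx hx' => by repeat rw [Function.update_of_ne (by omega)], ?_⟩,
      fun h1 => ⟨fun x hx hx' => by repeat rw [Function.update_of_ne (by omega)], ?_⟩⟩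
  · rw [if_pos ⟨h1, h2⟩, Finset.sum_insert (by simp)]
    ring
  · rw [if_neg fun h => by have := h1 h.1; omega]

/-- Set register `7` to `1` if the set of jobs before `k` is crowded. -/
def crowdedLoop : Prog :=
  .for 8 (const 1) (sub (reg 2) (const 1)) (block [
    load 9 0 [reg 8],
    assign 10 (const 0),
    sumLoop,
    guard [(reg 6, reg 9), (add (reg 9) (const 1), reg 5),
      (add (sub (reg 5) (reg 9)) (const 1), reg 10)] (assign 7 (const 1))])

open Classical in
theorem wp_crowdedLoop {m : Mem} {k s l : ℕ} (hm : I.Data m) (hk1 : 1 ≤ k) (hkn : k ≤ I.n)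
    (hk : m.reg 2 = k) (hl : m.reg 5 = I.r l) (hs : m.reg 6 = I.r s) (h7 : m.reg 7 = 0) :
    crowdedLoop.wp I.n (fun m' => (∀ y < 8, y ≠ 7 → m'.reg y = m.reg y) ∧ m'.arr = m.arr ∧
      m'.reg 7 = if I.Crowded k s l then 1 else 0) m := by
  have hfold := wp_fold (N := I.n) (a := 7) (b := 8) (A := 1) (B := k) (m := m)
    (lo := const 1) (hi := sub (reg 2) (const 1)) (c := (block [
    load 9 0 [reg 8],
    assign 10 (const 0),
    sumLoop,
    guard [(reg 6, reg 9), (add (reg 9) (const 1), reg 5),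
      (add (sub (reg 5) (reg 9)) (const 1), reg 10)] (assign 7 (const 1))]))
    (fun i v => v = if ∃ i', 1 ≤ i' ∧ i' < i ∧ I.r s ≤ I.r i' ∧ I.Tight k l i' then 1 else 0)
    (by norm_num) (by simp [Expr.val]) hk1 (by omega) (fun m' h => by simp [Expr.val, h, hk]) ?_ ?_
  · exact hfold
  · rw [if_neg]
    · exact h7
    · rintro ⟨i', h1, h2, -⟩
      omega
  · intro i m' hi hik hreg harr h8 h7'
    have hri : m'.arr 0 [(i : ℤ)] = I.r i := by rw [harr, hm.r i hi (by omega)]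
    have hm' : I.Data m' := hm.of_eq (hreg 0 (by omega) (by omega)) harr
    simp [block, wp, Expr.val, h8, hri]
    refine wp.mono (wp_sumLoop (k := k) (x := I.r i) (t := I.r l) ?_ hk1 hkn ?_ ?_ ?_ ?_) ?_
    · exact hm'.of_eq (by simp) rfl
    · simp [hreg, hk]
    · simp
    · simp [hreg, hl]
    · simp
    · rintro m₂ ⟨h3, h4, h5⟩
      simp only [harr, ne_eq] at h3 h4
      have h3' : ∀ x ≤ 8, m₂.reg x = m'.reg x := by
        intro x hx
        rw [h3 x (by omega) (by omega)]
        repeat rw [Function.update_of_ne (by omega)]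
      have e9 : m₂.reg 9 = I.r i := by
        rw [h3 9 (by omega) (by omega)]
        simp
      have hstep : (∃ i', 1 ≤ i' ∧ i' ≤ i ∧ I.r s ≤ I.r i' ∧ I.Tight k l i') ↔
          (I.r s ≤ I.r i ∧ I.Tight k l i) ∨
            ∃ i', 1 ≤ i' ∧ i' < i ∧ I.r s ≤ I.r i' ∧ I.Tight k l i' := by
        constructor
        · rintro ⟨i', h1, h2, h⟩
          rcases h2.lt_or_eq with h6 | rfl
          · exact Or.inr ⟨i', h1, h6, h⟩
          · exact Or.inl h
        · rintro (h | ⟨i', h1, h2, h⟩)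
          · exact ⟨i, hi, le_rfl, h⟩
          · exact ⟨i', h1, h2.le, h⟩
      rw [wp_guard]
      constructor
      · intro hall
        simp [Expr.val, h3', hreg, hs, hl, e9, h5] at hall
        refine ⟨fun x hx hx' => ?_, h4.trans harr.symm, ?_⟩
        · dsimp only
          rw [Function.update_of_ne (by omega), h3' x hx]
        · rw [if_pos (hstep.2 (Or.inl ⟨hall.1, hall.2.1, by push_cast; exact hall.2.2⟩))]
          simp [Expr.val]
      · intro hall
        refine ⟨fun x hx hx' => h3' x hx, h4.trans harr.symm, ?_⟩
        have : ¬ (I.r s ≤ I.r i ∧ I.Tight k l i) := by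
          rintro ⟨h1, h2, h6⟩
          push_cast at h6
          apply hall
          simp [Expr.val, h3', hreg, hs, hl, e9, h5]
          exact ⟨h1, h2, h6⟩
        rw [h3' 7 (by omega), h7']
        refine if_congr ?_ rfl rfl
        rw [hstep]
        simp [this]

/-- Fill array `7` with the information which pairs are crowded. -/
def crowdedStage : Prog :=
  .for 3 (const 1) (sub (reg 2) (const 1)) (.for 4 (const 1) (reg 0) (block [
    load 5 0 [reg 3],
    load 6 0 [reg 4],
    assign 7 (const 0),
    crowdedLoop,
    store 7 [reg 4, reg 3] (reg 7)]))

open Classical in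
theorem wp_crowdedStage {m : Mem} {k : ℕ} (hm : I.Data m)
    (hk1 : 1 ≤ k) (hkn : k ≤ I.n) (hk : m.reg 2 = k) :
    crowdedStage.wp I.n (fun m' => Upd m m' 3 7 {idx | ∃ l, 1 ≤ l ∧ l < k ∧
        idx ∈ {idx | ∃ s, 1 ≤ s ∧ s < I.n + 1 ∧ idx ∈ ({[(s : ℤ), (l : ℤ)]} : Set (List ℤ))}}
      (fun idx v => ∀ s l : ℕ, idx = [(s : ℤ), (l : ℤ)] →
        v = if I.Crowded k s l then 1 else 0)) m := by
  refine wp_fill (A := 1) (B := k) _ _ (by simp [Expr.val]) (by omega) (by omega)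
    (fun m' h => by simp [Expr.val, h, hk]) fun l m₁ hl1 hlk h₁ hl => ?_
  refine wp_fill (A := 1) (B := I.n + 1) (fun s => {[(s : ℤ), (l : ℤ)]}) _ (by simp [Expr.val])
    (by omega) (by omega) (fun m' h => by simp [Expr.val, h, h₁.reg, hm.n]) fun s m₂ hs1 hsn h₂ hs => ?_
  have hl₂ : m₂.reg 3 = l := (h₂.reg 3 (by omega)).trans hl
  have hk₂ : m₂.reg 2 = k := by rw [h₂.reg 2 (by omega), h₁.reg 2 (by omega), hk]
  have hm₂ : I.Data m₂ := (hm.of_upd h₁ (by omega) (by omega)).of_upd h₂ (by omega) (by omega)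
  simp [block, wp, Expr.val, hs, hl₂, hm₂.r l hl1 (by omega), hm₂.r s hs1 (by omega)]
  refine wp.mono (wp_crowdedLoop (k := k) (s := s) (l := l) ?_ hk1 hkn ?_ ?_ ?_ ?_) ?_
  · exact hm₂.of_eq (by simp) rfl
  · simp [hk₂]
  · simp
  · simp
  · simp
  · rintro m₃ ⟨h3, h4, h5⟩
    have e3 : m₃.reg 3 = l := by rw [h3 3 (by omega) (by omega)]; simp [hl₂]
    have e4 : m₃.reg 4 = s := by rw [h3 4 (by omega) (by omega)]; simp [hs]
    rw [e3, e4]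
    refine Upd.of_store (fun x hx => ?_) h4 ?_
    · rw [h3 x (by omega) (by omega)]
      dsimp only
      repeat rw [Function.update_of_ne (by omega)]
    · intro s' g' heq
      simp only [List.cons.injEq, Nat.cast_inj, and_true] at heq
      obtain ⟨rfl, rfl⟩ := heq
      exact h5

end Jobs


/-! ### The program: the table `P` -/

open GapSched.Expr GapSched.Prog

namespace Jobs

variable {I : Jobs}

/-- Compute the minimum in the recurrence for `P[s,k,g,l]` in register `11`. -/
def minLoop : Prog :=
  .for 12 (const 0) (reg 5) (block [
    load 13 3 [reg 6, sub (reg 2) (const 1), reg 12],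
    load 14 6 [reg 6, reg 12],
    load 15 0 [reg 14],
    load 16 4 [reg 14, reg 2, sub (reg 5) (reg 12), reg 3],
    guard [(add (reg 13) (const 1), reg 15), (reg 15, reg 7), (reg 8, reg 13), (const 0, reg 16)]
      (block [
        assign 17 (add (sub (reg 15) (reg 13)) (reg 16)),
        ite (const 0) (reg 11) (ite (reg 11) (reg 17) skip (assign 11 (reg 17)))
          (assign 11 (reg 17))])])

/-- Since `+∞` is stored as `-1`, a minimum requires a test of the sign. -/
theorem encode_min {x : ℕ∞} {w : ℕ} : encode (min (w : ℕ∞) x) =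
    if 0 ≤ encode x then if encode x ≤ w then encode x else w else w := by
  rcases encode_nonneg_or x with ⟨rfl, h⟩ | ⟨m, rfl, h⟩
  · simp
  · rw [show min (w : ℕ∞) (m : ℕ∞) = ((min w m : ℕ) : ℕ∞) from (Nat.mono_cast.map_min).symm, encode_natCast, encode_natCast]
    split_ifs <;> omega

/-- The entry of array `4` is assumed to be correct only when the first three guards hold. In the
other cases the cell that is read may be arbitrary, and its value is discarded. -/
theorem wp_minLoop {N : ℕ} {m : Mem} {s k g l : ℕ} {rl rk : ℤ} {u nv : ℕ → ℤ} {j : ℕ → ℕ}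
    {c : ℕ → ℕ∞} (hgN : g < N) (hk : m.reg 2 = k) (hl : m.reg 3 = l) (hg : m.reg 5 = g)
    (hs : m.reg 6 = s) (hrl : m.reg 7 = rl) (hrk : m.reg 8 = rk) (h11 : m.reg 11 = -1)
    (hu : ∀ h ≤ g, m.arr 3 [(s : ℤ), (k : ℤ) - 1, (h : ℤ)] = u h)
    (hj : ∀ h ≤ g, m.arr 6 [(s : ℤ), (h : ℤ)] = j h)
    (hnv : ∀ h ≤ g, m.arr 0 [(j h : ℤ)] = nv h)
    (hc : ∀ h ≤ g, u h + 1 ≤ nv h → nv h ≤ rl → rk ≤ u h →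
      m.arr 4 [(j h : ℤ), (k : ℤ), (g : ℤ) - (h : ℤ), (l : ℤ)] = encode (c h)) :
    minLoop.wp N (fun m' => (∀ y < 12, y ≠ 11 → m'.reg y = m.reg y) ∧ m'.arr = m.arr ∧
      m'.reg 11 = encode ((Finset.range (g + 1)).inf fun h =>
        if u h + 1 ≤ nv h ∧ nv h ≤ rl ∧ rk ≤ u h then ((nv h - u h).toNat : ℕ∞) + c h else ⊤)) m := by
  refine wp_fold (A := 0) (B := g + 1) (fun i v => v = encode ((Finset.range i).inf fun h =>
        if u h + 1 ≤ nv h ∧ nv h ≤ rl ∧ rk ≤ u h then ((nv h - u h).toNat : ℕ∞) + c h else ⊤))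
    (by norm_num) (by simp [Expr.val]) (by omega) (by omega)
    (fun m' h => by simp [Expr.val, h, hg]) (by simp [h11]) ?_
  intro h m' _ hhg hreg harr h12 h11'
  have e1 := hu h (by omega)
  have e2 := hj h (by omega)
  have e3 := hnv h (by omega)
  have e4 := hc h (by omega)
  rw [← harr] at e1 e2 e3 e4
  rw [Finset.range_add_one, Finset.inf_insert]
  set x := (Finset.range h).inf fun h =>
        if u h + 1 ≤ nv h ∧ nv h ≤ rl ∧ rk ≤ u h then ((nv h - u h).toNat : ℕ∞) + c h else ⊤
  simp only [block, wp]
  rw [wp_guard]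
  constructor
  · intro hall
    simp [Expr.val, hreg, hk, hl, hg, hs, hrl, hrk, h12, e1, e2, e3] at hall
    obtain ⟨h1, h2, h3, h4⟩ := hall
    have e4' := e4 (by omega) h2 h3
    rw [e4'] at h4
    obtain ⟨q, hq, hq'⟩ : ∃ q : ℕ, c h = q ∧ encode (c h) = q := by
      rcases encode_nonneg_or (c h) with ⟨-, h5⟩ | h5
      · omega
      · exact h5
    rw [if_pos ⟨by omega, h2, h3⟩, hq, ← Nat.cast_add]
    simp [wp, Expr.val, hreg, hk, hl, hg, hs, h12, e1, e2, e3, e4', hq', h11']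
    have hw : (((nv h - u h).toNat + q : ℕ) : ℤ) = nv h - u h + q := by omega
    have hmin := encode_min (x := x) (w := (nv h - u h).toNat + q)
    rw [hw] at hmin
    push_cast at hmin
    rw [hmin]
    refine ⟨fun h5 => ⟨fun h6 => ⟨fun x hx hx' => ?_, ?_⟩, fun h6 => ⟨fun x hx hx' => ?_, ?_⟩⟩,
      fun h5 => ⟨fun x hx hx' => ?_, ?_⟩⟩
    · repeat rw [Function.update_of_ne (by omega)]
    · rw [if_pos h5, if_pos h6]
    · repeat rw [Function.update_of_ne (by omega)]
    · rw [if_pos h5, if_neg (by omega)]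
    · repeat rw [Function.update_of_ne (by omega)]
    · rw [if_neg (by omega)]
  · intro hall
    refine ⟨fun x hx hx' => ?_, rfl, ?_⟩
    · dsimp only
      repeat rw [Function.update_of_ne (by omega)]
    · have : (if u h + 1 ≤ nv h ∧ nv h ≤ rl ∧ rk ≤ u h then
          ((nv h - u h).toNat : ℕ∞) + c h else ⊤) = ⊤ := by
        split_ifs with hC
        · rcases encode_nonneg_or (c h) with ⟨h5, -⟩ | ⟨q, -, h5⟩
          · simp [h5]
          · exfalso
            apply hall
            have e4' := e4 hC.1 hC.2.1 hC.2.2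
            simp [Expr.val, hreg, hk, hl, hg, hs, hrl, hrk, h12, e1, e2, e3, e4', h5]
            omega
        · rfl
      rw [this, top_inf_eq]
      simpa using h11'

/-- Compute `P[s,k,g,l]` in register `11`. -/
def amountEntry : Prog :=
  block [
    load 6 5 [reg 4],
    load 7 0 [reg 3],
    load 8 0 [reg 2],
    load 9 7 [reg 6, reg 3],
    load 10 3 [reg 6, sub (reg 2) (const 1), reg 5],
    assign 11 (const (-1)),
    ite (const 1) (reg 9) skip (ite (reg 7) (reg 10) (assign 11 (const 0)) minLoop)]

/-- Fill the part of array `4` for job `k`. -/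
def amountStage : Prog :=
  .for 3 (const 1) (sub (reg 2) (const 1)) (.for 4 (const 0) (sub (reg 0) (const 1))
    (.for 5 (const 0) (sub (reg 0) (const 1)) (block [
      amountEntry,
      store 4 [reg 6, reg 2, reg 5, reg 3] (reg 11)])))

-- For fixed `l`, the jobs `s` are treated by increasing rank, that is, by decreasing release time.
-- So the entries for jobs `j` with `r_j > r_s` that the recurrence calls for are ready.
open Classical in
theorem wp_amountStage {m : Mem} {k : ℕ} (hI : I.Normalized) (hm : I.Data m)
    (hk1 : 1 ≤ k) (hkn : k ≤ I.n) (hk : m.reg 2 = k) (hd : m.arr 0 [0] = I.d k)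
    {V : ℕ → ℕ → WithBot ℤ} {u : ℕ → ℕ → ℤ} {nx : ℕ → ℕ → ℕ}
    (hV : ∀ s g, 1 ≤ s → s ≤ I.n → g < I.n → V s g = u s g)
    (hu : ∀ s g, 1 ≤ s → s ≤ I.n → g < I.n → I.r s ≤ u s g)
    (hnx : ∀ s g, 1 ≤ s → s ≤ I.n → g < I.n → I.IsNext k (u s g) (nx s g))
    (hord : ∀ s, 1 ≤ s → s ≤ I.n → m.arr 5 [(I.rank s : ℤ)] = s)
    (h3 : ∀ s g : ℕ, 1 ≤ s → s ≤ I.n → g < I.n → m.arr 3 [(s : ℤ), (k : ℤ) - 1, (g : ℤ)] = u s g)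
    (h6 : ∀ s g : ℕ, 1 ≤ s → s ≤ I.n → g < I.n → m.arr 6 [(s : ℤ), (g : ℤ)] = nx s g)
    (h7 : ∀ s l : ℕ, 1 ≤ s → s ≤ I.n → 1 ≤ l → l < k →
      m.arr 7 [(s : ℤ), (l : ℤ)] = if I.Crowded k s l then 1 else 0) :
    amountStage.wp I.n (fun m' => Upd m m' 3 4 {idx | ∃ l, 1 ≤ l ∧ l < k ∧
        idx ∈ {idx | ∃ x, 0 ≤ x ∧ x < I.n ∧ idx ∈ {idx | ∃ s g, 1 ≤ s ∧ s ≤ I.n ∧ I.rank s = x ∧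
          g < I.n ∧ idx = [(s : ℤ), (k : ℤ), (g : ℤ), (l : ℤ)]}}}
      (fun idx v => ∀ s g l : ℕ, 1 ≤ s → s ≤ I.n → g < I.n →
        idx = [(s : ℤ), (k : ℤ), (g : ℤ), (l : ℤ)] → v = encode (I.stepP k V l s g))) m := by
  refine wp_fill (A := 1) (B := k) _ _ (by simp [Expr.val]) (by omega) (by omega)
    (fun m' h => by simp [Expr.val, h, hk]) fun l m₁ hl1 hlk h₁ hl => ?_
  refine wp_fill (A := 0) (B := I.n) (fun x => {idx | ∃ s g, 1 ≤ s ∧ s ≤ I.n ∧ I.rank s = x ∧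
          g < I.n ∧ idx = [(s : ℤ), (k : ℤ), (g : ℤ), (l : ℤ)]}) _ (by simp [Expr.val])
    (by omega) (by omega) (fun m' h => by simp [Expr.val, h, h₁.reg, hm.n]) fun x m₂ _ hx h₂ hx₂ => ?_
  obtain ⟨s, hs1, hsn, rfl⟩ := hI.exists_rank_eq hx
  have hset : {idx | ∃ s' g, 1 ≤ s' ∧ s' ≤ I.n ∧ I.rank s' = I.rank s ∧
      g < I.n ∧ idx = [(s' : ℤ), (k : ℤ), (g : ℤ), (l : ℤ)]} =
      {idx | ∃ g, 0 ≤ g ∧ g < I.n ∧ idx ∈ ({[(s : ℤ), (k : ℤ), (g : ℤ), (l : ℤ)]} : Set (List ℤ))} := by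
    ext idx
    constructor
    · rintro ⟨s', g, h1, h2, h3, h4, rfl⟩
      obtain rfl := hI.rank_injOn ⟨h1, h2⟩ ⟨hs1, hsn⟩ h3
      exact ⟨g, by omega, h4, rfl⟩
    · rintro ⟨g, -, h4, rfl⟩
      exact ⟨s, g, hs1, hsn, rfl, h4, rfl⟩
  rw [hset]
  have hl₂ : m₂.reg 3 = l := (h₂.reg 3 (by omega)).trans hl
  have hk₂ : m₂.reg 2 = k := by rw [h₂.reg 2 (by omega), h₁.reg 2 (by omega), hk]
  refine wp_fill (A := 0) (B := I.n) (fun g => {[(s : ℤ), (k : ℤ), (g : ℤ), (l : ℤ)]}) _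
    (by simp [Expr.val]) (by omega) (by omega) (fun m' h => by simp [Expr.val, h, h₂.reg, h₁.reg, hm.n])
    fun g m₃ _ hgn h₃ hg₃ => ?_
  have hm₃ : I.Data m₃ := ((hm.of_upd h₁ (by omega) (by omega)).of_upd h₂ (by omega)
    (by omega)).of_upd h₃ (by omega) (by omega)
  have hl₃ : m₃.reg 3 = l := (h₃.reg 3 (by omega)).trans hl₂
  have hk₃ : m₃.reg 2 = k := (h₃.reg 2 (by omega)).trans hk₂
  have hx₃ : m₃.reg 4 = I.rank s := (h₃.reg 4 (by omega)).trans hx₂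
  have harr : ∀ a, a ≠ 4 → m₃.arr a = m.arr a := fun a ha => by
    rw [h₃.other a ha, h₂.other a ha, h₁.other a ha]
  have hord₃ : m₃.arr 5 [(I.rank s : ℤ)] = s := by rw [harr 5 (by omega), hord s hs1 hsn]
  have hu₃ : ∀ h ≤ g, m₃.arr 3 [(s : ℤ), (k : ℤ) - 1, (h : ℤ)] = u s h := fun h hh => by
    rw [harr 3 (by omega), h3 s h hs1 hsn (by omega)]
  have hj₃ : ∀ h ≤ g, m₃.arr 6 [(s : ℤ), (h : ℤ)] = nx s h := fun h hh => by
    rw [harr 6 (by omega), h6 s h hs1 hsn (by omega)]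
  have hb₃ : m₃.arr 7 [(s : ℤ), (l : ℤ)] = if I.Crowded k s l then 1 else 0 := by
    rw [harr 7 (by omega), h7 s l hs1 hsn hl1 hlk]
  have hnv₃ : ∀ h ≤ g, m₃.arr 0 [(nx s h : ℤ)] = I.nextVal k (nx s h) := fun h hh => by
    rw [nextVal]
    rcases hnx s h hs1 hsn (by omega) with ⟨h1, -⟩ | ⟨h1, h2, -⟩
    · rw [if_pos h1, h1, harr 0 (by omega)]
      exact hd
    · rw [if_neg (by omega), hm₃.r _ h1 (by omega)]
  -- The next job is released after `s`, so its rank is smaller and its entry stems from an earlier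
  -- round of the middle loop; the current inner loop writes only to entries of `s`. The sentinel
  -- `d_k` cannot occur, as it exceeds `r_l`.
  have hc₃ : ∀ h ≤ g, u s h + 1 ≤ I.nextVal k (nx s h) → I.nextVal k (nx s h) ≤ I.r l →
      I.r k ≤ u s h → m₃.arr 4 [(nx s h : ℤ), (k : ℤ), (g : ℤ) - (h : ℤ), (l : ℤ)] =
        encode (I.stepP k V l (nx s h) (g - h)) := fun h hh h8 h9 _ => by
    have hld := hI.r_lt_d hl1 hlk.le hkn
    have hus := hu s h hs1 hsn (by omega)
    rw [nextVal] at h8 h9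
    rcases hnx s h hs1 hsn (by omega) with ⟨h1, -⟩ | ⟨h1, h2, -⟩
    · rw [if_pos h1] at h9
      omega
    · rw [if_neg (by omega)] at h8 h9
      have hlt : I.rank (nx s h) < I.rank s := rank_lt_rank h1 (by omega) (by omega)
      rw [← Nat.cast_sub hh, h₃.out]
      · exact h₂.mem _ ⟨_, by omega, hlt, _, _, h1, by omega, rfl, by omega, rfl⟩ _ _ _ h1 (by omega)
          (by omega) rfl
      · rintro ⟨g', -, -, heq⟩
        simp only [Set.mem_singleton_iff, List.cons.injEq, Nat.cast_inj] at heq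
        rw [heq.1] at hlt
        omega
  have heq := hI.stepP_eq_ite hkn hl1 hlk hs1 hsn hgn hV hu hnx
  have hentry : amountEntry.wp I.n (fun m' => (∀ y < 6, m'.reg y = m₃.reg y) ∧ m'.reg 6 = s ∧
      m'.arr = m₃.arr ∧ m'.reg 11 = encode (I.stepP k V l s g)) m₃ := by
    simp [amountEntry, block, wp, Expr.val, hx₃, hl₃, hk₃, hg₃, hord₃, hb₃, hu₃ g le_rfl,
      hm₃.r l hl1 (by omega), hm₃.r k hk1 hkn]
    refine ⟨fun h8 => ⟨fun y hy => ?_, ?_⟩, fun h8 => ⟨fun h9 => ⟨fun y hy => ?_, ?_⟩, fun h9 => ?_⟩⟩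
    · repeat rw [Function.update_of_ne (by omega)]
    · rw [heq, if_pos (by by_contra h; simp [h] at h8), encode_top]
    · repeat rw [Function.update_of_ne (by omega)]
    · rw [heq, if_neg (by intro h; simp [h] at h8), if_pos h9]
      exact (encode_natCast 0).symm
    · rw [heq, if_neg (by intro h; simp [h] at h8), if_neg (by omega)]
      refine wp.mono (wp_minLoop (s := s) (k := k) (g := g) (l := l) (rl := I.r l) (rk := I.r k)
        hgn (by simp [hk₃]) (by simp [hl₃]) (by simp [hg₃]) (by simp) (by simp) (by simp) (by simp)
        hu₃ hj₃ hnv₃ hc₃) ?_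
      rintro m₄ ⟨h10, h11, h12⟩
      refine ⟨fun y hy => ?_, ?_, h11, h12⟩
      · rw [h10 y (by omega) (by omega)]
        dsimp only
        repeat rw [Function.update_of_ne (by omega)]
      · rw [h10 6 (by omega) (by omega)]
        simp
  simp only [block, wp]
  refine hentry.mono fun m' ⟨hr, hr6, ha, hv⟩ => ?_
  simp only [Expr.val, List.map, hr6, hr 2 (by omega), hr 3 (by omega), hr 5 (by omega), hk₃, hl₃,
    hg₃]
  refine Upd.of_store hr ha ?_
  intro s' g' l' _ _ _ heq'
  simp only [List.cons.injEq, Nat.cast_inj, and_true, true_and] at heq'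
  obtain ⟨rfl, rfl, rfl⟩ := heq'
  exact hv

end Jobs


/-! ### The program: options for the pairs `(l,h)` -/

open GapSched.Expr GapSched.Prog

namespace Jobs

variable {I : Jobs}

/-- Raise register `7` to the maximum of the options for a pair `(l,h)`. -/
def raiseOpt : Prog :=
  block [
    load 15 3 [reg 11, sub (reg 2) (const 1), sub (reg 4) (reg 12)],
    load 16 6 [reg 11, sub (reg 4) (reg 12)],
    load 17 0 [reg 16],
    load 18 3 [reg 11, sub (reg 2) (const 1), sub (sub (reg 4) (reg 12)) (const 1)],
    load 19 6 [reg 11, sub (sub (reg 4) (reg 12)) (const 1)],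
    load 20 0 [reg 19],
    assign 21 (sub (reg 9) (reg 14)),
    guard [(reg 14, reg 9), (add (add (reg 15) (reg 21)) (const 1), reg 8), (reg 5, reg 15),
      (add (reg 15) (reg 21), reg 17)] (raise 7 (add (reg 15) (reg 21))),
    guard [(add (reg 14) (const 1), reg 9), (sub (reg 8) (reg 15), reg 21), (reg 8, reg 17)]
      (raise 7 (reg 8)),
    guard [(add (reg 12) (const 1), reg 4), (add (reg 14) (const 1), reg 9),
      (add (add (reg 18) (reg 21)) (const 1), reg 8), (reg 8, reg 20)] (raise 7 (reg 8))]

/-- For `h = g` the program reads cells with index `-1`. Their content is irrelevant, because the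
last guard contains the test `h + 1 ≤ g`. -/
theorem wp_raiseOpt {N : ℕ} {m : Mem} {k g l h q : ℕ} {u : ℕ → ℤ} {nx : ℕ → ℕ}
    {V : ℕ → WithBot ℤ} (hhg : h ≤ g) (hk : m.reg 2 = k) (hg : m.reg 4 = g) (hr : m.reg 5 = I.r k)
    (hd : m.reg 8 = I.d k) (hp : m.reg 9 = I.p k) (hl : m.reg 11 = l) (hh : m.reg 12 = h)
    (hq : m.reg 14 = q) (hV : ∀ h ≤ g, V h = u h) (hnx : ∀ h ≤ g, I.IsNext k (u h) (nx h))
    (hu : ∀ h ≤ g, m.arr 3 [(l : ℤ), (k : ℤ) - 1, (h : ℤ)] = u h)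
    (hj : ∀ h ≤ g, m.arr 6 [(l : ℤ), (h : ℤ)] = nx h)
    (hnv : ∀ h ≤ g, m.arr 0 [(nx h : ℤ)] = I.nextVal k (nx h)) :
    raiseOpt.wp N (fun m' => (∀ y < 15, y ≠ 7 → m'.reg y = m.reg y) ∧ m'.arr = m.arr ∧
      (m'.reg 7 : WithBot ℤ) = max (m.reg 7 : WithBot ℤ) (I.optU k g h q V)) m := by
  have e : (g : ℤ) - (h : ℤ) = ((g - h : ℕ) : ℤ) := by omega
  have h1 := hu (g - h) (by omega)
  have h2 := hj (g - h) (by omega)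
  have h3 := hnv (g - h) (by omega)
  rw [optU_eq (hV (g - h) (by omega)) (hnx (g - h) (by omega))
    (fun _ => hV (g - h - 1) (by omega)) (fun _ => hnx (g - h - 1) (by omega))]
  simp only [raiseOpt, block, wp]
  refine wp_guard_raise _ fun v₁ hv₁ => wp_guard_raise _ fun v₂ hv₂ =>
    wp_guard_raise _ fun v₃ hv₃ => ?_
  simp [Expr.val, hk, hg, hr, hd, hp, hl, hh, hq, e, h1, h2, h3] at hv₁ hv₂ hv₃
  refine ⟨fun y hy hy' => ?_, rfl, ?_⟩
  · dsimp only
    repeat rw [Function.update_of_ne (by omega)]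
  · simp only [Function.update_self]
    rw [hv₃, hv₂, hv₁, max_assoc, max_assoc]
    congr 1
    congr 1
    · exact if_congr (by omega) (WithBot.coe_add _ _).symm rfl
    · congr 1
      · exact if_congr (by omega) rfl rfl
      · by_cases hlt : h < g
        · have e' : ((g - h : ℕ) : ℤ) - 1 = ((g - h - 1 : ℕ) : ℤ) := by omega
          rw [e', hu (g - h - 1) (by omega), hj (g - h - 1) (by omega), hnv (g - h - 1) (by omega)]
          exact if_congr (by omega) rfl rfl
        · rw [if_neg (fun h' => hlt h'.1), if_neg (fun h' => hlt (by omega))]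

theorem optU_le_stepU {k s g l h : ℕ} {V : ℕ → ℕ → WithBot ℤ} (hsk : I.r s ≤ I.r k) (hl1 : 1 ≤ l)
    (hlk : l < k) (hsl : I.r s ≤ I.r l) (hhg : h ≤ g) :
    I.optU k g h (I.stepP k V l s h) (V l) ≤ I.stepU k V s g := by
  rw [stepU, if_neg (not_lt.2 hsk)]
  refine le_max_of_le_right (le_max_of_le_left ?_)
  refine le_trans ?_ (Finset.le_sup (Finset.mem_range.2 (Nat.lt_succ_of_le hhg)))
  exact Finset.le_sup (f := fun l => I.optU k g h (I.stepP k V l s h) (V l))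
    (Finset.mem_filter.2 ⟨Finset.mem_Ico.2 ⟨hl1, hlk⟩, hsl⟩)

/-- Raise register `7` to the maximum of the options for all pairs `(l,h)` with `l < k`. -/
def pairLoop : Prog :=
  .for 11 (const 1) (sub (reg 2) (const 1)) (block [
    load 13 0 [reg 11],
    guard [(reg 6, reg 13)] (.for 12 (const 0) (reg 4) (block [
      load 14 4 [reg 3, reg 2, reg 12, reg 11],
      guard [(const 0, reg 14)] raiseOpt]))])

/-- The loops run through the pairs in another order than the definition of `stepU`. So the register
is not tracked as a partial maximum but enclosed: it never exceeds the final value `W`, and it is at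
least every option treated so far. -/
theorem wp_pairLoop {m : Mem} {k s g : ℕ} {W : ℤ} {V : ℕ → ℕ → WithBot ℤ} {u : ℕ → ℕ → ℤ}
    {nx : ℕ → ℕ → ℕ} (hm : I.Data m) (hk1 : 1 ≤ k) (hkn : k ≤ I.n) (hgn : g < I.n)
    (hk : m.reg 2 = k) (hs : m.reg 3 = s) (hg : m.reg 4 = g) (hrk : m.reg 5 = I.r k)
    (hrs : m.reg 6 = I.r s) (hd : m.reg 8 = I.d k) (hp : m.reg 9 = I.p k)
    (h0 : m.arr 0 [0] = I.d k) (hsk : I.r s ≤ I.r k)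
    (hV : ∀ s g, 1 ≤ s → s ≤ I.n → g < I.n → V s g = u s g)
    (hnx : ∀ s g, 1 ≤ s → s ≤ I.n → g < I.n → I.IsNext k (u s g) (nx s g))
    (h3 : ∀ s g : ℕ, 1 ≤ s → s ≤ I.n → g < I.n → m.arr 3 [(s : ℤ), (k : ℤ) - 1, (g : ℤ)] = u s g)
    (h6 : ∀ s g : ℕ, 1 ≤ s → s ≤ I.n → g < I.n → m.arr 6 [(s : ℤ), (g : ℤ)] = nx s g)
    (h4 : ∀ l h : ℕ, 1 ≤ l → l < k → h < I.n →
      m.arr 4 [(s : ℤ), (k : ℤ), (h : ℤ), (l : ℤ)] = encode (I.stepP k V l s h))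
    (hW : I.stepU k V s g = W) (h7 : m.reg 7 ≤ W) :
    pairLoop.wp I.n (fun m' => (∀ y < 11, y ≠ 7 → m'.reg y = m.reg y) ∧ m'.arr = m.arr ∧
      m'.reg 7 ≤ W ∧ m.reg 7 ≤ m'.reg 7 ∧ ∀ l h, 1 ≤ l → l < k → h ≤ g → I.r s ≤ I.r l →
        I.optU k g h (I.stepP k V l s h) (V l) ≤ (m'.reg 7 : WithBot ℤ)) m := by
  refine wp_fold (A := 1) (B := k) (fun i v => v ≤ W ∧ m.reg 7 ≤ v ∧
      ∀ l h, 1 ≤ l → l < i → h ≤ g → I.r s ≤ I.r l →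
        I.optU k g h (I.stepP k V l s h) (V l) ≤ (v : WithBot ℤ))
    (by norm_num) (by simp [Expr.val]) hk1 (by omega) (fun m' h => by simp [Expr.val, h, hk])
    ⟨h7, le_rfl, by omega⟩ ?_
  rintro l m₁ hl1 hlk hreg harr hl ⟨hv1, hv2, hv3⟩
  have hrl : m₁.arr 0 [(l : ℤ)] = I.r l := by rw [harr, hm.r l hl1 (by omega)]
  simp only [block, wp]
  rw [wp_guard]
  simp only [Expr.val, List.map, hl, hrl]
  refine ⟨fun hsl => ?_, fun hsl => ?_⟩
  · simp [Expr.val, hreg, hrs] at hsl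
    refine wp.mono (wp_fold (a := 7) (A := 0) (B := g + 1) (fun i v => v ≤ W ∧ m₁.reg 7 ≤ v ∧
      ∀ h < i, I.optU k g h (I.stepP k V l s h) (V l) ≤ (v : WithBot ℤ)) (by norm_num) (by simp [Expr.val])
      (by omega) (by omega) (fun m' h => by simp [Expr.val, h, hreg, hg])
      ⟨by simpa using hv1, by simp, by omega⟩ ?_) ?_
    · rintro h m₂ - hhg hreg₂ harr₂ hh ⟨hw1, hw2, hw3⟩
      dsimp only at harr₂
      have hreg' : ∀ y < 12, y ≠ 7 → m₂.reg y = m₁.reg y := by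
        intro y hy hy'
        rw [hreg₂ y hy hy']
        dsimp only
        repeat rw [Function.update_of_ne (by omega)]
      have hl₂ : m₂.reg 11 = l := by rw [hreg' 11 (by omega) (by omega), hl]
      have hq : m₂.arr 4 [(s : ℤ), (k : ℤ), (h : ℤ), (l : ℤ)] = encode (I.stepP k V l s h) := by
        rw [harr₂, harr, h4 l h hl1 hlk (by omega)]
      have hstep := optU_le_stepU (V := V) hsk hl1 hlk hsl (h := h) (g := g) (by omega)
      rw [hW] at hstep
      simp only [wp]
      rw [wp_guard]
      simp [Expr.val, hreg', hreg, hk, hs, hl, hh, hq]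
      rcases encode_nonneg_or (I.stepP k V l s h) with ⟨e1, e2⟩ | ⟨q, e1, e2⟩
      · rw [e2]
        refine ⟨by omega, fun _ => ⟨fun y hy hy' => ?_, hw1, hw2, fun h' hh' => ?_⟩⟩
        · repeat rw [Function.update_of_ne (by omega)]
        · rcases hh'.lt_or_eq with hlt | rfl
          · exact hw3 h' hlt
          · rw [e1, optU_top]
            exact bot_le
      · rw [e2]
        refine ⟨fun _ => ?_, by omega⟩
        refine wp.mono (wp_raiseOpt (k := k) (g := g) (l := l) (h := h) (q := q) (u := u l)
          (nx := nx l) (V := V l) (by omega)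
          (by simp [hreg', hreg, hk]) (by simp [hreg', hreg, hg]) (by simp [hreg', hreg, hrk])
          (by simp [hreg', hreg, hd]) (by simp [hreg', hreg, hp]) (by simp [hl₂]) (by simp [hh])
          (by simp) (fun h' hh' => hV l h' hl1 (by omega) (by omega))
          (fun h' hh' => hnx l h' hl1 (by omega) (by omega)) (fun h' hh' => ?_) (fun h' hh' => ?_)
          (fun h' hh' => ?_)) ?_
        · simp only [harr₂, harr]
          exact h3 l h' hl1 (by omega) (by omega)
        · simp only [harr₂, harr]
          exact h6 l h' hl1 (by omega) (by omega)
        · simp only [harr₂, harr]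
          rw [nextVal]
          rcases hnx l h' hl1 (by omega) (by omega) with ⟨h1, -⟩ | ⟨h1, h2, -⟩
          · rw [if_pos h1, h1]
            exact h0
          · rw [if_neg (by omega), hm.r _ h1 (by omega)]
        · rintro m₃ ⟨f1, f2, f3⟩
          rw [← e1] at f3
          simp at f3
          refine ⟨fun y hy hy' => ?_, f2, ?_, ?_, fun h' hh' => ?_⟩
          · rw [f1 y (by omega) hy']
            dsimp only
            repeat rw [Function.update_of_ne (by omega)]
          · rw [← WithBot.coe_le_coe, f3]
            exact max_le (WithBot.coe_le_coe.2 hw1) hstep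
          · rw [← WithBot.coe_le_coe, f3]
            exact le_max_of_le_left (WithBot.coe_le_coe.2 (by simpa using hw2))
          · rw [f3]
            rcases hh'.lt_or_eq with hlt | rfl
            · exact le_max_of_le_left (hw3 h' hlt)
            · exact le_max_right _ _
    · rintro m₂ ⟨g1, g2, g3, g4, g5⟩
      refine ⟨fun y hy hy' => ?_, g2, g3, hv2.trans (by simpa using g4), fun l' h hl' hll' hh hsl' => ?_⟩
      · rw [g1 y (by omega) hy']
        dsimp only
        repeat rw [Function.update_of_ne (by omega)]
      · rcases Nat.lt_succ_iff_lt_or_eq.1 hll' with hlt | rfl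
        · exact (hv3 l' h hl' hlt hh hsl').trans (WithBot.coe_le_coe.2 (by simpa using g4))
        · exact g5 h (by omega)
  · simp [Expr.val, hreg, hrs] at hsl
    refine ⟨fun y hy hy' => ?_, trivial, hv1, hv2, fun l' h hl' hll' hh hsl' => ?_⟩
    · repeat rw [Function.update_of_ne (by omega)]
    · rcases Nat.lt_succ_iff_lt_or_eq.1 hll' with hlt | rfl
      · exact hv3 l' h hl' hlt hh hsl'
      · omega

end Jobs


/-! ### The program: the table `U` -/

open GapSched.Expr GapSched.Prog

namespace Jobs

variable {I : Jobs}

theorem le_stepU {k s g : ℕ} {V : ℕ → ℕ → WithBot ℤ} (hsk : I.r s ≤ I.r k)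
    (h : V s g < (I.r k : WithBot ℤ)) : V s g ≤ I.stepU k V s g := by
  rw [stepU, if_neg (not_lt.2 hsk), if_pos h]
  exact le_max_left _ _

theorem optU_zero_le_stepU {k s g : ℕ} {V : ℕ → ℕ → WithBot ℤ} (hsk : I.r s ≤ I.r k)
    (h : k ≤ s) : I.optU k g 0 0 (V s) ≤ I.stepU k V s g := by
  rw [stepU, if_neg (not_lt.2 hsk), if_pos h]
  exact le_max_of_le_right (le_max_right _ _)

theorem stepU_le {k s g : ℕ} {V : ℕ → ℕ → WithBot ℤ} {c : WithBot ℤ} (hsk : I.r s ≤ I.r k)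
    (h1 : V s g < (I.r k : WithBot ℤ) → V s g ≤ c)
    (h2 : ∀ l h, 1 ≤ l → l < k → h ≤ g → I.r s ≤ I.r l →
      I.optU k g h (I.stepP k V l s h) (V l) ≤ c)
    (h3 : k ≤ s → I.optU k g 0 0 (V s) ≤ c) : I.stepU k V s g ≤ c := by
  rw [stepU, if_neg (not_lt.2 hsk)]
  refine max_le ?_ (max_le (Finset.sup_le fun h hh => Finset.sup_le fun l hl => ?_) ?_)
  · split_ifs with h
    · exact h1 h
    · exact bot_le
  · rw [Finset.mem_filter, Finset.mem_Ico] at hl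
    exact h2 l h hl.1.1 hl.1.2 (Nat.lt_succ_iff.1 (Finset.mem_range.1 hh)) hl.2
  · split_ifs with h
    · exact h3 h
    · exact bot_le

/-- Compute `U[s,k,g]` in register `7`. -/
def optEntry : Prog :=
  block [
    load 5 0 [reg 2],
    load 6 0 [reg 3],
    load 8 1 [reg 2],
    load 9 2 [reg 2],
    load 10 3 [reg 3, sub (reg 2) (const 1), reg 4],
    ite (add (reg 5) (const 1)) (reg 6) (assign 7 (reg 10)) (block [
      assign 7 (reg 6),
      guard [(add (reg 10) (const 1), reg 5)] (raise 7 (reg 10)),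
      pairLoop,
      guard [(reg 2, reg 3)] (block [
        assign 11 (reg 3),
        assign 12 (const 0),
        assign 14 (const 0),
        raiseOpt])])]

/-- For `r_s ≤ r_k`, register `7` starts with `r_s` in place of `⊥`. This does not falsify the
maximum, since `r_s ≤ W`. -/
theorem wp_optEntry {m : Mem} {k s g : ℕ} {W : ℤ} {V : ℕ → ℕ → WithBot ℤ} {u : ℕ → ℕ → ℤ}
    {nx : ℕ → ℕ → ℕ} (hm : I.Data m) (hk1 : 1 ≤ k) (hkn : k ≤ I.n) (hs1 : 1 ≤ s) (hsn : s ≤ I.n)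
    (hgn : g < I.n) (hk : m.reg 2 = k) (hs : m.reg 3 = s) (hg : m.reg 4 = g)
    (h0 : m.arr 0 [0] = I.d k)
    (hV : ∀ s g, 1 ≤ s → s ≤ I.n → g < I.n → V s g = u s g)
    (hnx : ∀ s g, 1 ≤ s → s ≤ I.n → g < I.n → I.IsNext k (u s g) (nx s g))
    (h3 : ∀ s g : ℕ, 1 ≤ s → s ≤ I.n → g < I.n → m.arr 3 [(s : ℤ), (k : ℤ) - 1, (g : ℤ)] = u s g)
    (h6 : ∀ s g : ℕ, 1 ≤ s → s ≤ I.n → g < I.n → m.arr 6 [(s : ℤ), (g : ℤ)] = nx s g)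
    (h4 : ∀ l h : ℕ, 1 ≤ l → l < k → h < I.n →
      m.arr 4 [(s : ℤ), (k : ℤ), (h : ℤ), (l : ℤ)] = encode (I.stepP k V l s h))
    (hW : I.stepU k V s g = W) (hsW : I.r s ≤ W) :
    optEntry.wp I.n (fun m' => (∀ y < 5, m'.reg y = m.reg y) ∧ m'.arr = m.arr ∧
      m'.reg 7 = W) m := by
  have hVs := hV s g hs1 hsn hgn
  simp [optEntry, block, wp, Expr.val, hk, hs, hg, hm.r k hk1 hkn, hm.r s hs1 hsn, hm.d k hk1 hkn,
    hm.p k hk1 hkn, h3 s g hs1 hsn hgn]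
  refine ⟨fun h => ⟨fun y hy => ?_, ?_⟩, fun hsk => ?_⟩
  · repeat rw [Function.update_of_ne (by omega)]
  · rw [stepU, if_pos h, hVs] at hW
    exact_mod_cast hW
  refine wp_guard_raise _ fun v hv => ?_
  simp [Expr.val] at hv
  refine wp.mono (wp_pairLoop (k := k) (s := s) (g := g) (W := W) (V := V) (u := u) (nx := nx)
    (hm.of_eq (by simp) rfl) hk1 hkn hgn (by simp [hk]) (by simp [hs]) (by simp [hg]) (by simp)
    (by simp) (by simp) (by simp) h0 hsk hV hnx h3 h6 h4 hW ?_) ?_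
  · simp only [Function.update_self]
    rw [← WithBot.coe_le_coe, hv]
    refine max_le (WithBot.coe_le_coe.2 hsW) ?_
    split_ifs with h
    · rw [← hVs, ← hW]
      refine le_stepU hsk ?_
      rw [hVs]
      exact_mod_cast h
    · exact bot_le
  · rintro m₁ ⟨f1, f2, f3, f4, f5⟩
    simp only [Function.update_self] at f4
    have hreg : ∀ y < 5, m₁.reg y = m.reg y := by
      intro y hy
      rw [f1 y (by omega) (by omega)]
      dsimp only
      repeat rw [Function.update_of_ne (by omega)]
    have e5 : m₁.reg 5 = I.r k := by rw [f1 5 (by omega) (by omega)]; simp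
    have e8 : m₁.reg 8 = I.d k := by rw [f1 8 (by omega) (by omega)]; simp
    have e9 : m₁.reg 9 = I.p k := by rw [f1 9 (by omega) (by omega)]; simp
    have hv7 : (if u s g < I.r k then (u s g : WithBot ℤ) else ⊥) ≤ (m₁.reg 7 : WithBot ℤ) :=
      (le_max_right _ _).trans (hv.ge.trans (WithBot.coe_le_coe.2 f4))
    have hopt1 : V s g < (I.r k : WithBot ℤ) → V s g ≤ (m₁.reg 7 : WithBot ℤ) := by
      intro h
      rw [hVs] at h ⊢
      rwa [if_pos (by exact_mod_cast h)] at hv7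
    rw [wp_guard]
    simp [Expr.val, hreg, hk, hs]
    refine ⟨fun hks => ?_, fun hks => ⟨hreg, f2, le_antisymm f3 ?_⟩⟩
    · simp only [wp, Expr.val]
      refine wp.mono (wp_raiseOpt (k := k) (g := g) (l := s) (h := 0) (q := 0) (u := u s)
          (nx := nx s) (V := V s) (by omega)
          (by simp [hreg, hk]) (by simp [hreg, hg]) (by simp [e5])
          (by simp [e8]) (by simp [e9]) (by simp [hreg, hs]) (by simp)
          (by simp) (fun h' hh' => hV s h' hs1 hsn (by omega))
          (fun h' hh' => hnx s h' hs1 hsn (by omega)) (fun h' hh' => ?_) (fun h' hh' => ?_)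
          (fun h' hh' => ?_)) ?_
      · simp only [f2]
        exact h3 s h' hs1 hsn (by omega)
      · simp only [f2]
        exact h6 s h' hs1 hsn (by omega)
      · simp only [f2]
        rw [nextVal]
        rcases hnx s h' hs1 hsn (by omega) with ⟨h1, -⟩ | ⟨h1, h2, -⟩
        · rw [if_pos h1, h1]
          exact h0
        · rw [if_neg (by omega), hm.r _ h1 (by omega)]
      · rintro m₂ ⟨g1, g2, g3⟩
        simp at g3
        refine ⟨fun y hy => ?_, g2.trans f2, ?_⟩
        · rw [g1 y (by omega) (by omega), ← hreg y hy]
          dsimp only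
          repeat rw [Function.update_of_ne (by omega)]
        · rw [← WithBot.coe_inj, g3]
          refine le_antisymm (max_le (WithBot.coe_le_coe.2 f3) ?_) ?_
          · rw [← hW]
            exact optU_zero_le_stepU hsk hks
          · rw [← hW]
            exact stepU_le hsk (fun h => le_max_of_le_left (hopt1 h))
              (fun l h h1 h2 h3 h4 => le_max_of_le_left (f5 l h h1 h2 h3 h4))
              (fun _ => le_max_right _ _)
    · rw [← WithBot.coe_le_coe, ← hW]
      exact stepU_le hsk hopt1 f5 (fun h => by omega)

/-- Fill the part of array `3` for job `k`. -/
def optStage : Prog :=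
  .for 3 (const 1) (reg 0) (.for 4 (const 0) (sub (reg 0) (const 1)) (block [
    optEntry,
    store 3 [reg 3, reg 2, reg 4] (reg 7)]))

theorem wp_optStage {m : Mem} {k : ℕ} {W : ℕ → ℕ → ℤ} {V : ℕ → ℕ → WithBot ℤ} {u : ℕ → ℕ → ℤ}
    {nx : ℕ → ℕ → ℕ} (hm : I.Data m) (hk1 : 1 ≤ k) (hkn : k ≤ I.n) (hk : m.reg 2 = k)
    (h0 : m.arr 0 [0] = I.d k)
    (hV : ∀ s g, 1 ≤ s → s ≤ I.n → g < I.n → V s g = u s g)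
    (hnx : ∀ s g, 1 ≤ s → s ≤ I.n → g < I.n → I.IsNext k (u s g) (nx s g))
    (h3 : ∀ s g : ℕ, 1 ≤ s → s ≤ I.n → g < I.n → m.arr 3 [(s : ℤ), (k : ℤ) - 1, (g : ℤ)] = u s g)
    (h6 : ∀ s g : ℕ, 1 ≤ s → s ≤ I.n → g < I.n → m.arr 6 [(s : ℤ), (g : ℤ)] = nx s g)
    (h4 : ∀ s l h : ℕ, 1 ≤ s → s ≤ I.n → 1 ≤ l → l < k → h < I.n →
      m.arr 4 [(s : ℤ), (k : ℤ), (h : ℤ), (l : ℤ)] = encode (I.stepP k V l s h))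
    (hW : ∀ s g, 1 ≤ s → s ≤ I.n → g < I.n → I.stepU k V s g = W s g)
    (hsW : ∀ s g, 1 ≤ s → s ≤ I.n → g < I.n → I.r s ≤ W s g) :
    optStage.wp I.n (fun m' => Upd m m' 3 3 {idx | ∃ s, 1 ≤ s ∧ s < I.n + 1 ∧
        idx ∈ {idx | ∃ g, 0 ≤ g ∧ g < I.n ∧
          idx ∈ ({[(s : ℤ), (k : ℤ), (g : ℤ)]} : Set (List ℤ))}}
      (fun idx v => ∀ s g : ℕ, idx = [(s : ℤ), (k : ℤ), (g : ℤ)] → v = W s g)) m := by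
  refine wp_fill (A := 1) (B := I.n + 1) _ _ (by simp [Expr.val]) (by omega) (by omega)
    (fun m' h => by simp [Expr.val, h, hm.n]) fun s m₁ hs1 hsn h₁ hs => ?_
  refine wp_fill (A := 0) (B := I.n) (fun g => {[(s : ℤ), (k : ℤ), (g : ℤ)]}) _ (by simp [Expr.val])
    (by omega) (by omega) (fun m' h => by simp [Expr.val, h, h₁.reg, hm.n])
    fun g m₂ _ hgn h₂ hg => ?_
  have hs₂ : m₂.reg 3 = s := (h₂.reg 3 (by omega)).trans hs
  have hk₂ : m₂.reg 2 = k := by rw [h₂.reg 2 (by omega), h₁.reg 2 (by omega), hk]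
  have hm₂ : I.Data m₂ := (hm.of_upd h₁ (by omega) (by omega)).of_upd h₂ (by omega) (by omega)
  have harr : ∀ a, a ≠ 3 → m₂.arr a = m.arr a := fun a ha => by
    rw [h₂.other a ha, h₁.other a ha]
  simp only [block, wp]
  refine wp.mono (wp_optEntry (k := k) (s := s) (g := g) (W := W s g) (V := V) (u := u) (nx := nx)
    hm₂ hk1 hkn hs1 (by omega) hgn hk₂ hs₂ hg (by rw [harr 0 (by omega), h0]) hV hnx
    (fun s' g' a b c => ?_) (fun s' g' a b c => by rw [harr 6 (by omega), h6 s' g' a b c])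
    (fun l h a b c => by rw [harr 4 (by omega), h4 s l h hs1 (by omega) a b c])
    (hW s g hs1 (by omega) hgn) (hsW s g hs1 (by omega) hgn)) ?_
  -- The stage reads entries for `k - 1` and writes only entries for `k` in the same array.
  · rw [h₂.out, h₁.out, h3 s' g' a b c]
    · rintro ⟨_, -, -, _, -, -, heq⟩
      simp at heq
    · rintro ⟨_, -, -, heq⟩
      simp at heq
  · rintro m₃ ⟨f1, f2, f3⟩
    simp only [Expr.val, List.map, f1 3 (by omega), f1 2 (by omega), f1 4 (by omega), hs₂, hk₂, hg]
    refine Upd.of_store f1 f2 ?_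
    intro s' g' heq
    simp only [List.cons.injEq, Nat.cast_inj, and_true, true_and] at heq
    obtain ⟨rfl, rfl⟩ := heq
    exact f3

end Jobs


/-! ### The program: sorting, initialization, answer and the total running time -/

open GapSched.Expr GapSched.Prog

namespace Jobs

variable {I : Jobs}

/-- Count the release times after the number in register `3`. -/
def rankLoop : Prog :=
  .for 5 (const 1) (reg 0) (block [
    load 6 0 [reg 5],
    guard [(add (reg 3) (const 1), reg 6)] (assign 4 (add (reg 4) (const 1)))])

/-- Sort the jobs by decreasing release times into array `5`. -/
def sortStage : Prog :=
  .for 2 (const 1) (reg 0) (block [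
    load 3 0 [reg 2],
    assign 4 (const 0),
    rankLoop,
    store 5 [reg 4] (reg 2)])

/-- The rank of a job is its position in array `5`. Distinct release times give distinct ranks, so
no cell is used for two jobs. -/
theorem wp_sortStage {m : Mem} (hI : I.Normalized) (hm : I.Data m) :
    sortStage.wp I.n (fun m' => Upd m m' 2 5 {idx | ∃ s, 1 ≤ s ∧ s < I.n + 1 ∧
        idx ∈ ({[(I.rank s : ℤ)]} : Set (List ℤ))}
      (fun idx v => ∀ s : ℕ, 1 ≤ s → s ≤ I.n → idx = [(I.rank s : ℤ)] → v = s)) m := by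
  refine wp_fill (A := 1) (B := I.n + 1) (fun s => {[(I.rank s : ℤ)]}) _ (by simp [Expr.val])
    (by omega) (by omega) (fun m' h => by simp [Expr.val, h, hm.n]) fun s m₁ hs1 hsn h₁ hs => ?_
  have hm₁ := hm.of_upd h₁ (by omega) (by omega)
  simp only [block, wp, Expr.val, List.map, hs, hm₁.r s hs1 (by omega)]
  refine wp.mono (wp_fold (a := 4) (A := 1) (B := I.n + 1)
    (fun i v => v = (((Finset.Ico 1 i).filter fun j => I.r s < I.r j).card : ℤ)) (by norm_num)
    (by simp [Expr.val]) (by omega) (by omega) (fun m' h => by simp [Expr.val, h, hm₁.n]) (by simp)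
    ?_) ?_
  · intro i m₂ hi hin hreg harr h5 h4
    have hri : m₂.arr 0 [(i : ℤ)] = I.r i := by rw [harr]; exact hm₁.r i hi (by omega)
    have h3 : m₂.reg 3 = I.r s := by rw [hreg 3 (by omega) (by omega)]; simp
    simp [block, wp, wp_guard, Expr.val, h3, h4, h5, hri,
      ← Finset.insert_Ico_right_eq_Ico_add_one hi, Finset.filter_insert]
    refine ⟨fun h => ⟨fun y hy hy' => ?_, ?_⟩, fun h => ⟨fun y hy hy' => ?_, ?_⟩⟩
    · repeat rw [Function.update_of_ne (by omega)]
    · rw [if_pos h, Finset.card_insert_of_notMem (by simp)]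
      simp
    · repeat rw [Function.update_of_ne (by omega)]
    · rw [if_neg (by omega)]
  · rintro m₂ ⟨f1, f2, f3⟩
    have e2 : m₂.reg 2 = s := by rw [f1 2 (by omega) (by omega)]; simp [hs]
    have e4 : m₂.reg 4 = I.rank s := f3
    rw [e2, e4]
    refine Upd.of_store (fun y hy => ?_) f2 ?_
    · rw [f1 y (by omega) (by omega)]
      dsimp only
      repeat rw [Function.update_of_ne (by omega)]
    · intro s' h1 h2 heq
      simp only [List.cons.injEq, Nat.cast_inj, and_true] at heq
      rw [hI.rank_injOn ⟨hs1, by omega⟩ ⟨h1, h2⟩ heq]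

/-- Fill array `3` for `k = 0`. -/
def initStage : Prog :=
  .for 2 (const 1) (reg 0) (.for 3 (const 0) (sub (reg 0) (const 1)) (block [
    load 4 0 [reg 2],
    store 3 [reg 2, const 0, reg 3] (reg 4)]))

theorem wp_initStage {m : Mem} (hm : I.Data m) :
    initStage.wp I.n (fun m' => Upd m m' 2 3 {idx | ∃ s, 1 ≤ s ∧ s < I.n + 1 ∧
        idx ∈ {idx | ∃ g, 0 ≤ g ∧ g < I.n ∧ idx ∈ ({[(s : ℤ), 0, (g : ℤ)]} : Set (List ℤ))}}
      (fun idx v => ∀ s g : ℕ, idx = [(s : ℤ), 0, (g : ℤ)] → v = I.r s)) m := by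
  refine wp_fill (A := 1) (B := I.n + 1) _ _ (by simp [Expr.val]) (by omega) (by omega)
    (fun m' h => by simp [Expr.val, h, hm.n]) fun s m₁ hs1 hsn h₁ hs => ?_
  refine wp_fill (A := 0) (B := I.n) (fun g => {[(s : ℤ), 0, (g : ℤ)]}) _ (by simp [Expr.val])
    (by omega) (by omega) (fun m' h => by simp [Expr.val, h, h₁.reg, hm.n])
    fun g m₂ _ hgn h₂ hg => ?_
  have hs₂ : m₂.reg 2 = s := (h₂.reg 2 (by omega)).trans hs
  have hm₂ : I.Data m₂ := (hm.of_upd h₁ (by omega) (by omega)).of_upd h₂ (by omega) (by omega)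
  simp [block, wp, Expr.val, hs₂, hg, hm₂.r s hs1 (by omega)]
  refine Upd.of_store (m' := ⟨Function.update m₂.reg 4 (I.r s), m₂.arr⟩) (fun y hy => ?_) rfl ?_
  · dsimp only
    repeat rw [Function.update_of_ne (by omega)]
  · intro s' g' heq
    simp only [List.cons.injEq, Nat.cast_inj, and_true, true_and] at heq
    rw [heq.1]

/-- The stages for job `k`. -/
def jobStage : Prog :=
  block [
    load 3 1 [reg 2],
    store 0 [const 0] (reg 3),
    nextStage,
    crowdedStage,
    amountStage,
    optStage]

/-- The memory holds the tables for the jobs before `i`. -/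
structure Tables (I : Jobs) (i : ℕ) (m : Mem) : Prop extends I.Data m where
  ord : ∀ s, 1 ≤ s → s ≤ I.n → m.arr 5 [(I.rank s : ℤ)] = s
  tableU : ∀ s k g : ℕ, 1 ≤ s → s ≤ I.n → k < i → g < I.n →
    m.arr 3 [(s : ℤ), (k : ℤ), (g : ℤ)] = I.U s k g
  tableP : ∀ s k g l : ℕ, 1 ≤ s → s ≤ I.n → 1 ≤ k → k < i → g < I.n → 1 ≤ l → l < k →
    m.arr 4 [(s : ℤ), (k : ℤ), (g : ℤ), (l : ℤ)] = encode (I.algP s k g l)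

theorem wp_jobStage {m : Mem} {k : ℕ} (hI : I.Normalized) (hk1 : 1 ≤ k) (hkn : k ≤ I.n)
    (hk : m.reg 2 = k) (hm : I.Tables k m) :
    jobStage.wp I.n (fun m' => I.Tables (k + 1) m' ∧ m'.reg 2 = k) m := by
  classical
  have hk' : ((k - 1 : ℕ) : ℤ) = (k : ℤ) - 1 := by omega
  have hV : ∀ s g, 1 ≤ s → s ≤ I.n → g < I.n → I.algU s (k - 1) g = I.U s (k - 1) g :=
    fun s g h1 h2 h3 => hI.algU_eq (by omega) h1 h2 h3
  have hu : ∀ s k' g, k' ≤ I.n → I.r s ≤ I.U s k' g :=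
    fun s k' g h => hI.le_of_mem_completions h (hI.U_mem h)
  have hW : ∀ s g, 1 ≤ s → s ≤ I.n → g < I.n →
      I.stepU k (fun s' g' => I.algU s' (k - 1) g') s g = I.U s k g := fun s g h1 h2 h3 => by
    rw [← hI.algU_eq hkn h1 h2 h3]
    obtain ⟨k, rfl⟩ := Nat.exists_eq_add_of_le' hk1
    rfl
  simp only [jobStage, block, wp, Expr.val, List.map, hk, hm.d k hk1 hkn, Function.update_self]
  -- The deadline `d_k` is written to cell `0` of the release times, as the sentinel for the stages
  -- of job `k`.
  set m₁ : Mem := ⟨Function.update m.reg 3 (I.d k), Function.update m.arr 0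
    (Function.update (m.arr 0) [0] (I.d k))⟩ with hm₁
  have a₁ : ∀ a, a ≠ 0 → m₁.arr a = m.arr a := fun a ha => Function.update_of_ne ha _ _
  have d₁ : I.Data m₁ := by
    refine ⟨?_, fun j h1 h2 => ?_, ?_, ?_⟩
    · simpa [hm₁] using hm.n
    · have : [(j : ℤ)] ≠ [0] := by simp; omega
      simpa [hm₁, Function.update_of_ne this] using hm.r j h1 h2
    · rw [a₁ 1 (by omega)]
      exact hm.d
    · rw [a₁ 2 (by omega)]
      exact hm.p
  have k₁ : m₁.reg 2 = k := by simp [hm₁, hk]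
  have z₁ : m₁.arr 0 [0] = I.d k := by simp [hm₁]
  have u₁ : ∀ s g : ℕ, 1 ≤ s → s ≤ I.n → g < I.n →
      m₁.arr 3 [(s : ℤ), (k : ℤ) - 1, (g : ℤ)] = I.U s (k - 1) g := fun s g h1 h2 h3 => by
    rw [a₁ 3 (by omega), ← hk', hm.tableU s (k - 1) g h1 h2 (by omega) h3]
  refine wp.mono (wp_nextStage (k := k) (u := fun s g => I.U s (k - 1) g) hI d₁ hk1 hkn k₁ z₁ u₁) ?_
  intro m₂ h₂
  have d₂ := d₁.of_upd h₂ (by omega) (by omega)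
  have k₂ : m₂.reg 2 = k := (h₂.reg 2 (by omega)).trans k₁
  refine wp.mono (wp_crowdedStage d₂ hk1 hkn k₂) ?_
  intro m₃ h₃
  have d₃ := d₂.of_upd h₃ (by omega) (by omega)
  have k₃ : m₃.reg 2 = k := (h₃.reg 2 (by omega)).trans k₂
  have a₃ : ∀ a, a ≠ 6 → a ≠ 7 → m₃.arr a = m₁.arr a := fun a h1 h2 => by
    rw [h₃.other a h2, h₂.other a h1]
  have hnext : ∀ s g : ℕ, ∃ j : ℕ, 1 ≤ s → s ≤ I.n → g < I.n →
      m₃.arr 6 [(s : ℤ), (g : ℤ)] = j ∧ I.IsNext k (I.U s (k - 1) g) j := by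
    intro s g
    by_cases h : 1 ≤ s ∧ s ≤ I.n ∧ g < I.n
    · obtain ⟨j, h1, h2⟩ := h₂.mem [(s : ℤ), (g : ℤ)]
        ⟨s, h.1, by omega, g, by omega, h.2.2, rfl⟩ s g rfl
      exact ⟨j, fun _ _ _ => ⟨by rw [h₃.other 6 (by omega), h1], h2⟩⟩
    · exact ⟨0, fun h1 h2 h3 => absurd ⟨h1, h2, h3⟩ h⟩
  choose nx hnx using hnext
  have z₃ : m₃.arr 0 [0] = I.d k := by rw [a₃ 0 (by omega) (by omega), z₁]
  have u₃ : ∀ s g : ℕ, 1 ≤ s → s ≤ I.n → g < I.n →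
      m₃.arr 3 [(s : ℤ), (k : ℤ) - 1, (g : ℤ)] = I.U s (k - 1) g := fun s g h1 h2 h3 => by
    rw [a₃ 3 (by omega) (by omega), u₁ s g h1 h2 h3]
  refine wp.mono (wp_amountStage hI d₃ hk1 hkn k₃ z₃ hV
    (fun s g _ _ _ => hu s (k - 1) g (by omega)) (fun s g a b c => (hnx s g a b c).2)
    (fun s h1 h2 => ?_) u₃ (fun s g a b c => (hnx s g a b c).1) (fun s l a b c d => ?_)) ?_
  · rw [a₃ 5 (by omega) (by omega), a₁ 5 (by omega), hm.ord s h1 h2]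
  · exact h₃.mem [(s : ℤ), (l : ℤ)] ⟨l, c, d, s, a, by omega, rfl⟩ s l rfl
  intro m₄ h₄
  have d₄ := d₃.of_upd h₄ (by omega) (by omega)
  have k₄ : m₄.reg 2 = k := (h₄.reg 2 (by omega)).trans k₃
  have p₄ : ∀ s l h : ℕ, 1 ≤ s → s ≤ I.n → 1 ≤ l → l < k → h < I.n →
      m₄.arr 4 [(s : ℤ), (k : ℤ), (h : ℤ), (l : ℤ)] =
        encode (I.stepP k (fun s' g' => I.algU s' (k - 1) g') l s h) := fun s l h a b c d e =>
    h₄.mem _ ⟨l, c, d, I.rank s, by omega, rank_lt a b, s, h, a, b, rfl, e, rfl⟩ s h l a b e rfl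
  refine wp.mono (wp_optStage (W := fun s g => I.U s k g) d₄ hk1 hkn k₄
    (by rw [h₄.other 0 (by omega), z₃]) hV (fun s g a b c => (hnx s g a b c).2)
    (fun s g a b c => by rw [h₄.other 3 (by omega), u₃ s g a b c])
    (fun s g a b c => by rw [h₄.other 6 (by omega), (hnx s g a b c).1]) p₄ hW
    (fun s g _ _ _ => hu s k g hkn)) ?_
  intro m₅ h₅
  have a₅ : ∀ a, a ≠ 0 → a ≠ 3 → a ≠ 4 → a ≠ 6 → a ≠ 7 → m₅.arr a = m.arr a :=
    fun a h1 h2 h3 h4 h5 => by rw [h₅.other a h2, h₄.other a h3, a₃ a h4 h5, a₁ a h1]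
  refine ⟨⟨d₄.of_upd h₅ (by omega) (by omega), fun s h1 h2 => ?_, fun s k' g h1 h2 h3 h4 => ?_,
    fun s k' g l h1 h2 h3 h4 h5 h6 h7 => ?_⟩, (h₅.reg 2 (by omega)).trans k₄⟩
  · rw [a₅ 5 (by omega) (by omega) (by omega) (by omega) (by omega), hm.ord s h1 h2]
  · rcases Nat.lt_succ_iff_lt_or_eq.1 h3 with h | rfl
    · rw [h₅.out, h₄.other 3 (by omega), a₃ 3 (by omega) (by omega), a₁ 3 (by omega),
        hm.tableU s k' g h1 h2 h h4]
      rintro ⟨_, -, -, _, -, -, heq⟩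
      simp only [Set.mem_singleton_iff, List.cons.injEq, Nat.cast_inj] at heq
      omega
    · exact h₅.mem _ ⟨s, h1, by omega, g, by omega, h4, rfl⟩ s g rfl
  · rw [h₅.other 4 (by omega)]
    rcases Nat.lt_succ_iff_lt_or_eq.1 h4 with h | rfl
    · rw [h₄.out, a₃ 4 (by omega) (by omega), a₁ 4 (by omega),
        hm.tableP s k' g l h1 h2 h3 h h5 h6 h7]
      rintro ⟨_, -, -, _, -, -, _, _, -, -, -, -, heq⟩
      simp only [List.cons.injEq, Nat.cast_inj] at heq
      omega
    · exact p₄ s l g h1 h2 h6 h7 h5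

/-- Compute the answer in register `1`. -/
def answerStage : Prog :=
  block [
    load 2 0 [const 1],
    .for 3 (const 1) (reg 0) (block [
      load 4 0 [reg 3],
      raise 2 (reg 4)]),
    assign 1 (const (-1)),
    .for 3 (const 0) (sub (reg 0) (const 1)) (block [
      load 4 3 [const 1, reg 0, reg 3],
      ite (const 0) (reg 1) skip (guard [(add (reg 2) (const 1), reg 4)] (assign 1 (reg 3)))])]

/-- Register `1` is `-1` until the first suitable `g` is found, and it does not change afterwards.
-/
theorem wp_answerStage {m : Mem} (hI : I.Normalized) (hm : I.Tables (I.n + 1) m) :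
    answerStage.wp I.n (fun m' => m'.arr = m.arr ∧ m'.reg 1 = encode I.algGaps) m := by
  have hn := hI.one_le_n
  have hr1 := hm.r 1 le_rfl hn
  simp only [Nat.cast_one] at hr1
  simp only [answerStage, block, wp, Expr.val, List.map, hr1]
  refine wp.mono (wp_fold (a := 2) (A := 1) (B := I.n + 1) (fun i v =>
    (∀ j, 1 ≤ j → j < i → I.r j ≤ v) ∧ ∃ j, 1 ≤ j ∧ j ≤ I.n ∧ v = I.r j) (by norm_num)
    (by simp [Expr.val]) (by omega) (by omega) (fun m' h => by simp [Expr.val, h, hm.n])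
    ⟨by omega, 1, le_rfl, hn, by simp⟩ ?_) ?_
  · rintro i m₁ hi hin hreg harr h3 ⟨h1, j, hj1, hjn, h2⟩
    have hri : m₁.arr 0 [(i : ℤ)] = I.r i := by rw [harr]; exact hm.r i hi (by omega)
    simp only [wp, List.map, Expr.val, h3, hri]
    refine wp_raise ?_
    simp [Expr.val]
    refine ⟨fun y hy hy' => ?_, fun j' hj' hji => ?_, ?_⟩
    · repeat rw [Function.update_of_ne (by omega)]
    · rcases hji.lt_or_eq with h | rfl
      · exact Or.inl (h1 j' hj' h)
      · exact Or.inr le_rfl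
    · rcases le_total (m₁.reg 2) (I.r i) with h | h
      · exact ⟨i, hi, by omega, max_eq_right h⟩
      · exact ⟨j, hj1, hjn, by rw [max_eq_left h, h2]⟩
  · rintro m₁ ⟨f1, f2, f3, j, hj1, hjn, f4⟩
    have hcond : ∀ g < I.n, ((Finset.Icc 1 I.n).sup (fun j => (I.r j : WithBot ℤ)) <
        I.algU 1 I.n g ↔ m₁.reg 2 < I.U 1 I.n g) := by
      intro g hg
      rw [hI.algU_eq le_rfl le_rfl hn hg, Finset.sup_lt_iff (WithBot.bot_lt_coe _)]
      simp only [Finset.mem_Icc, WithBot.coe_lt_coe]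
      constructor
      · intro h
        rw [f4]
        exact h j ⟨hj1, hjn⟩
      · intro h j' hj'
        exact (f3 j' hj'.1 (by omega)).trans_lt h
    have n₁ : m₁.reg 0 = I.n := by rw [f1 0 (by omega) (by omega)]; simp [hm.n]
    refine wp.mono (wp_fold (a := 1) (A := 0) (B := I.n) (fun i v =>
      (v = -1 ∧ ∀ g < i, ¬ m₁.reg 2 < I.U 1 I.n g) ∨
      ∃ g₀ : ℕ, v = g₀ ∧ g₀ < i ∧ m₁.reg 2 < I.U 1 I.n g₀ ∧ ∀ g < g₀, ¬ m₁.reg 2 < I.U 1 I.n g)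
      (by norm_num) (by simp [Expr.val]) (by omega) (by omega)
      (fun m' h => by simp [Expr.val, h, n₁]) (Or.inl ⟨by simp, by omega⟩) ?_) ?_
    · rintro i m₂ - hin hreg harr h3 h1
      have n₂ : m₂.reg 0 = I.n := by rw [hreg 0 (by omega) (by omega)]; simp [n₁]
      have e2 : m₂.reg 2 = m₁.reg 2 := by rw [hreg 2 (by omega) (by omega)]; simp
      have hUi := hm.tableU 1 I.n i le_rfl hn (by omega) hin
      simp only [Nat.cast_one] at hUi
      have hui : m₂.arr 3 [1, (I.n : ℤ), (i : ℤ)] = I.U 1 I.n i := by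
        rw [harr]
        simp only [f2]
        exact hUi
      simp [wp, wp_guard, Expr.val, n₂, h3, hui, e2]
      rcases h1 with ⟨h1, h4⟩ | ⟨g₀, h1, h4, h5, h6⟩
      · rw [h1]
        refine ⟨by omega, fun _ => ⟨fun h => ⟨fun y hy hy' => ?_, ?_⟩,
          fun h => ⟨fun y hy hy' => ?_, Or.inl ⟨rfl, fun g hg => ?_⟩⟩⟩⟩
        · repeat rw [Function.update_of_ne (by omega)]
        · exact ⟨h, fun g hg => not_lt.1 (h4 g hg)⟩
        · repeat rw [Function.update_of_ne (by omega)]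
        · rcases hg.lt_or_eq with h' | rfl
          · exact not_lt.1 (h4 g h')
          · exact h
      · rw [h1]
        refine ⟨fun _ => ⟨fun y hy hy' => ?_, Or.inr ⟨g₀, rfl, h4.le, h5, fun g hg =>
          not_lt.1 (h6 g hg)⟩⟩, by omega⟩
        repeat rw [Function.update_of_ne (by omega)]
    · rintro m₂ ⟨-, g2, g3⟩
      refine ⟨g2.trans f2, ?_⟩
      rw [algGaps]
      rcases g3 with ⟨g3, g4⟩ | ⟨g₀, g3, g4, g5, g6⟩
      · rw [Finset.filter_false_of_mem, Finset.inf_empty, encode_top, g3]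
        intro g hg
        rw [Finset.mem_range] at hg
        rw [hcond g hg]
        exact g4 g hg
      · rw [g3, ← encode_natCast g₀]
        congr 1
        refine le_antisymm (Finset.le_inf fun g hg => ?_) (Finset.inf_le ?_)
        · rw [Finset.mem_filter, Finset.mem_range] at hg
          rw [hcond g hg.1] at hg
          by_contra hlt
          exact g6 g (by exact_mod_cast not_le.1 hlt) hg.2
        · rw [Finset.mem_filter, Finset.mem_range, hcond g₀ g4]
          exact ⟨g4, g5⟩

/-- The algorithm. -/
def algorithm : Prog :=
  block [
    sortStage,
    initStage,
    .for 2 (const 1) (reg 0) jobStage,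
    answerStage]

theorem data_input (I : Jobs) : I.Data I.input := by
  refine ⟨by simp [input], fun j h1 h2 => ?_, fun j h1 h2 => ?_, fun j h1 h2 => ?_⟩ <;>
  simp [input] <;> omega

theorem wp_algorithm (hI : I.Normalized) : algorithm.wp I.n I.HoldsResults I.input := by
  simp only [algorithm, block, wp]
  refine wp.mono (wp_sortStage hI I.data_input) fun m₁ h₁ => ?_
  have d₁ := I.data_input.of_upd h₁ (by omega) (by omega)
  refine wp.mono (wp_initStage d₁) fun m₂ h₂ => ?_
  have d₂ := d₁.of_upd h₂ (by omega) (by omega)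
  refine wp.mono (wp_for (A := 1) (B := I.n + 1) (fun i m => I.Tables i m) (by simp [Expr.val])
    (by omega) (by omega) ⟨d₂, fun s h1 h2 => ?_, fun s k g h1 h2 h3 h4 => ?_, ?_⟩
    (fun i m v h => ⟨h.toData.of_eq (by simp) rfl, h.ord, h.tableU, h.tableP⟩)
    (fun i m h => by simp [Expr.val, h.n])
    (fun k m hk1 hkn h hk => wp_jobStage hI hk1 (by omega) hk h)) fun m₃ h₃ => ?_
  · rw [h₂.other 5 (by omega)]
    exact h₁.mem _ ⟨s, h1, by omega, rfl⟩ s h1 h2 rfl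
  · obtain rfl : k = 0 := by omega
    have hU : I.U s 0 g = I.r s := by
      have := hI.algU_eq (Nat.zero_le I.n) h1 h2 h4
      rw [algU] at this
      exact_mod_cast this.symm
    rw [hU]
    exact h₂.mem _ ⟨s, h1, by omega, g, by omega, h4, rfl⟩ s g rfl
  · intro s k g l _ _ h3 h4
    omega
  · refine wp.mono (wp_answerStage hI h₃) fun m₄ ⟨h4, h5⟩ => ⟨fun s k g h6 h7 h8 h9 => ?_,
      fun s k g l h6 h7 h8 h9 h10 h11 h12 _ => ?_, h5⟩
    · rw [h4, h₃.tableU s k g h6 h7 (by omega) h9, hI.algU_eq h8 h6 h7 h9]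
    · rw [h4, h₃.tableP s k g l h6 h7 h8 (by omega) h10 h11 h12]

/-- Depth five is attained three times, always inside the loop over `k`: by `l`, `s`, `i`, `j` for
the crowded pairs, by `l`, the rank of `s`, `g`, `h` for `P`, and by `s`, `g`, `l`, `h` for `U`. -/
theorem depth_algorithm : algorithm.depth = 5 := by
  simp [algorithm, sortStage, rankLoop, initStage, jobStage, nextStage, nextLoop, crowdedStage,
    crowdedLoop, sumLoop, amountStage, amountEntry, minLoop, optStage, optEntry, pairLoop, raiseOpt,
    answerStage, block, Prog.for, Prog.guard, raise, depth]

end Jobs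

end GapSched

theorem mainTheorem2 :
    (∀ I : GapSched.Jobs, I.Normalized →
      (∀ s k g : ℕ, 1 ≤ s → s ≤ I.n → k ≤ I.n → g < I.n →
        IsGreatest (I.completions s k g) (I.U s k g) ∧
          I.algU s k g = (I.U s k g : WithBot ℤ)) ∧
      (∀ s k g l : ℕ, 1 ≤ s → s ≤ I.n → 1 ≤ k → k ≤ I.n → g < I.n → 1 ≤ l → l < k →
        I.r s ≤ I.r l → I.algP s k g l = I.P s k g l) ∧
      (∃ m : ℕ, I.algGaps = (m : ℕ∞) ∧
        IsLeast {x : ℕ | ∃ S, I.IsSchedule S ∧ x = S.gaps.ncard} m ∧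
        IsLeast {E : ℤ | ∃ S, I.IsSchedule S ∧ E = GapSched.Schedule.energy 1 S} (m : ℤ))) ∧
    (∃ (c : GapSched.Prog) (K : ℕ), ∀ I : GapSched.Jobs, I.Normalized →
      ∃ (t : ℕ) (m : GapSched.Mem), GapSched.Runs c I.input t m ∧ t ≤ K * I.n ^ 5 ∧
        I.HoldsResults m) := by
  refine ⟨fun I hI => ⟨fun s k g hs1 hsn hkn hgn => ⟨hI.isGreatest_U hkn, hI.algU_eq hkn hs1 hsn hgn⟩,
    fun s k g l hs1 hsn hk1 hkn hgn hl1 hlk hsl => hI.algP_eq hs1 hsn hk1 hkn hgn hl1 hlk hsl, ?_⟩,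
    GapSched.Jobs.algorithm, GapSched.Jobs.algorithm.factor, fun I hI => ?_⟩
  · obtain ⟨m, hm, ⟨S, hS, hSm⟩, hmin⟩ := hI.algGaps_spec
    refine ⟨m, hm, ⟨⟨S, hS, hSm⟩, hmin⟩, ⟨S, hS, ?_⟩, ?_⟩
    · rw [GapSched.Schedule.energy_one, hSm]
    · rintro E ⟨S', hS', rfl⟩
      rw [GapSched.Schedule.energy_one]
      exact_mod_cast hmin ⟨S', hS', rfl⟩
  · obtain ⟨t, m, hr, ht, hm⟩ := (GapSched.Jobs.wp_algorithm hI).reaches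
    exact ⟨t, m, hr, GapSched.Jobs.depth_algorithm ▸ ht.trans (GapSched.Prog.bound_le hI.one_le_n _), hm⟩
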